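/- Let $n\ge 1$ and $0<\lambda\le\Lambda<\infty$, let $B_1$ be the open unit ball of $\mathbb R^n$, and let $\mathcal P^{\pm}$ be the Pucci extremal operators: for a symmetric matrix $X$ with eigenvalues $e_i$, $$\mathcal P^+(X)=\lambda\sum_{e_i<0}e_i+\Lambda\sum_{e_i>0}e_i,\qquad \mathcal P^-(X)=\lambda\sum_{e_i>0}e_i+\Lambda\sum_{e_i<0}e_i .$$ There is a constant $\sigma=\sigma(n,\lambda,\Lambda)\in(0,1]$, and for every $\delta\in(0,\sigma)$ a constant $C=C(n,\lambda,\Lambda,\delta)>0$, such that the following holds for every $0\le\gamma<1$. Let $u\in C^0(\overline{B_1})$ and $f\in C^0(B_1)\cap L^\infty(B_1)$ satisfy $$|Du|^{-\gamma}\mathcal P^-(D^2u)-|Du|^{1-\gamma}\le f\le |Du|^{-\gamma}\mathcal P^+(D^2u)+|Du|^{1-\gamma}\quad\text{in }B_1$$ in the viscosity sense: for every $\varphi\in C^2(B_1)$ and $x_0\in B_1$ such that $\varphi$ touches $u$ at $x_0$ from below (resp. from above) in a neighbourhood of $x_0$, the left (resp. right) inequality holds at $x_0$ with $D\varphi(x_0),D^2\varphi(x_0)$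 in place of $Du,D^2u$; if $\gamma>0$, only $\varphi$ with $D\varphi(x_0)\ne0$ are tested. Then $u\in W^{2,\delta}(B_1)$ and $$\|u\|_{W^{2,\delta}(B_1)}\le C\Big(\|u\|_{L^\infty(B_1)}+\|f\|_{L^\infty(B_1)}^{\frac1{1-\gamma}}\Big).$$ Here, as $\delta<1$, $u\in W^{2,\delta}(B_1)$ means that $u$ has a second-order Taylor expansion (with error $o(|y-x|^2)$ as $y\to x$) at almost every $x\in B_1$, and that $u$ and the resulting measurable functions $D_iu$, $D_{ij}u$ belong to $L^\delta(B_1)$, with $$\|u\|_{W^{2,\delta}(B_1)}=\Big(\int_{B_1}|u|^\delta+\sum_i\int_{B_1}|D_iu|^\delta+\sum_{i,j}\int_{B_1}|D_{ij}u|^\delta\Big)^{1/\delta}.$$ Moreover the same bound holds for $\|\Theta\|_{L^\delta(B_1)}$, where $\Theta(x)\in[0,\infty]$ is the infimum of all $M\ge0$ for which there are $p,q\in\mathbb R^n$ with $$u(x)+p\cdot(y-x)-\tfrac M2|y-x|^2\le u(y)\le u(x)+q\cdot(y-x)+\tfrac M2|y-x|^2\quad\text{for all }y\in B_1 .$$ 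-/

import Mathlib

open MeasureTheory Metric Topology Asymptotics
open scoped ENNReal NNReal

/-- The maximal Pucci extremal operator with ellipticity constants `lam ≤ Lam`, evaluated on a
real symmetric matrix through its eigenvalues (counted with multiplicity). It is only ever
evaluated on symmetric matrices; the value `0` elsewhere is a convention. -/
noncomputable def pucciMax {n : ℕ} (lam Lam : ℝ) (X : Matrix (Fin n) (Fin n) ℝ) : ℝ :=
  open Classical in
  if h : X.IsHermitian then
    lam * (∑ i with h.eigenvalues i < 0, h.eigenvalues i)
      + Lam * (∑ i with 0 < h.eigenvalues i, h.eigenvalues i)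
  else 0

/-- The minimal Pucci extremal operator. -/
noncomputable def pucciMin {n : ℕ} (lam Lam : ℝ) (X : Matrix (Fin n) (Fin n) ℝ) : ℝ :=
  open Classical in
  if h : X.IsHermitian then
    lam * (∑ i with 0 < h.eigenvalues i, h.eigenvalues i)
      + Lam * (∑ i with h.eigenvalues i < 0, h.eigenvalues i)
  else 0

/-- The classical Hessian matrix of `φ` at `x`, with entries `D_i D_j φ (x)`. -/
noncomputable def hessianMatrix {n : ℕ} (φ : EuclideanSpace ℝ (Fin n) → ℝ)
    (x : EuclideanSpace ℝ (Fin n)) : Matrix (Fin n) (Fin n) ℝ :=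
  Matrix.of fun i j =>
    fderiv ℝ (fderiv ℝ φ) x (EuclideanSpace.single i 1) (EuclideanSpace.single j 1)

/-- The Hessian matrix of a function that is `C²` in an open set is symmetric there. -/
theorem hessianMatrix_isHermitian {n : ℕ} {φ : EuclideanSpace ℝ (Fin n) → ℝ}
    {Ω : Set (EuclideanSpace ℝ (Fin n))} (hΩ : IsOpen Ω) (hφ : ContDiffOn ℝ 2 φ Ω)
    {x : EuclideanSpace ℝ (Fin n)} (hx : x ∈ Ω) : (hessianMatrix φ x).IsHermitian := by
  have h : IsSymmSndFDerivAt ℝ φ x :=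
    (hφ.contDiffAt (hΩ.mem_nhds hx)).isSymmSndFDerivAt (by simp)
  ext i j
  simpa [hessianMatrix] using h.eq _ _

/-- `v` touches `w` from below at `x₀` in `U`. -/
def TouchesFromBelow {n : ℕ} (v w : EuclideanSpace ℝ (Fin n) → ℝ)
    (x₀ : EuclideanSpace ℝ (Fin n)) (U : Set (EuclideanSpace ℝ (Fin n))) : Prop :=
  x₀ ∈ U ∧ v x₀ = w x₀ ∧ ∀ x ∈ U, v x ≤ w x

/-- `|Du|^{-γ} P^-(D²u) - |Du|^{1-γ} ≤ f` in `Ω` in the viscosity sense: the inequality holds at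
`x₀` for every `C²` function `φ` touching `u` from below at `x₀` in a neighbourhood of `x₀`. When
`γ > 0` the left-hand side has no meaning where `Dφ(x₀) = 0`, and such `φ` are not tested; when
`γ = 0` the inequality is `P^-(D²u) - |Du| ≤ f` and all `φ` are tested. -/
def IsViscositySupersol {n : ℕ} (lam Lam γ : ℝ) (Ω : Set (EuclideanSpace ℝ (Fin n)))
    (f u : EuclideanSpace ℝ (Fin n) → ℝ) : Prop :=
  ∀ φ : EuclideanSpace ℝ (Fin n) → ℝ, ContDiffOn ℝ 2 φ Ω →
    ∀ x₀ ∈ Ω, ∀ U : Set (EuclideanSpace ℝ (Fin n)), IsOpen U → U ⊆ Ω →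
      TouchesFromBelow φ u x₀ U → (γ = 0 ∨ gradient φ x₀ ≠ 0) →
        ‖gradient φ x₀‖ ^ (-γ) * pucciMin lam Lam (hessianMatrix φ x₀)
          - ‖gradient φ x₀‖ ^ (1 - γ) ≤ f x₀

/-- `f ≤ |Du|^{-γ} P^+(D²u) + |Du|^{1-γ}` in `Ω` in the viscosity sense: the same with `C²`
functions `φ` touching `u` from above. -/
def IsViscositySubsol {n : ℕ} (lam Lam γ : ℝ) (Ω : Set (EuclideanSpace ℝ (Fin n)))
    (f u : EuclideanSpace ℝ (Fin n) → ℝ) : Prop :=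
  ∀ φ : EuclideanSpace ℝ (Fin n) → ℝ, ContDiffOn ℝ 2 φ Ω →
    ∀ x₀ ∈ Ω, ∀ U : Set (EuclideanSpace ℝ (Fin n)), IsOpen U → U ⊆ Ω →
      TouchesFromBelow u φ x₀ U → (γ = 0 ∨ gradient φ x₀ ≠ 0) →
        f x₀ ≤ ‖gradient φ x₀‖ ^ (-γ) * pucciMax lam Lam (hessianMatrix φ x₀)
          + ‖gradient φ x₀‖ ^ (1 - γ)

/-- `u` has at `x` the second-order Taylor expansion
`u(y) = u(x) + p·(y - x) + (y - x)ᵀ A (y - x) / 2 + o(|y - x|²)` with `A` symmetric; `p` and `A`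
are then unique, and they are the pointwise gradient and Hessian of `u` at `x`. -/
def HasSecondOrderExpansionAt {n : ℕ} (u : EuclideanSpace ℝ (Fin n) → ℝ)
    (x p : EuclideanSpace ℝ (Fin n)) (A : Matrix (Fin n) (Fin n) ℝ) : Prop :=
  A.IsSymm ∧
    (fun y => u y - u x - ∑ i, p i * (y i - x i)
        - (1 / 2) * ∑ i, ∑ j, A i j * (y i - x i) * (y j - x j))
      =o[𝓝 x] fun y => ‖y - x‖ ^ 2

/-- The measurable functions `Du`, `D2u` are the gradient and the Hessian of `u` almost everywhere
in `Ω`. They are determined by `u` up to null sets. -/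
structure IsGradHess {n : ℕ} (Ω : Set (EuclideanSpace ℝ (Fin n)))
    (u : EuclideanSpace ℝ (Fin n) → ℝ)
    (Du : EuclideanSpace ℝ (Fin n) → EuclideanSpace ℝ (Fin n))
    (D2u : EuclideanSpace ℝ (Fin n) → Matrix (Fin n) (Fin n) ℝ) : Prop where
  aemeasurable_grad : ∀ i, AEMeasurable (fun x => Du x i) (volume.restrict Ω)
  aemeasurable_hess : ∀ i j, AEMeasurable (fun x => D2u x i j) (volume.restrict Ω)
  expansion : ∀ᵐ x ∂(volume.restrict Ω), HasSecondOrderExpansionAt u x (Du x) (D2u x)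

/-- Membership in `W^{2,δ}(Ω)` for an exponent `0 < δ < 1`. Functions in `L^δ` need not be locally
integrable, so that the derivatives are the pointwise ones, which have to exist almost everywhere
in `Ω`; the function and its derivatives of order one and two have to lie in `L^δ(Ω)`. -/
def MemSobolevTwo {n : ℕ} (δ : ℝ) (Ω : Set (EuclideanSpace ℝ (Fin n)))
    (u : EuclideanSpace ℝ (Fin n) → ℝ) : Prop :=
  ∃ (Du : EuclideanSpace ℝ (Fin n) → EuclideanSpace ℝ (Fin n))
    (D2u : EuclideanSpace ℝ (Fin n) → Matrix (Fin n) (Fin n) ℝ),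
    IsGradHess Ω u Du D2u ∧
      MemLp u (ENNReal.ofReal δ) (volume.restrict Ω) ∧
      (∀ i, MemLp (fun x => Du x i) (ENNReal.ofReal δ) (volume.restrict Ω)) ∧
      ∀ i j, MemLp (fun x => D2u x i j) (ENNReal.ofReal δ) (volume.restrict Ω)

/-- The quasi-norm of `W^{2,δ}(Ω)`,
`(∫ |u|^δ + ∑ i, ∫ |D_i u|^δ + ∑ i j, ∫ |D_ij u|^δ)^{1/δ}` with integrals over `Ω`. The infimum is
over versions of the almost everywhere unique derivatives, which all give the same value; it is
`∞` if there are none. -/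
noncomputable def sobolevTwoNorm {n : ℕ} (δ : ℝ) (Ω : Set (EuclideanSpace ℝ (Fin n)))
    (u : EuclideanSpace ℝ (Fin n) → ℝ) : ℝ≥0∞ :=
  ⨅ (Du : EuclideanSpace ℝ (Fin n) → EuclideanSpace ℝ (Fin n))
    (D2u : EuclideanSpace ℝ (Fin n) → Matrix (Fin n) (Fin n) ℝ)
    (_ : IsGradHess Ω u Du D2u),
    ((∫⁻ x in Ω, ‖u x‖ₑ ^ δ) + (∑ i, ∫⁻ x in Ω, ‖Du x i‖ₑ ^ δ)
      + ∑ i, ∑ j, ∫⁻ x in Ω, ‖D2u x i j‖ₑ ^ δ) ^ (1 / δ)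

/-- `paraboloidOpening u Ω x` is the least opening `M ∈ [0, ∞]` such that a concave and a convex
paraboloid of opening `M` touch `u` at `x` in `Ω` from below and from above. -/
noncomputable def paraboloidOpening {n : ℕ} (u : EuclideanSpace ℝ (Fin n) → ℝ)
    (Ω : Set (EuclideanSpace ℝ (Fin n))) (x : EuclideanSpace ℝ (Fin n)) : ℝ≥0∞ :=
  ⨅ (M : ℝ≥0)
    (_ : (∃ p : EuclideanSpace ℝ (Fin n), TouchesFromBelow
          (fun y => u x + inner ℝ p (y - x) - (M : ℝ) / 2 * ‖y - x‖ ^ 2) u x Ω) ∧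
        ∃ q : EuclideanSpace ℝ (Fin n), TouchesFromBelow
          u (fun y => u x + inner ℝ q (y - x) + (M : ℝ) / 2 * ‖y - x‖ ^ 2) x Ω),
    (M : ℝ≥0∞)

/-! Multiplying the singular inequalities by |Du|^γ and applying Young's inequality turns them into
P⁻(D²v) ≤ K + 2|Dv| for v = u and v = -u, where K bounds |u| and |f|^(1/(1-γ)). The exponent γ has
disappeared, and with it any dependence of the constants on γ. Test functions with zero gradient,
excluded by the hypothesis when γ > 0, are recovered by a perturbation (`subjetBound_of_ne_zero`).
The inequality is homogeneous, so K = 1 and |u| ≤ 1 may be assumed.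

The heart of the matter is the decay in a of the measure of the set where no concave paraboloid of
opening a touches u from below. Write a = S². Since |u| ≤ 1, a touching paraboloid has slope at most
2S at points of distance 2/S or more from the boundary; for large S the first order term is
therefore negligible against a. On a paraboloid touching at x₁ one puts a Gaussian bump centred at a
nearby x₀, and slides paraboloids of opening a, with vertices in a small ball around x₀, under the
difference of u and this barrier. The bump and the equation force the contact points into the same
small ball, and at each of them u is touched by a paraboloid of opening κa. The equation bounds the
Jacobian of the map from contact points to vertices, so the contact points occupy a fixed fraction
of the ball (`volume_vertices_le`, `density_of_touch`). A Vitali covering turns this into a gain of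
a factor less than 1 in the measure of the untouched set when a becomes κa (`volume_step`), and
iteration gives geometric decay (`exists_volume_decay`).

The function u has no derivatives to begin with. Wherever a function is touched from both sides by
paraboloids of a fixed opening, its slope is Lipschitz; at density points of such a set where the
slope is differentiable, the function has a second order expansion (`second_order_of_thick`). This
is used twice: for an inf-convolution in the Jacobian estimate, and for u itself, touched from both
sides almost everywhere because the decay holds for u and -u (`exists_isGradHess`). The opening
bounds the Hessian, and the decay makes its power δ integrable as soon as κ^δ q < 1, which
determines σ. -/

/-! ### Quadratic forms and Pucci operators. -/

/-- The matrix of the bilinear form `⟪X h, k⟫` in the standard basis. -/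
noncomputable def formMatrix {n : ℕ} (X : EuclideanSpace ℝ (Fin n) →L[ℝ] EuclideanSpace ℝ (Fin n)) :
    Matrix (Fin n) (Fin n) ℝ :=
  Matrix.of fun i j => inner ℝ (X (EuclideanSpace.single i 1)) (EuclideanSpace.single j 1)

/-- The trace of a linear map of `ℝⁿ`. -/
noncomputable def formTrace {n : ℕ} (X : EuclideanSpace ℝ (Fin n) →L[ℝ] EuclideanSpace ℝ (Fin n)) : ℝ :=
  ∑ i, inner ℝ (X (EuclideanSpace.single i 1)) (EuclideanSpace.single i (1 : ℝ))

theorem formMatrix_isHermitian {n : ℕ}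
    {X : EuclideanSpace ℝ (Fin n) →L[ℝ] EuclideanSpace ℝ (Fin n)}
    (hX : ∀ h k, inner ℝ (X h) k = inner ℝ h (X k)) : (formMatrix X).IsHermitian := by
  ext i j
  simp only [formMatrix, Matrix.conjTranspose_apply, Matrix.of_apply, star_trivial]
  rw [hX, real_inner_comm]

theorem formMatrix_quadratic {n : ℕ}
    (X : EuclideanSpace ℝ (Fin n) →L[ℝ] EuclideanSpace ℝ (Fin n)) (v : EuclideanSpace ℝ (Fin n)) :
    inner ℝ (X v) v = v.ofLp ⬝ᵥ (formMatrix X).mulVec v.ofLp := by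
  have hv : v = ∑ i, v i • EuclideanSpace.single i (1 : ℝ) := by
    ext j
    simp [Finset.sum_apply, Pi.single_apply]
  conv_lhs => rw [hv]
  simp only [map_sum, map_smul, sum_inner, inner_sum, inner_smul_left, inner_smul_right,
    dotProduct, Matrix.mulVec, formMatrix, Matrix.of_apply, Finset.mul_sum]
  rw [Finset.sum_comm]
  refine Finset.sum_congr rfl fun i _ => Finset.sum_congr rfl fun j _ => ?_
  simp
  ring

theorem formMatrix_trace {n : ℕ}
    (X : EuclideanSpace ℝ (Fin n) →L[ℝ] EuclideanSpace ℝ (Fin n)) :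
    (formMatrix X).trace = formTrace X := rfl

theorem formMatrix_eq_toMatrix {n : ℕ}
    (X : EuclideanSpace ℝ (Fin n) →L[ℝ] EuclideanSpace ℝ (Fin n)) :
    (formMatrix X).transpose = LinearMap.toMatrix (EuclideanSpace.basisFun (Fin n) ℝ).toBasis
      (EuclideanSpace.basisFun (Fin n) ℝ).toBasis (X : _ →ₗ[ℝ] _) := by
  ext i j
  rw [LinearMap.toMatrix_apply]
  simp [formMatrix, EuclideanSpace.inner_single_right]

theorem formMatrix_det {n : ℕ}
    (X : EuclideanSpace ℝ (Fin n) →L[ℝ] EuclideanSpace ℝ (Fin n)) :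
    (formMatrix X).det = X.det := by
  rw [← Matrix.det_transpose, formMatrix_eq_toMatrix, LinearMap.det_toMatrix]

theorem formTrace_sub_smul_id {n : ℕ}
    (X : EuclideanSpace ℝ (Fin n) →L[ℝ] EuclideanSpace ℝ (Fin n)) (η : ℝ) :
    formTrace (X - η • ContinuousLinearMap.id ℝ _) = formTrace X - n * η := by
  simp [formTrace, inner_sub_left, inner_smul_left, Finset.sum_sub_distrib]

theorem formTrace_smul {n : ℕ}
    (X : EuclideanSpace ℝ (Fin n) →L[ℝ] EuclideanSpace ℝ (Fin n)) (c : ℝ) :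
    formTrace (c • X) = c * formTrace X := by
  simp [formTrace, inner_smul_left, Finset.mul_sum]

/-- The determinant is a product of n nonnegative eigenvalues, each at most their sum. -/
theorem det_le_trace_pow {n : ℕ}
    {X : EuclideanSpace ℝ (Fin n) →L[ℝ] EuclideanSpace ℝ (Fin n)}
    (hX : ∀ h k, inner ℝ (X h) k = inner ℝ h (X k)) (hpos : ∀ h, 0 ≤ inner ℝ (X h) h) :
    |X.det| ≤ formTrace X ^ n := by
  have hH := formMatrix_isHermitian hX
  have hev : ∀ i, 0 ≤ hH.eigenvalues i := fun i => by
    rw [hH.eigenvalues_eq]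
    simpa [formMatrix_quadratic] using hpos (hH.eigenvectorBasis i)
  rw [← formMatrix_det, ← formMatrix_trace, hH.det_eq_prod_eigenvalues,
    hH.trace_eq_sum_eigenvalues]
  simp only [RCLike.ofReal_real_eq_id, id_eq]
  rw [abs_of_nonneg (Finset.prod_nonneg fun i _ => hev i)]
  calc ∏ i, hH.eigenvalues i ≤ ∏ _i : Fin n, ∑ j, hH.eigenvalues j :=
        Finset.prod_le_prod (fun i _ => hev i) fun i _ =>
          Finset.single_le_sum (fun j _ => hev j) (Finset.mem_univ i)
    _ = _ := by simp

/-- The inequality holds eigenvalue by eigenvalue: for e < 0 it reads lam (e + β) ≤ Lam (e + β),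
with e + β ≥ 0. The shift by β produces the trace of a nonnegative form, which controls its
determinant. -/
theorem pucciMin_formMatrix_ge {n : ℕ} {lam Lam β : ℝ} (hLam : lam ≤ Lam)
    (hβ : 0 ≤ β) {X : EuclideanSpace ℝ (Fin n) →L[ℝ] EuclideanSpace ℝ (Fin n)}
    (hX : ∀ h k, inner ℝ (X h) k = inner ℝ h (X k))
    (hXβ : ∀ h, -β * ‖h‖ ^ 2 ≤ inner ℝ (X h) h) :
    lam * (formTrace X + n * β) ≤ pucciMin lam Lam (formMatrix X) + Lam * n * β := by
  have hH := formMatrix_isHermitian hX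
  have hev : ∀ i, -β ≤ hH.eigenvalues i := fun i => by
    rw [hH.eigenvalues_eq]
    simpa [formMatrix_quadratic] using hXβ (hH.eigenvectorBasis i)
  rw [pucciMin, dif_pos hH, ← formMatrix_trace, hH.trace_eq_sum_eigenvalues]
  simp only [RCLike.ofReal_real_eq_id, id_eq, Finset.sum_filter]
  have h1 : ∀ e : ℝ, -β ≤ e → lam * (e + β) ≤
      lam * (if 0 < e then e else 0) + Lam * (if e < 0 then e else 0) + Lam * β := by
    intro e he
    rcases lt_trichotomy e 0 with h | h | h
    · rw [if_neg (by linarith), if_pos h]; nlinarith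
    · subst h; simp; nlinarith
    · rw [if_pos h, if_neg (by linarith)]; nlinarith
  have h2 := Finset.sum_le_sum fun i (_ : i ∈ Finset.univ) => h1 _ (hev i)
  simp only [← Finset.mul_sum, Finset.sum_add_distrib, Finset.sum_const, Finset.card_univ,
    Fintype.card_fin, nsmul_eq_mul] at h2
  linarith

/-- The eigenvalues of -X are at most β, and P⁺(-X) = -P⁻(X), so the bound for supersolutions
reappears for the negative of a subsolution. -/
theorem pucciMax_neg_formMatrix_le {n : ℕ} {lam Lam β : ℝ} (hLam : lam ≤ Lam)
    (hβ : 0 ≤ β) {X : EuclideanSpace ℝ (Fin n) →L[ℝ] EuclideanSpace ℝ (Fin n)}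
    (hX : ∀ h k, inner ℝ (X h) k = inner ℝ h (X k))
    (hXβ : ∀ h, -β * ‖h‖ ^ 2 ≤ inner ℝ (X h) h) :
    lam * (formTrace X + n * β) ≤ -pucciMax lam Lam (formMatrix (-X)) + Lam * n * β := by
  have hX' : ∀ h k, inner ℝ ((-X) h) k = inner ℝ h ((-X) k) := by
    intro h k; simp [hX h k]
  have hH := formMatrix_isHermitian hX'
  have hev : ∀ i, hH.eigenvalues i ≤ β := fun i => by
    rw [hH.eigenvalues_eq]
    have h1 := hXβ (hH.eigenvectorBasis i)
    have h2 := formMatrix_quadratic (-X) (hH.eigenvectorBasis i)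
    simp only [neg_apply, inner_neg_left, OrthonormalBasis.norm_eq_one,
      star_trivial, RCLike.re_to_real] at h1 h2 ⊢
    linarith
  have htr : formTrace X = -(formMatrix (-X)).trace := by
    simp [formMatrix_trace, formTrace]
  rw [pucciMax, dif_pos hH, htr, hH.trace_eq_sum_eigenvalues]
  simp only [RCLike.ofReal_real_eq_id, id_eq, Finset.sum_filter]
  have h1 : ∀ e : ℝ, e ≤ β → lam * (-e + β) ≤
      -(lam * (if e < 0 then e else 0)) - Lam * (if 0 < e then e else 0) + Lam * β := by
    intro e he
    rcases lt_trichotomy e 0 with h | h | h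
    · rw [if_pos h, if_neg (by linarith)]; nlinarith
    · subst h; simp; nlinarith
    · rw [if_neg (by linarith), if_pos h]; nlinarith
  have h2 := Finset.sum_le_sum fun i (_ : i ∈ Finset.univ) => h1 _ (hev i)
  simp only [← Finset.mul_sum, Finset.sum_add_distrib, Finset.sum_const, Finset.card_univ,
    Fintype.card_fin, nsmul_eq_mul, Finset.sum_sub_distrib, Finset.sum_neg_distrib] at h2
  linarith

/-! ### Subjets and the inequality without γ. -/

/-- The quadratic polynomial with value `c`, gradient `p` and Hessian `X` at `x`. -/
noncomputable def quadPoly {n : ℕ} (c : ℝ) (x p : EuclideanSpace ℝ (Fin n))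
    (X : EuclideanSpace ℝ (Fin n) →L[ℝ] EuclideanSpace ℝ (Fin n))
    (y : EuclideanSpace ℝ (Fin n)) : ℝ :=
  c + inner ℝ p (y - x) + 1 / 2 * inner ℝ (X (y - x)) (y - x)

theorem quadPoly_self {n : ℕ} (c : ℝ) (x p : EuclideanSpace ℝ (Fin n))
    (X : EuclideanSpace ℝ (Fin n) →L[ℝ] EuclideanSpace ℝ (Fin n)) : quadPoly c x p X x = c := by
  simp [quadPoly]

theorem quadPoly_contDiff {n : ℕ} (c : ℝ) (x p : EuclideanSpace ℝ (Fin n))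
    (X : EuclideanSpace ℝ (Fin n) →L[ℝ] EuclideanSpace ℝ (Fin n)) :
    ContDiff ℝ 2 (quadPoly c x p X) := by
  have h : ContDiff ℝ 2 fun y => y - x := contDiff_id.sub contDiff_const
  exact (contDiff_const.add (contDiff_const.inner ℝ h)).add
    (contDiff_const.mul ((X.contDiff.comp h).inner ℝ h))

theorem quadPoly_fderiv {n : ℕ} (c : ℝ) (x p : EuclideanSpace ℝ (Fin n))
    {X : EuclideanSpace ℝ (Fin n) →L[ℝ] EuclideanSpace ℝ (Fin n)}
    (hX : ∀ h k, inner ℝ (X h) k = inner ℝ h (X k)) (y : EuclideanSpace ℝ (Fin n)) :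
    HasFDerivAt (quadPoly c x p X) (innerSL ℝ (p + X (y - x))) y := by
  have h0 : HasFDerivAt (fun y : EuclideanSpace ℝ (Fin n) => y - x)
    (ContinuousLinearMap.id ℝ (EuclideanSpace ℝ (Fin n))) y := (hasFDerivAt_id y).sub_const x
  have h1 := ((hasFDerivAt_const p y).inner ℝ h0).const_add c
  have h2 := ((X.hasFDerivAt.comp y h0).inner ℝ h0).const_mul (1 / 2)
  refine (h1.add h2).congr_fderiv ?_
  ext k
  simp [hX k (y - x), real_inner_comm k, inner_sub_right]
  ring

theorem quadPoly_gradient {n : ℕ} (c : ℝ) (x p : EuclideanSpace ℝ (Fin n))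
    {X : EuclideanSpace ℝ (Fin n) →L[ℝ] EuclideanSpace ℝ (Fin n)}
    (hX : ∀ h k, inner ℝ (X h) k = inner ℝ h (X k)) :
    gradient (quadPoly c x p X) x = p := by
  refine HasGradientAt.gradient ?_
  rw [hasGradientAt_iff_hasFDerivAt]
  refine (quadPoly_fderiv c x p hX x).congr_fderiv ?_
  ext k
  simp

theorem quadPoly_hessianMatrix {n : ℕ} (c : ℝ) (x p : EuclideanSpace ℝ (Fin n))
    {X : EuclideanSpace ℝ (Fin n) →L[ℝ] EuclideanSpace ℝ (Fin n)}
    (hX : ∀ h k, inner ℝ (X h) k = inner ℝ h (X k)) :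
    hessianMatrix (quadPoly c x p X) x = formMatrix X := by
  have h1 : fderiv ℝ (quadPoly c x p X) = fun y => innerSL ℝ (p + X (y - x)) :=
    funext fun y => (quadPoly_fderiv c x p hX y).fderiv
  have h0 : HasFDerivAt (fun y : EuclideanSpace ℝ (Fin n) => y - x)
    (ContinuousLinearMap.id ℝ (EuclideanSpace ℝ (Fin n))) x := (hasFDerivAt_id x).sub_const x
  have h2 : HasFDerivAt (fun y => innerSL ℝ (p + X (y - x)))
      ((innerSL ℝ (E := EuclideanSpace ℝ (Fin n))).comp X) x := by
    have := (innerSL ℝ (E := EuclideanSpace ℝ (Fin n))).hasFDerivAt.comp x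
      ((X.hasFDerivAt.comp x h0).const_add p)
    refine this.congr_fderiv ?_
    ext; simp; rfl
  ext i j
  simp only [hessianMatrix, formMatrix, Matrix.of_apply, h1, h2.fderiv]
  rfl

/-- The quadratic polynomial with gradient `p` and Hessian `X` at `x` touches `u` from below
at `x`. -/
def HasSubjet {n : ℕ} (u : EuclideanSpace ℝ (Fin n) → ℝ) (x p : EuclideanSpace ℝ (Fin n))
    (X : EuclideanSpace ℝ (Fin n) →L[ℝ] EuclideanSpace ℝ (Fin n)) : Prop :=
  ∀ᶠ y in 𝓝 x, quadPoly (u x) x p X y ≤ u y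

/-- `pucciMin lam Lam (D²u) ≤ K + 2 |Du|` in the unit ball in the viscosity sense, in the form in
which it is used: as a bound of the trace of `X + β` for the subjets with `X ≥ -β`. -/
def SubjetBound {n : ℕ} (lam Lam K : ℝ) (u : EuclideanSpace ℝ (Fin n) → ℝ) : Prop :=
  ∀ x ∈ ball (0 : EuclideanSpace ℝ (Fin n)) 1, ∀ p,
    ∀ X : EuclideanSpace ℝ (Fin n) →L[ℝ] EuclideanSpace ℝ (Fin n), ∀ β : ℝ, 0 ≤ β →
      (∀ h k, inner ℝ (X h) k = inner ℝ h (X k)) → (∀ h, -β * ‖h‖ ^ 2 ≤ inner ℝ (X h) h) →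
        HasSubjet u x p X → lam * (formTrace X + n * β) ≤ K + 2 * ‖p‖ + Lam * n * β

/-- Young's inequality with weights γ and 1 - γ. Dropping the weights is what makes all later
constants independent of γ. -/
theorem rpow_mul_rpow_le_add {a b γ : ℝ} (ha : 0 ≤ a) (hb : 0 ≤ b) (h0 : 0 ≤ γ) (h1 : γ ≤ 1) :
    a ^ γ * b ^ (1 - γ) ≤ a + b := by
  have := Real.geom_mean_le_arith_mean2_weighted h0 (by linarith : 0 ≤ 1 - γ) ha hb (by ring)
  nlinarith

/-- The singular inequality, multiplied by the power of the gradient. -/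
theorem le_of_singular_le {γ q P F K : ℝ} (hγ0 : 0 ≤ γ) (hγ1 : γ < 1) (hq : 0 ≤ q)
    (hqγ : γ = 0 ∨ q ≠ 0) (hK : 0 ≤ K) (hF : F ≤ K ^ (1 - γ))
    (h : q ^ (-γ) * P - q ^ (1 - γ) ≤ F) : P ≤ K + 2 * q := by
  rcases hqγ with rfl | hq0
  · simp at h hF
    linarith
  · have hq' : 0 < q := lt_of_le_of_ne hq (Ne.symm hq0)
    have e1 : q ^ γ * q ^ (-γ) = 1 := by rw [← Real.rpow_add hq']; simp
    have e2 : q ^ γ * q ^ (1 - γ) = q := by rw [← Real.rpow_add hq']; simp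
    have h3 := mul_le_mul_of_nonneg_left (h.trans hF) (Real.rpow_nonneg hq γ)
    rw [mul_sub, ← mul_assoc, e1, e2] at h3
    have h4 := rpow_mul_rpow_le_add hq hK hγ0 hγ1.le
    linarith

theorem subjet_bound_of_supersol {n : ℕ} {lam Lam γ K : ℝ} (hLam : lam ≤ Lam) (hγ0 : 0 ≤ γ)
    (hγ1 : γ < 1) (hK : 0 ≤ K) {u f : EuclideanSpace ℝ (Fin n) → ℝ}
    (hf : ∀ x ∈ ball (0 : EuclideanSpace ℝ (Fin n)) 1, |f x| ≤ K ^ (1 - γ))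
    (hu : IsViscositySupersol lam Lam γ (ball 0 1) f u)
    {x p : EuclideanSpace ℝ (Fin n)} (hx : x ∈ ball (0 : EuclideanSpace ℝ (Fin n)) 1)
    (hp : γ = 0 ∨ p ≠ 0)
    {X : EuclideanSpace ℝ (Fin n) →L[ℝ] EuclideanSpace ℝ (Fin n)} {β : ℝ} (hβ : 0 ≤ β)
    (hX : ∀ h k, inner ℝ (X h) k = inner ℝ h (X k))
    (hXβ : ∀ h, -β * ‖h‖ ^ 2 ≤ inner ℝ (X h) h) (hj : HasSubjet u x p X) :
    lam * (formTrace X + n * β) ≤ K + 2 * ‖p‖ + Lam * n * β := by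
  obtain ⟨V, hV, hVo, hxV⟩ := _root_.eventually_nhds_iff.1 hj
  have h := hu (quadPoly (u x) x p X) (quadPoly_contDiff _ _ _ _).contDiffOn x hx
    (V ∩ ball 0 1) (hVo.inter isOpen_ball) Set.inter_subset_right
    ⟨⟨hxV, hx⟩, quadPoly_self _ _ _ _, fun y hy => hV y hy.1⟩
  rw [quadPoly_gradient _ _ _ hX, quadPoly_hessianMatrix _ _ _ hX] at h
  have h1 := le_of_singular_le hγ0 hγ1 (norm_nonneg p) (hp.imp_right norm_ne_zero_iff.2) hK
    (abs_le.1 (hf x hx)).2 (h hp)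
  have h2 := pucciMin_formMatrix_ge hLam hβ hX hXβ
  linarith

/-- With this, -u obeys the same one-sided inequality as u, and everything that follows is done from
below only. -/
theorem subjet_bound_of_subsol {n : ℕ} {lam Lam γ K : ℝ} (hLam : lam ≤ Lam) (hγ0 : 0 ≤ γ)
    (hγ1 : γ < 1) (hK : 0 ≤ K) {u f : EuclideanSpace ℝ (Fin n) → ℝ}
    (hf : ∀ x ∈ ball (0 : EuclideanSpace ℝ (Fin n)) 1, |f x| ≤ K ^ (1 - γ))
    (hu : IsViscositySubsol lam Lam γ (ball 0 1) f u)
    {x p : EuclideanSpace ℝ (Fin n)} (hx : x ∈ ball (0 : EuclideanSpace ℝ (Fin n)) 1)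
    (hp : γ = 0 ∨ p ≠ 0)
    {X : EuclideanSpace ℝ (Fin n) →L[ℝ] EuclideanSpace ℝ (Fin n)} {β : ℝ} (hβ : 0 ≤ β)
    (hX : ∀ h k, inner ℝ (X h) k = inner ℝ h (X k))
    (hXβ : ∀ h, -β * ‖h‖ ^ 2 ≤ inner ℝ (X h) h) (hj : HasSubjet (fun y => -u y) x p X) :
    lam * (formTrace X + n * β) ≤ K + 2 * ‖p‖ + Lam * n * β := by
  obtain ⟨V, hV, hVo, hxV⟩ := _root_.eventually_nhds_iff.1 hj
  have hX' : ∀ h k, inner ℝ ((-X) h) k = inner ℝ h ((-X) k) := by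
    intro h k; simp [hX h k]
  have h := hu (quadPoly (u x) x (-p) (-X)) (quadPoly_contDiff _ _ _ _).contDiffOn x hx
    (V ∩ ball 0 1) (hVo.inter isOpen_ball) Set.inter_subset_right
    ⟨⟨hxV, hx⟩, (quadPoly_self _ _ _ _).symm, fun y hy => by
      have := hV y hy.1
      simp only [quadPoly, neg_apply, inner_neg_left] at this ⊢
      linarith⟩
  rw [quadPoly_gradient _ _ _ hX', quadPoly_hessianMatrix _ _ _ hX', norm_neg] at h
  have h1 := le_of_singular_le (P := -pucciMax lam Lam (formMatrix (-X))) (F := -f x) hγ0 hγ1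
    (norm_nonneg p) (hp.imp_right norm_ne_zero_iff.2) hK
    (by linarith [(abs_le.1 (hf x hx)).1]) (by linarith [h (hp.imp_right neg_ne_zero.2)])
  have h2 := pucciMax_neg_formMatrix_le hLam hβ hX hXβ
  linarith

theorem quadPoly_recentre {n : ℕ} (c : ℝ) (x p z : EuclideanSpace ℝ (Fin n))
    {X : EuclideanSpace ℝ (Fin n) →L[ℝ] EuclideanSpace ℝ (Fin n)}
    (hX : ∀ h k, inner ℝ (X h) k = inner ℝ h (X k)) (y : EuclideanSpace ℝ (Fin n)) :
    quadPoly c x p X y = quadPoly (quadPoly c x p X z) z (p + X (z - x)) X y := by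
  obtain ⟨h, rfl⟩ : ∃ h, y = z + h := ⟨y - z, by abel⟩
  obtain ⟨k, rfl⟩ : ∃ k, z = x + k := ⟨z - x, by abel⟩
  have e1 : x + k + h - x = k + h := by abel
  simp only [quadPoly, e1, add_sub_cancel_left, map_add, inner_add_left, inner_add_right,
    hX h k, real_inner_comm (X k) h]
  ring

/-- Subjets with vanishing gradient need not be tested. -/
theorem subjetBound_of_ne_zero {n : ℕ} {lam Lam K : ℝ} (hlam : 0 < lam) (hLam : lam ≤ Lam)
    (hK : 0 ≤ K) {u : EuclideanSpace ℝ (Fin n) → ℝ} (hu : ContinuousOn u (closedBall 0 1))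
    (H : ∀ x ∈ ball (0 : EuclideanSpace ℝ (Fin n)) 1, ∀ p,
      ∀ X : EuclideanSpace ℝ (Fin n) →L[ℝ] EuclideanSpace ℝ (Fin n), ∀ β : ℝ, p ≠ 0 → 0 ≤ β →
      (∀ h k, inner ℝ (X h) k = inner ℝ h (X k)) → (∀ h, -β * ‖h‖ ^ 2 ≤ inner ℝ (X h) h) →
        HasSubjet u x p X → lam * (formTrace X + n * β) ≤ K + 2 * ‖p‖ + Lam * n * β) :
    SubjetBound lam Lam K u := by
  intro x hx p X β hβ hX hXβ hj
  by_cases hp : p ≠ 0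
  · exact H x hx p X β hp hβ hX hXβ hj
  push Not at hp
  subst hp
  by_contra! hcon
  rw [norm_zero, mul_zero, add_zero] at hcon
  set gap := lam * (formTrace X + n * β) - (K + Lam * n * β) with hgap
  have hgap0 : 0 < gap := by rw [hgap]; linarith
  have hLam0 : 0 < Lam := hlam.trans_le hLam
  have htr : 0 < formTrace X := by
    have h1 : lam * (n * β) ≤ Lam * (n * β) := by gcongr
    nlinarith
  -- Lowering the Hessian by η makes the touching strict. The choice of η costs at most half of the
  -- violation `gap` and keeps the trace positive, so that some direction e has ⟪Ye, e⟫ > 0.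
  obtain ⟨η, hη0, hη1, hη2⟩ : ∃ η : ℝ, 0 < η ∧ Lam * n * η < gap / 2 ∧ n * η < formTrace X := by
    have h1 : ∀ᶠ η : ℝ in 𝓝[>] 0, Lam * n * η < gap / 2 := by
      refine nhdsWithin_le_nhds (ContinuousAt.eventually_lt (by fun_prop) (by fun_prop) ?_)
      simp; linarith
    have h2 : ∀ᶠ η : ℝ in 𝓝[>] 0, n * η < formTrace X := by
      refine nhdsWithin_le_nhds (ContinuousAt.eventually_lt (by fun_prop) (by fun_prop) ?_)
      simpa using htr
    obtain ⟨η, h⟩ := ((h1.and h2).and self_mem_nhdsWithin).exists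
    exact ⟨η, h.2, h.1.1, h.1.2⟩
  set Y := X - η • ContinuousLinearMap.id ℝ (EuclideanSpace ℝ (Fin n)) with hY
  have hYapp : ∀ h k, inner ℝ (Y h) k = inner ℝ (X h) k - η * inner ℝ h k := by
    intro h k; simp [hY, inner_sub_left, inner_smul_left]
  have hYs : ∀ h k, inner ℝ (Y h) k = inner ℝ h (Y k) := by
    intro h k
    rw [real_inner_comm (Y k) h, hYapp, hYapp, hX, real_inner_comm (X k) h, real_inner_comm h k]
  have hYβ : ∀ h, -(β + η) * ‖h‖ ^ 2 ≤ inner ℝ (Y h) h := by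
    intro h
    rw [hYapp, real_inner_self_eq_norm_sq]
    linarith [hXβ h]
  have hYtr : formTrace Y = formTrace X - n * η := formTrace_sub_smul_id X η
  obtain ⟨e, he⟩ : ∃ e, 0 < inner ℝ (Y e) e := by
    by_contra! hno
    have : formTrace Y ≤ 0 := Finset.sum_nonpos fun i _ => hno _
    linarith
  obtain ⟨ρ, hρ0, hρ⟩ : ∃ ρ > 0, closedBall x ρ ⊆ ball 0 1 ∧
      ∀ y ∈ closedBall x ρ, quadPoly (u x) x 0 X y ≤ u y := by
    have := hj.and (isOpen_ball.eventually_mem hx)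
    obtain ⟨ρ, hρ0, hρ⟩ := nhds_basis_closedBall.mem_iff.1 this
    exact ⟨ρ, hρ0, fun y hy => (hρ hy).2, fun y hy => (hρ hy).1⟩
  -- The lowered polynomial is tilted by -τYe. Strictness confines the new contact point to distance
  -- 2τ|Ye|/η from x, so for small τ it is interior and twice the gradient there is below the other
  -- half of `gap`.
  obtain ⟨τ, hτ0, hτ1, hτ2⟩ : ∃ τ : ℝ, 0 < τ ∧ 2 * τ * ‖Y e‖ / η < ρ ∧
      2 * (‖Y‖ * (2 * τ * ‖Y e‖ / η) + τ * ‖Y e‖) < gap / 2 := by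
    have h1 : ∀ᶠ τ : ℝ in 𝓝[>] 0, 2 * τ * ‖Y e‖ / η < ρ := by
      refine nhdsWithin_le_nhds (ContinuousAt.eventually_lt (by fun_prop) (by fun_prop) ?_)
      simpa using hρ0
    have h2 : ∀ᶠ τ : ℝ in 𝓝[>] 0,
        2 * (‖Y‖ * (2 * τ * ‖Y e‖ / η) + τ * ‖Y e‖) < gap / 2 := by
      refine nhdsWithin_le_nhds (ContinuousAt.eventually_lt (by fun_prop) (by fun_prop) ?_)
      simp; linarith
    obtain ⟨τ, h⟩ := ((h1.and h2).and self_mem_nhdsWithin).exists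
    exact ⟨τ, h.2, h.1.1, h.1.2⟩
  have hcont : ContinuousOn (fun y => u y - quadPoly (u x) x (-(τ • Y e)) Y y)
      (closedBall x ρ) :=
    ((hu.mono ball_subset_closedBall).mono hρ.1).sub
      (quadPoly_contDiff _ _ _ _).continuous.continuousOn
  obtain ⟨z, hz, hzmin⟩ := (isCompact_closedBall x ρ).exists_isMinOn
    ⟨x, mem_closedBall_self hρ0.le⟩ hcont
  have hmin : ∀ y ∈ closedBall x ρ,
      u z - quadPoly (u x) x (-(τ • Y e)) Y z ≤ u y - quadPoly (u x) x (-(τ • Y e)) Y y :=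
    fun y hy => hzmin hy
  have hzx := hmin x (mem_closedBall_self hρ0.le)
  rw [quadPoly_self, sub_self] at hzx
  have hzu := hρ.2 z hz
  have hqz : quadPoly (u x) x 0 X z = u x + 1 / 2 * (inner ℝ (Y (z - x)) (z - x)
      + η * ‖z - x‖ ^ 2) := by
    simp only [quadPoly, hYapp, inner_zero_left, real_inner_self_eq_norm_sq]; ring
  have hqz' : quadPoly (u x) x (-(τ • Y e)) Y z = u x - τ * inner ℝ (Y e) (z - x)
      + 1 / 2 * inner ℝ (Y (z - x)) (z - x) := by
    simp [quadPoly, inner_smul_left]; ring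
  have hCS := (abs_le.1 (abs_real_inner_le_norm (Y e) (z - x))).1
  have hsmall : ‖z - x‖ ≤ 2 * τ * ‖Y e‖ / η := by
    rw [le_div_iff₀ hη0]
    by_contra! hlt
    have hpos : 0 < ‖z - x‖ := by
      by_contra! h0
      have h00 : ‖z - x‖ = 0 := le_antisymm h0 (norm_nonneg _)
      rw [h00, zero_mul] at hlt
      have : 0 ≤ 2 * τ * ‖Y e‖ := by positivity
      linarith
    have h1 := mul_le_mul_of_nonneg_left hCS hτ0.le
    have h2 := mul_lt_mul_of_pos_right hlt hpos
    nlinarith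
  have hzball : z ∈ ball x ρ := by
    rw [mem_ball, dist_eq_norm]; linarith
  have hrec : ∀ y, quadPoly (u x) x (-(τ • Y e)) Y y
      - quadPoly (u x) x (-(τ • Y e)) Y z + u z
      = quadPoly (u z) z (-(τ • Y e) + Y (z - x)) Y y := by
    intro y
    rw [quadPoly_recentre (u x) x _ z hYs y]
    simp [quadPoly]; ring
  have hzj : HasSubjet u z (-(τ • Y e) + Y (z - x)) Y := by
    filter_upwards [isOpen_ball.eventually_mem hzball] with y hy
    rw [← hrec]
    linarith [hmin y (ball_subset_closedBall hy)]
  -- If the gradient still vanished, then Y(z - x) = τYe, and the form Y at z - x would be τ²⟪Ye, e⟫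
  -- > 0. Minimality then puts u z below u x, while the original touching polynomial puts it above.
  by_cases hg : -(τ • Y e) + Y (z - x) = 0
  · have h1 := hmin x (mem_closedBall_self hρ0.le)
    have h2 := hrec x
    have h3 : quadPoly (u z) z 0 Y x = u z + 1 / 2 * inner ℝ (Y (z - x)) (z - x) := by
      simp only [quadPoly, inner_zero_left, add_zero, ← neg_sub z x, map_neg, inner_neg_neg]
    have h4 : Y (z - x) = τ • Y e := by
      rw [← sub_eq_zero, ← hg]; abel
    have h5 : inner ℝ (Y (z - x)) (z - x) = τ ^ 2 * inner ℝ (Y e) e := by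
      rw [h4, inner_smul_left, hYs e, h4, inner_smul_right, real_inner_comm]
      simp; ring
    rw [hg, h3, h5] at h2
    rw [hqz, h5] at hzu
    have h6 : 0 < τ ^ 2 * inner ℝ (Y e) e := by positivity
    have h7 : 0 ≤ η * ‖z - x‖ ^ 2 := by positivity
    linarith
  · have hb := H z (hρ.1 hz) _ Y (β + η) hg (by positivity) hYs hYβ hzj
    have h1 : ‖-(τ • Y e) + Y (z - x)‖ ≤ τ * ‖Y e‖ + ‖Y‖ * (2 * τ * ‖Y e‖ / η) := by
      refine (norm_add_le _ _).trans (add_le_add ?_ ?_)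
      · rw [norm_neg, norm_smul, Real.norm_of_nonneg hτ0.le]
      · exact (Y.le_opNorm _).trans (by gcongr)
    rw [hYtr] at hb
    have h2 : lam * (formTrace X - n * η + n * (β + η)) = lam * (formTrace X + n * β) := by ring
    rw [h2] at hb
    linarith

theorem subjetBound_of_supersol {n : ℕ} {lam Lam γ K : ℝ} (hlam : 0 < lam) (hLam : lam ≤ Lam)
    (hγ0 : 0 ≤ γ) (hγ1 : γ < 1) (hK : 0 ≤ K) {u f : EuclideanSpace ℝ (Fin n) → ℝ}
    (huc : ContinuousOn u (closedBall 0 1))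
    (hf : ∀ x ∈ ball (0 : EuclideanSpace ℝ (Fin n)) 1, |f x| ≤ K ^ (1 - γ))
    (hu : IsViscositySupersol lam Lam γ (ball 0 1) f u) : SubjetBound lam Lam K u :=
  subjetBound_of_ne_zero hlam hLam hK huc fun _ hx _ _ _ hp hβ hX hXβ hj =>
    subjet_bound_of_supersol hLam hγ0 hγ1 hK hf hu hx (Or.inr hp) hβ hX hXβ hj

theorem subjetBound_of_subsol {n : ℕ} {lam Lam γ K : ℝ} (hlam : 0 < lam) (hLam : lam ≤ Lam)
    (hγ0 : 0 ≤ γ) (hγ1 : γ < 1) (hK : 0 ≤ K) {u f : EuclideanSpace ℝ (Fin n) → ℝ}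
    (huc : ContinuousOn u (closedBall 0 1))
    (hf : ∀ x ∈ ball (0 : EuclideanSpace ℝ (Fin n)) 1, |f x| ≤ K ^ (1 - γ))
    (hu : IsViscositySubsol lam Lam γ (ball 0 1) f u) :
    SubjetBound lam Lam K fun y => -u y :=
  subjetBound_of_ne_zero hlam hLam hK huc.neg fun _ hx _ _ _ hp hβ hX hXβ hj =>
    subjet_bound_of_subsol hLam hγ0 hγ1 hK hf hu hx (Or.inr hp) hβ hX hXβ hj

theorem SubjetBound.const_mul {n : ℕ} {lam Lam K : ℝ} {u : EuclideanSpace ℝ (Fin n) → ℝ}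
    (hu : SubjetBound lam Lam K u) {c : ℝ} (hc : 0 < c) :
    SubjetBound lam Lam (c * K) fun y => c * u y := by
  intro x hx p X β hβ hX hXβ hj
  have hj' : HasSubjet u x (c⁻¹ • p) (c⁻¹ • X) := by
    filter_upwards [hj] with y hy
    have h1 : quadPoly (c * u x) x p X y
        = c * quadPoly (u x) x (c⁻¹ • p) (c⁻¹ • X) y := by
      simp only [quadPoly, smul_apply, inner_smul_left, RCLike.conj_to_real]
      field_simp
    rw [h1] at hy
    exact le_of_mul_le_mul_left hy hc
  have h := hu x hx _ _ (c⁻¹ * β) (by positivity)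
    (fun h k => by simp [inner_smul_left, inner_smul_right, hX])
    (fun h => by
      simp only [smul_apply, inner_smul_left, RCLike.conj_to_real]
      have := mul_le_mul_of_nonneg_left (hXβ h) (inv_pos.2 hc).le
      linarith) hj'
  rw [formTrace_smul, norm_smul, Real.norm_of_nonneg (inv_pos.2 hc).le] at h
  have h' := mul_le_mul_of_nonneg_left h hc.le
  field_simp at h'
  linarith

/-! ### Second order expansions at density points. -/

/-- `A` is so dense at `x` that every ball of radius `r` around `x` is within distance `o(r)`
of `A`. -/
def IsThickAt {E : Type*} [NormedAddCommGroup E] (A : Set E) (x : E) : Prop :=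
  ∀ ε > 0, ∃ ρ > 0, ∀ r, 0 < r → r < ρ → ∀ z ∈ closedBall x r, ∃ a ∈ A, ‖a - z‖ ≤ ε * r

/-- If a ball of radius εr with centre in the ball of radius r around x misses A, then A misses the
fraction (ε/2)^n of the ball of radius 2r. This contradicts Lebesgue density for small r. -/
theorem ae_isThickAt {n : ℕ} (A : Set (EuclideanSpace ℝ (Fin n))) :
    ∀ᵐ x ∂(volume.restrict A), IsThickAt A x := by
  filter_upwards [Besicovitch.ae_tendsto_measure_inter_div
    (volume : Measure (EuclideanSpace ℝ (Fin n))) A] with x hx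
  suffices H : ∀ ε > 0, ε ≤ 1 → ∃ ρ > 0, ∀ r, 0 < r → r < ρ → ∀ z ∈ closedBall x r,
      ∃ a ∈ A, ‖a - z‖ ≤ ε * r by
    intro ε hε
    obtain ⟨ρ, hρ, h⟩ := H (min ε 1) (by positivity) (min_le_right _ _)
    refine ⟨ρ, hρ, fun r hr hrρ z hz => ?_⟩
    obtain ⟨a, ha, haz⟩ := h r hr hrρ z hz
    exact ⟨a, ha, haz.trans (by gcongr; exact min_le_left _ _)⟩
  intro ε hε hε1
  have hpos : 0 < (ε / 2) ^ n := by positivity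
  have hev : ∀ᶠ r in 𝓝[>] (0 : ℝ),
      1 - ENNReal.ofReal ((ε / 2) ^ n) < volume (A ∩ closedBall x r) / volume (closedBall x r) :=
    hx.eventually_const_lt (ENNReal.sub_lt_self ENNReal.one_ne_top one_ne_zero
      (by simpa using hpos))
  obtain ⟨R, hR, hRr⟩ := mem_nhdsGT_iff_exists_Ioo_subset.1 hev
  refine ⟨R / 2, by simpa using hR, fun r hr hrR z hz => ?_⟩
  by_contra! hno
  have h2r : 2 * r ∈ Set.Ioo 0 R := ⟨by linarith, by linarith⟩
  have h1 := hRr h2r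
  simp only [Set.mem_ofPred_eq] at h1
  have hsub : closedBall z (ε * r) ⊆ closedBall x (2 * r) := by
    intro y hy
    rw [mem_closedBall] at hy hz ⊢
    nlinarith [dist_triangle y z x]
  have hA : A ∩ closedBall x (2 * r) ⊆ closedBall x (2 * r) \ closedBall z (ε * r) := by
    rintro y ⟨hyA, hy⟩
    refine ⟨hy, fun hyz => ?_⟩
    rw [mem_closedBall, dist_eq_norm] at hyz
    exact absurd hyz (not_le.2 (hno y hyA))
  have hvol : volume (closedBall z (ε * r))
      = ENNReal.ofReal ((ε / 2) ^ n) * volume (closedBall x (2 * r)) := by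
    rw [Measure.addHaar_closedBall _ _ (by positivity), Measure.addHaar_closedBall _ x
      (by positivity), ← mul_assoc, ← ENNReal.ofReal_mul (by positivity), finrank_euclideanSpace,
      Fintype.card_fin, ← mul_pow]
    congr 3
    ring
  have hne : volume (closedBall x (2 * r)) ≠ 0 :=
    (measure_closedBall_pos _ _ (by linarith)).ne'
  have hnt : volume (closedBall x (2 * r)) ≠ ⊤ := measure_closedBall_lt_top.ne
  have h2 : volume (A ∩ closedBall x (2 * r)) / volume (closedBall x (2 * r))
      ≤ 1 - ENNReal.ofReal ((ε / 2) ^ n) := by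
    refine (ENNReal.div_le_iff hne hnt).2 ?_
    rw [ENNReal.sub_mul (fun _ _ => hnt), one_mul, ← hvol]
    refine (measure_mono hA).trans (le_of_eq ?_)
    exact measure_sdiff hsub measurableSet_closedBall.nullMeasurableSet
      measure_closedBall_lt_top.ne
  exact absurd h1 (not_lt.2 h2)

section Expansion

variable {n : ℕ} {w : EuclideanSpace ℝ (Fin n) → ℝ} {A U : Set (EuclideanSpace ℝ (Fin n))}
  {P : EuclideanSpace ℝ (Fin n) → EuclideanSpace ℝ (Fin n)} {M : ℝ}
  {x : EuclideanSpace ℝ (Fin n)} {L : EuclideanSpace ℝ (Fin n) →L[ℝ] EuclideanSpace ℝ (Fin n)}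

/-- If `w` has first order expansions with uniform quadratic error at the points of `A`, then
near a thick point at which the gradient is differentiable they exist approximately at every
point. -/
theorem approx_first_order (hM : 0 ≤ M) (hU : U ∈ 𝓝 x)
    (hw : ∀ a ∈ A, ∀ y ∈ U, |w y - w a - inner ℝ (P a) (y - a)| ≤ M * ‖y - a‖ ^ 2)
    (hP : HasFDerivWithinAt P L A x) (hA : IsThickAt A x) {η : ℝ} (hη : 0 < η) :
    ∃ ρ > 0, ∀ r, 0 < r → r < ρ → ∀ z₁ ∈ closedBall x r, ∀ z₂ ∈ closedBall x r,
      |w z₂ - w z₁ - inner ℝ (P x + L (z₁ - x)) (z₂ - z₁)|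
        ≤ 2 * M * ‖z₂ - z₁‖ ^ 2 + η * r ^ 2 := by
  -- The total error is εc r²: 3M comes from replacing z₁ by a nearby point a of A in the two
  -- quadratic errors, and 4 + 2‖L‖ from replacing P a by its linearization at z₁.
  set c := 3 * M + 4 + 2 * ‖L‖ with hc
  have hc0 : 0 < c := by positivity
  set ε := min 1 (η / c) with hε
  have hε0 : 0 < ε := by positivity
  have hε1 : ε ≤ 1 := min_le_left _ _
  have hεc : ε * c ≤ η := by
    rw [← le_div_iff₀ hc0]; exact min_le_right _ _
  obtain ⟨ρ₁, hρ₁, h1⟩ := hA ε hε0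
  obtain ⟨ρ₂, hρ₂, h2⟩ := Metric.mem_nhds_iff.1 hU
  have h3 : ∀ᶠ a in 𝓝[A] x, ‖P a - P x - L (a - x)‖ ≤ ε * ‖a - x‖ :=
    hP.isLittleO.def hε0
  rw [eventually_nhdsWithin_iff] at h3
  obtain ⟨ρ₃, hρ₃, h3⟩ := Metric.eventually_nhds_iff.1 h3
  refine ⟨min ρ₁ (min ρ₂ (ρ₃ / 2)), by positivity, fun r hr hrρ z₁ hz₁ z₂ hz₂ => ?_⟩
  simp only [lt_min_iff] at hrρ
  obtain ⟨a, haA, haz⟩ := h1 r hr hrρ.1 z₁ hz₁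
  rw [mem_closedBall, dist_eq_norm] at hz₁ hz₂
  have hz₁U : z₁ ∈ U := h2 (by rw [mem_ball, dist_eq_norm]; linarith)
  have hz₂U : z₂ ∈ U := h2 (by rw [mem_ball, dist_eq_norm]; linarith)
  have hεr : ε * r ≤ r := by nlinarith
  have hax : ‖a - x‖ ≤ 2 * r := by
    have := norm_add_le (a - z₁) (z₁ - x)
    rw [sub_add_sub_cancel] at this
    linarith
  have h4 := h3 (by rw [dist_eq_norm]; linarith) haA
  have hz12 : ‖z₂ - z₁‖ ≤ 2 * r := by
    have := norm_sub_le (z₂ - x) (z₁ - x)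
    rw [sub_sub_sub_cancel_right] at this
    linarith
  have h5 := hw a haA z₁ hz₁U
  have h6 := hw a haA z₂ hz₂U
  have hz1a : ‖z₁ - a‖ ≤ ε * r := by rwa [norm_sub_rev]
  have hz2a : ‖z₂ - a‖ ≤ ‖z₂ - z₁‖ + ε * r := by
    have := norm_add_le (z₂ - z₁) (z₁ - a)
    rw [sub_add_sub_cancel] at this
    linarith
  set v := P a - P x - L (z₁ - x) with hv
  have hvn : ‖v‖ ≤ ε * (2 * r) + ‖L‖ * (ε * r) := by
    have e : v = (P a - P x - L (a - x)) + L (a - z₁) := by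
      rw [hv]; simp only [map_sub]; abel
    rw [e]
    refine (norm_add_le _ _).trans (add_le_add (h4.trans (by gcongr)) ?_)
    exact (L.le_opNorm _).trans (by gcongr)
  have hin : |inner ℝ v (z₂ - z₁)| ≤ (ε * (2 * r) + ‖L‖ * (ε * r)) * (2 * r) :=
    (abs_real_inner_le_norm _ _).trans (by gcongr)
  have e1 : w z₂ - w z₁ - inner ℝ (P x + L (z₁ - x)) (z₂ - z₁)
      = (w z₂ - w a - inner ℝ (P a) (z₂ - a)) - (w z₁ - w a - inner ℝ (P a) (z₁ - a))
        + inner ℝ v (z₂ - z₁) := by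
    rw [hv]
    simp only [inner_sub_left, inner_sub_right, inner_add_left]
    ring
  have h7 : M * ‖z₁ - a‖ ^ 2 ≤ M * (ε * r ^ 2) := by
    have : ‖z₁ - a‖ ^ 2 ≤ (ε * r) ^ 2 := by gcongr
    have : (ε * r) ^ 2 ≤ ε * r ^ 2 := by nlinarith [sq_nonneg r]
    gcongr; linarith
  have h8 : M * ‖z₂ - a‖ ^ 2 ≤ M * (2 * ‖z₂ - z₁‖ ^ 2 + 2 * (ε * r ^ 2)) := by
    have : ‖z₂ - a‖ ^ 2 ≤ (‖z₂ - z₁‖ + ε * r) ^ 2 := by gcongr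
    have : (ε * r) ^ 2 ≤ ε * r ^ 2 := by nlinarith [sq_nonneg r]
    gcongr; nlinarith [sq_nonneg (‖z₂ - z₁‖ - ε * r)]
  have h9 : ε * c * r ^ 2 ≤ η * r ^ 2 := by gcongr
  rw [e1]
  have h10 := abs_add_le ((w z₂ - w a - inner ℝ (P a) (z₂ - a))
    - (w z₁ - w a - inner ℝ (P a) (z₁ - a))) (inner ℝ v (z₂ - z₁))
  have h11 := abs_sub (w z₂ - w a - inner ℝ (P a) (z₂ - a))
    (w z₁ - w a - inner ℝ (P a) (z₁ - a))
  have h12 : ε * c * r ^ 2 = 3 * (M * (ε * r ^ 2))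
    + (ε * (2 * r) + ‖L‖ * (ε * r)) * (2 * r) := by rw [hc]; ring
  linarith

/-- The increment of w from x to y is summed over N equal steps, each evaluated by
`approx_first_order` with r = |y - x|. The quadratic errors add up to 2M/N, the Riemann sum of the
linear gradient differs from its integral by at most ‖L‖/(2N), and the choice η = ε/(2N) contributes
ε/2, all in units of |y - x|². -/
theorem second_order_of_thick (hM : 0 ≤ M) (hU : U ∈ 𝓝 x)
    (hw : ∀ a ∈ A, ∀ y ∈ U, |w y - w a - inner ℝ (P a) (y - a)| ≤ M * ‖y - a‖ ^ 2)
    (hP : HasFDerivWithinAt P L A x) (hA : IsThickAt A x) {ε : ℝ} (hε : 0 < ε) :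
    ∀ᶠ y in 𝓝 x, |w y - w x - inner ℝ (P x) (y - x) - 1 / 2 * inner ℝ (L (y - x)) (y - x)|
      ≤ ε * ‖y - x‖ ^ 2 := by
  obtain ⟨N, hN⟩ := exists_nat_gt ((2 * M + ‖L‖) / (ε / 2))
  have hN0 : (0 : ℝ) < N := lt_of_le_of_lt (by positivity) hN
  rw [div_lt_iff₀ (by positivity)] at hN
  have hη : 0 < ε / (2 * N) := by positivity
  obtain ⟨ρ, hρ, h⟩ := approx_first_order hM hU hw hP hA hη
  filter_upwards [ball_mem_nhds x hρ] with y hy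
  obtain ⟨k, rfl⟩ : ∃ k, y = x + k := ⟨y - x, by abel⟩
  rw [mem_ball, dist_eq_norm, add_sub_cancel_left] at hy
  simp only [add_sub_cancel_left]
  rcases (norm_nonneg k).eq_or_lt with hk0 | hk0
  · rw [eq_comm, norm_eq_zero] at hk0
    subst hk0
    simp
  have key : ∀ j : ℕ, j ≤ N → |w (x + ((j : ℝ) / N) • k) - w x - (j / N) * inner ℝ (P x) k
      - (j * (j - 1) / (2 * N ^ 2)) * inner ℝ (L k) k|
      ≤ j * (2 * M / N ^ 2 + ε / (2 * N)) * ‖k‖ ^ 2 := by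
    intro j
    induction j with
    | zero => intro; simp
    | succ j ih =>
      intro hj
      have ih := ih (by omega)
      have hjN : (j : ℝ) / N ≤ 1 := by
        rw [div_le_one hN0]; exact_mod_cast (by omega : j ≤ N)
      have hjN' : ((j + 1 : ℕ) : ℝ) / N ≤ 1 := by
        rw [div_le_one hN0]; exact_mod_cast hj
      have hmem : ∀ s : ℝ, 0 ≤ s → s ≤ 1 → x + s • k ∈ closedBall x ‖k‖ := by
        intro s h0 h1
        rw [mem_closedBall, dist_eq_norm, add_sub_cancel_left, norm_smul,
          Real.norm_of_nonneg h0]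
        nlinarith
      have hs := h ‖k‖ hk0 hy _ (hmem _ (by positivity) hjN) _ (hmem _ (by positivity) hjN')
      have e : x + (((j + 1 : ℕ) : ℝ) / N) • k - (x + ((j : ℝ) / N) • k) = (1 / (N : ℝ)) • k := by
        rw [add_sub_add_left_eq_sub, ← sub_smul]
        congr 1
        push_cast
        ring
      rw [e, add_sub_cancel_left, norm_smul, Real.norm_of_nonneg (by positivity), map_smul,
        inner_add_left, inner_smul_right, inner_smul_right, inner_smul_left] at hs
      simp only [RCLike.conj_to_real] at hs
      set W₁ := w (x + (((j + 1 : ℕ) : ℝ) / N) • k)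
      set W₀ := w (x + ((j : ℝ) / N) • k)
      set I := inner ℝ (P x) k
      set J := inner ℝ (L k) k
      have e2 : W₁ - w x - ((j + 1 : ℕ) : ℝ) / N * I
          - ((j + 1 : ℕ) : ℝ) * (((j + 1 : ℕ) : ℝ) - 1) / (2 * N ^ 2) * J
          = (W₁ - W₀ - (1 / N * I + 1 / N * (j / N * J)))
            + (W₀ - w x - j / N * I - j * (j - 1) / (2 * N ^ 2) * J) := by
        push_cast
        field_simp
        ring
      rw [e2]
      refine (abs_add_le _ _).trans ((add_le_add hs ih).trans (le_of_eq ?_))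
      push_cast
      field_simp
      ring
  have hfin := key N le_rfl
  rw [div_self hN0.ne', one_smul] at hfin
  have hJ : |inner ℝ (L k) k| ≤ ‖L‖ * ‖k‖ ^ 2 := by
    refine (abs_real_inner_le_norm _ _).trans ?_
    have := L.le_opNorm k
    nlinarith [norm_nonneg k]
  have e3 : w (x + k) - w x - inner ℝ (P x) k - 1 / 2 * inner ℝ (L k) k
      = (w (x + k) - w x - 1 * inner ℝ (P x) k
        - (N * (N - 1) / (2 * N ^ 2)) * inner ℝ (L k) k) - (1 / (2 * N)) * inner ℝ (L k) k := by
    field_simp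
    ring
  rw [e3]
  refine (abs_sub _ _).trans ?_
  have h1 : |1 / (2 * (N : ℝ)) * inner ℝ (L k) k| ≤ 1 / (2 * N) * (‖L‖ * ‖k‖ ^ 2) := by
    rw [abs_mul, abs_of_nonneg (by positivity : (0 : ℝ) ≤ 1 / (2 * N))]
    gcongr
  refine (add_le_add hfin h1).trans ?_
  have h2 : N * (2 * M / N ^ 2 + ε / (2 * N)) * ‖k‖ ^ 2 + 1 / (2 * N) * (‖L‖ * ‖k‖ ^ 2)
      = ((2 * M + ‖L‖ / 2) / N + ε / 2) * ‖k‖ ^ 2 := by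
    field_simp
    ring
  rw [h2]
  gcongr
  have h3 : (2 * M + ‖L‖ / 2) / N ≤ ε / 2 := by
    rw [div_le_iff₀ hN0]
    have := norm_nonneg L
    linarith
  linarith

/-- The expansion at x sees only the symmetric part of L, whereas the approximate gradient at x + th
sees L itself. Comparing both on the step from x + th to x + t(h + τk) shows, as t → 0, that the
antisymmetric part contributes τD/2 and everything else is O(τ²). Hence D = 0. -/
theorem symmetric_of_thick (hM : 0 ≤ M) (hU : U ∈ 𝓝 x)
    (hw : ∀ a ∈ A, ∀ y ∈ U, |w y - w a - inner ℝ (P a) (y - a)| ≤ M * ‖y - a‖ ^ 2)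
    (hP : HasFDerivWithinAt P L A x) (hA : IsThickAt A x)
    (h k : EuclideanSpace ℝ (Fin n)) : inner ℝ (L h) k = inner ℝ h (L k) := by
  set D := inner ℝ (L k) h - inner ℝ (L h) k with hD
  set q := inner ℝ (L k) k with hq
  set R := ‖h‖ + ‖k‖ + 1 with hR
  have hR0 : 0 < R := by positivity
  have key : ∀ τ : ℝ, 0 < τ → τ ≤ 1 → |1 / 2 * (τ * D + τ ^ 2 * q)| ≤ 2 * M * (τ * ‖k‖) ^ 2 := by
    intro τ hτ0 hτ1
    refine le_of_forall_pos_le_add fun ς hς => ?_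
    have hη : 0 < ς / (3 * R ^ 2) := by positivity
    obtain ⟨ρ, hρ, H1⟩ := approx_first_order hM hU hw hP hA hη
    obtain ⟨ρ', hρ', H2⟩ := Metric.eventually_nhds_iff.1
      (second_order_of_thick hM hU hw hP hA hη)
    obtain ⟨t, ht0, ht⟩ := exists_between (show (0 : ℝ) < min ρ ρ' / R by positivity)
    rw [lt_div_iff₀ hR0, lt_min_iff] at ht
    have hn1 : ‖t • h‖ ≤ t * R := by
      rw [norm_smul, Real.norm_of_nonneg ht0.le]
      gcongr
      rw [hR]; linarith [norm_nonneg k]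
    have hn2 : ‖t • (h + τ • k)‖ ≤ t * R := by
      rw [norm_smul, Real.norm_of_nonneg ht0.le]
      gcongr
      refine (norm_add_le _ _).trans ?_
      rw [norm_smul, Real.norm_of_nonneg hτ0.le]
      nlinarith [norm_nonneg k]
    have hs1 := H1 (t * R) (by positivity) ht.1 (x + t • h) (by simpa using hn1)
      (x + t • (h + τ • k)) (by simpa using hn2)
    have hs2 := H2 (y := x + t • h) (by rw [dist_eq_norm, add_sub_cancel_left]; linarith)
    have hs3 := H2 (y := x + t • (h + τ • k))
      (by rw [dist_eq_norm, add_sub_cancel_left]; linarith)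
    have e : x + t • (h + τ • k) - (x + t • h) = (t * τ) • k := by
      rw [add_sub_add_left_eq_sub, ← smul_sub, add_sub_cancel_left, smul_smul]
    rw [e, add_sub_cancel_left] at hs1
    rw [add_sub_cancel_left] at hs2 hs3
    have hs2' : ς / (3 * R ^ 2) * ‖t • h‖ ^ 2 ≤ ς / (3 * R ^ 2) * (t * R) ^ 2 := by gcongr
    have hs3' : ς / (3 * R ^ 2) * ‖t • (h + τ • k)‖ ^ 2 ≤ ς / (3 * R ^ 2) * (t * R) ^ 2 := by
      gcongr
    have hR3 : ς / (3 * R ^ 2) * (t * R) ^ 2 = t ^ 2 * (ς / 3) := by field_simp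
    rw [norm_smul, Real.norm_of_nonneg (by positivity), hR3] at hs1
    rw [hR3] at hs2' hs3'
    simp only [map_smul, map_add, inner_add_left, inner_add_right, inner_smul_left,
      inner_smul_right, RCLike.conj_to_real] at hs1 hs2 hs3
    have a1 := abs_le.1 hs1
    have a2 := abs_le.1 (hs2.trans hs2')
    have a3 := abs_le.1 (hs3.trans hs3')
    have ht2 : 0 < t ^ 2 := by positivity
    rw [abs_le]
    constructor
    · refine le_of_mul_le_mul_left ?_ ht2
      rw [hD, hq]
      linarith [a1.1, a2.2, a3.1, a1.2, a2.1, a3.2]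
    · refine le_of_mul_le_mul_left ?_ ht2
      rw [hD, hq]
      linarith [a1.1, a2.2, a3.1, a1.2, a2.1, a3.2]
  have hD0 : |D| ≤ 0 := by
    refine le_of_forall_pos_le_add fun ς hς => ?_
    set C := 4 * M * ‖k‖ ^ 2 + |q| + 1 with hC
    have hC0 : 0 < C := by positivity
    set τ := min 1 (ς / C) with hτ
    have hτ0 : 0 < τ := by positivity
    have hτC : τ * C ≤ ς := by rw [← le_div_iff₀ hC0]; exact min_le_right _ _
    have h1 := key τ hτ0 (min_le_left _ _)
    have h2 : τ * |D| ≤ τ * (τ * (4 * M * ‖k‖ ^ 2 + |q|)) := by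
      have e : τ * D = 2 * (1 / 2 * (τ * D + τ ^ 2 * q)) - τ ^ 2 * q := by ring
      rw [← abs_of_pos hτ0, ← abs_mul, abs_of_pos hτ0, e]
      refine (abs_sub _ _).trans ?_
      rw [abs_mul 2, abs_mul (τ ^ 2), abs_of_nonneg (sq_nonneg τ), abs_two]
      nlinarith
    have h3 := le_of_mul_le_mul_left h2 hτ0
    rw [zero_add]
    nlinarith
  have : D = 0 := abs_nonpos_iff.1 hD0
  rw [hD] at this
  rw [real_inner_comm (L k) h]
  linarith

theorem quadratic_ge_of_expansion {p : EuclideanSpace ℝ (Fin n)} {c : ℝ}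
    (h : ∀ ε > 0, ∀ᶠ y in 𝓝 x,
      |w y - w x - inner ℝ p (y - x) - 1 / 2 * inner ℝ (L (y - x)) (y - x)| ≤ ε * ‖y - x‖ ^ 2)
    (hc : ∀ᶠ y in 𝓝 x, c * ‖y - x‖ ^ 2 ≤ w y - w x - inner ℝ p (y - x))
    (k : EuclideanSpace ℝ (Fin n)) : 2 * c * ‖k‖ ^ 2 ≤ inner ℝ (L k) k := by
  refine le_of_forall_pos_le_add fun ς hς => ?_
  have hε : 0 < ς / (2 * (‖k‖ ^ 2 + 1)) := by positivity
  obtain ⟨ρ, hρ, H⟩ := Metric.eventually_nhds_iff.1 ((h _ hε).and hc)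
  obtain ⟨t, ht0, ht⟩ := exists_between (show (0 : ℝ) < ρ / (‖k‖ + 1) by positivity)
  rw [lt_div_iff₀ (by positivity)] at ht
  have hn : ‖t • k‖ = t * ‖k‖ := by rw [norm_smul, Real.norm_of_nonneg ht0.le]
  obtain ⟨h1, h2⟩ := H (y := x + t • k) (by
    rw [dist_eq_norm, add_sub_cancel_left, hn]; nlinarith)
  rw [add_sub_cancel_left, hn] at h1 h2
  simp only [map_smul, inner_smul_left, inner_smul_right, RCLike.conj_to_real] at h1 h2
  have h3 := (abs_le.1 h1).2
  have h4 : ς / (2 * (‖k‖ ^ 2 + 1)) * (t * ‖k‖) ^ 2 ≤ t ^ 2 * (ς / 2) := by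
    have : ‖k‖ ^ 2 / (‖k‖ ^ 2 + 1) ≤ 1 := by
      rw [div_le_one (by positivity)]; linarith
    have e : ς / (2 * (‖k‖ ^ 2 + 1)) * (t * ‖k‖) ^ 2
        = t ^ 2 * (ς / 2) * (‖k‖ ^ 2 / (‖k‖ ^ 2 + 1)) := by field_simp
    rw [e]
    exact mul_le_of_le_one_right (by positivity) this
  have ht2 : 0 < t ^ 2 := by positivity
  refine le_of_mul_le_mul_left ?_ ht2
  linarith

end Expansion

/-! ### Contact points, vertices and the Jacobian estimate. -/

/-- Lipschitz maps do not create n-dimensional Hausdorff measure from null sets, and this measure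
has the same null sets as the volume. -/
theorem volume_image_eq_zero_of_lipschitzOn {n : ℕ}
    {T : EuclideanSpace ℝ (Fin n) → EuclideanSpace ℝ (Fin n)} {K : ℝ≥0}
    {s : Set (EuclideanSpace ℝ (Fin n))} (hT : LipschitzOnWith K T s) (hs : volume s = 0) :
    volume (T '' s) = 0 := by
  have : (μH[(n : ℝ)] : Measure (EuclideanSpace ℝ (Fin n))).IsAddHaarMeasure := by
    have h := isAddHaarMeasure_hausdorffMeasure (E := EuclideanSpace ℝ (Fin n))
    rwa [finrank_euclideanSpace, Fintype.card_fin] at h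
  have h1 : (μH[(n : ℝ)] : Measure (EuclideanSpace ℝ (Fin n))) s = 0 :=
    Measure.absolutelyContinuous_isAddHaarMeasure _ volume hs
  refine Measure.absolutelyContinuous_isAddHaarMeasure volume
    (μH[(n : ℝ)] : Measure (EuclideanSpace ℝ (Fin n))) ?_
  refine le_antisymm ((hT.hausdorffMeasure_image_le (Nat.cast_nonneg n)).trans ?_) (zero_le)
  rw [h1, mul_zero]

/-- The pairs of contact points and vertices for the concave paraboloids of opening `a` with
vertex in `V` that touch `v` from below in the closed unit ball. -/
def contactPairs {n : ℕ} (v : EuclideanSpace ℝ (Fin n) → ℝ) (a : ℝ)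
    (V : Set (EuclideanSpace ℝ (Fin n))) :
    Set (EuclideanSpace ℝ (Fin n) × EuclideanSpace ℝ (Fin n)) :=
  {q | q.1 ∈ closedBall 0 1 ∧ q.2 ∈ V ∧ ∀ z ∈ closedBall (0 : EuclideanSpace ℝ (Fin n)) 1,
    v q.1 + a / 2 * ‖q.1 - q.2‖ ^ 2 ≤ v z + a / 2 * ‖z - q.2‖ ^ 2}

section Contact

variable {n : ℕ} {v : EuclideanSpace ℝ (Fin n) → ℝ} {a θ : ℝ}
  {V : Set (EuclideanSpace ℝ (Fin n))}

theorem isCompact_contactPairs (hv : Continuous v) (hV : IsCompact V) :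
    IsCompact (contactPairs v a V) := by
  have h : IsClosed {q : EuclideanSpace ℝ (Fin n) × EuclideanSpace ℝ (Fin n) |
      ∀ z ∈ closedBall (0 : EuclideanSpace ℝ (Fin n)) 1,
        v q.1 + a / 2 * ‖q.1 - q.2‖ ^ 2 ≤ v z + a / 2 * ‖z - q.2‖ ^ 2} := by
    simp only [Set.ofPred_forall]
    refine isClosed_iInter fun z => isClosed_iInter fun _ => ?_
    exact isClosed_le (by fun_prop) (by fun_prop)
  refine (((isCompact_closedBall 0 1).prod hV).inter_right h).of_isClosed_subset ?_ ?_
  · have : contactPairs v a V = (closedBall 0 1 ×ˢ V) ∩ {q |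
      ∀ z ∈ closedBall (0 : EuclideanSpace ℝ (Fin n)) 1,
        v q.1 + a / 2 * ‖q.1 - q.2‖ ^ 2 ≤ v z + a / 2 * ‖z - q.2‖ ^ 2} := by
      ext q; simp only [contactPairs, Set.mem_ofPred_eq, Set.mem_inter_iff, Set.mem_prod]; tauto
    rw [this]
    exact ((isClosed_closedBall).prod hV.isClosed).inter h
  · exact fun q hq => ⟨⟨hq.1, hq.2.1⟩, hq.2.2⟩

theorem exists_contactPair (hv : Continuous v) {y : EuclideanSpace ℝ (Fin n)} (hy : y ∈ V) :
    ∃ z, (z, y) ∈ contactPairs v a V := by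
  obtain ⟨z, hz, hmin⟩ := (isCompact_closedBall (0 : EuclideanSpace ℝ (Fin n)) 1).exists_isMinOn
    ⟨0, by simp⟩ (f := fun z => v z + a / 2 * ‖z - y‖ ^ 2) (by fun_prop)
  exact ⟨z, hz, hy, fun z' hz' => hmin hz'⟩

/-- In the sum of the two minimality inequalities the values of v and all squared norms cancel, and
only the mixed inner products remain. -/
theorem contactPairs_monotone (ha : 0 < a)
    {q r : EuclideanSpace ℝ (Fin n) × EuclideanSpace ℝ (Fin n)}
    (hq : q ∈ contactPairs v a V) (hr : r ∈ contactPairs v a V) :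
    0 ≤ inner ℝ (q.1 - r.1) (q.2 - r.2) := by
  have h1 := hq.2.2 r.1 hr.1
  have h2 := hr.2.2 q.1 hq.1
  simp only [@norm_sub_sq ℝ] at h1 h2
  simp only [inner_sub_left, inner_sub_right]
  simp only [RCLike.re_to_real] at h1 h2
  have : 0 ≤ a * (inner ℝ q.1 q.2 - inner ℝ q.1 r.2 - (inner ℝ r.1 q.2 - inner ℝ r.1 r.2)) := by
    linarith
  have := nonneg_of_mul_nonneg_right this ha
  linarith

/-- Pairing the difference of the dividing points with the difference of the vertices, the contact
points contribute nonnegatively by monotonicity. A contact point may have several vertices, but the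
vertex is a Lipschitz function, with constant 1/θ, of the dividing point. -/
theorem contactPairs_dist_le (ha : 0 < a) (hθ1 : θ < 1)
    {q r : EuclideanSpace ℝ (Fin n) × EuclideanSpace ℝ (Fin n)}
    (hq : q ∈ contactPairs v a V) (hr : r ∈ contactPairs v a V) :
    θ * ‖q.2 - r.2‖ ≤ ‖((1 - θ) • q.1 + θ • q.2) - ((1 - θ) • r.1 + θ • r.2)‖ := by
  have hm := contactPairs_monotone ha hq hr
  have e : ((1 - θ) • q.1 + θ • q.2) - ((1 - θ) • r.1 + θ • r.2)
      = (1 - θ) • (q.1 - r.1) + θ • (q.2 - r.2) := by module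
  rw [e]
  have hCS := real_inner_le_norm ((1 - θ) • (q.1 - r.1) + θ • (q.2 - r.2)) (q.2 - r.2)
  rw [inner_add_left, inner_smul_left, inner_smul_left, real_inner_self_eq_norm_sq] at hCS
  simp only [RCLike.conj_to_real] at hCS
  rcases (norm_nonneg (q.2 - r.2)).eq_or_lt with h0 | h0
  · rw [← h0]; simp
  · refine le_of_mul_le_mul_right ?_ h0
    have : 0 ≤ (1 - θ) * inner ℝ (q.1 - r.1) (q.2 - r.2) := mul_nonneg (by linarith) hm
    nlinarith

/-- Convexity of the square. Equality holds when A and B are in the ratio θ to 1 - θ, which is why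
the dividing points are the ones where the inf-convolution can be computed. -/
theorem norm_add_sq_le_weighted (hθ0 : 0 < θ) (hθ1 : θ < 1) (A B : EuclideanSpace ℝ (Fin n)) :
    ‖A + B‖ ^ 2 ≤ ‖A‖ ^ 2 / θ + ‖B‖ ^ 2 / (1 - θ) := by
  have h1 : 0 < 1 - θ := by linarith
  have h2 := sq_nonneg ‖(1 - θ) • A - θ • B‖
  rw [@norm_sub_sq ℝ, norm_smul, norm_smul, Real.norm_of_nonneg hθ0.le,
    Real.norm_of_nonneg h1.le, inner_smul_left, inner_smul_right] at h2
  simp only [RCLike.conj_to_real, RCLike.re_to_real] at h2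
  rw [@norm_add_sq ℝ, RCLike.re_to_real, div_add_div _ _ hθ0.ne' h1.ne', le_div_iff₀ (by positivity)]
  nlinarith

/-- The inf-convolution, over the closed unit ball, of a continuous function. -/
theorem exists_infConvolution (hv : Continuous v) (κ : ℝ) :
    ∃ w : EuclideanSpace ℝ (Fin n) → ℝ,
      (∀ x, ∀ z ∈ closedBall (0 : EuclideanSpace ℝ (Fin n)) 1, w x ≤ v z + κ / 2 * ‖x - z‖ ^ 2) ∧
      ∀ x, ∃ z ∈ closedBall (0 : EuclideanSpace ℝ (Fin n)) 1,
        w x = v z + κ / 2 * ‖x - z‖ ^ 2 := by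
  have h : ∀ x : EuclideanSpace ℝ (Fin n), ∃ z ∈ closedBall (0 : EuclideanSpace ℝ (Fin n)) 1,
      ∀ z' ∈ closedBall (0 : EuclideanSpace ℝ (Fin n)) 1,
        v z + κ / 2 * ‖x - z‖ ^ 2 ≤ v z' + κ / 2 * ‖x - z'‖ ^ 2 := by
    intro x
    obtain ⟨z, hz, hmin⟩ := (isCompact_closedBall
      (0 : EuclideanSpace ℝ (Fin n)) 1).exists_isMinOn
      ⟨0, by simp⟩ (f := fun z => v z + κ / 2 * ‖x - z‖ ^ 2) (by fun_prop)
    exact ⟨z, hz, fun z' hz' => hmin hz'⟩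
  choose g hg hmin using h
  exact ⟨fun x => v (g x) + κ / 2 * ‖x - g x‖ ^ 2, hmin, fun x => ⟨g x, hg x, rfl⟩⟩

/-- The inf-convolution is touched from both sides by paraboloids at the points that divide the
segments between contact points and vertices in the ratio `θ`. -/
theorem infConvolution_touch (ha : 0 < a) (hθ0 : 0 < θ) (hθ1 : θ < 1)
    {w : EuclideanSpace ℝ (Fin n) → ℝ}
    (hw1 : ∀ x, ∀ z ∈ closedBall (0 : EuclideanSpace ℝ (Fin n)) 1,
      w x ≤ v z + a / θ / 2 * ‖x - z‖ ^ 2)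
    (hw2 : ∀ x, ∃ z ∈ closedBall (0 : EuclideanSpace ℝ (Fin n)) 1,
      w x = v z + a / θ / 2 * ‖x - z‖ ^ 2)
    {q : EuclideanSpace ℝ (Fin n) × EuclideanSpace ℝ (Fin n)} (hq : q ∈ contactPairs v a V)
    {x : EuclideanSpace ℝ (Fin n)} (hx : x = (1 - θ) • q.1 + θ • q.2) :
    w x = v q.1 + a / θ / 2 * ‖x - q.1‖ ^ 2 ∧ ∀ y,
      -(a / (1 - θ) / 2) * ‖y - x‖ ^ 2 ≤ w y - w x - inner ℝ (a • (q.2 - q.1)) (y - x) ∧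
      w y - w x - inner ℝ (a • (q.2 - q.1)) (y - x) ≤ a / θ / 2 * ‖y - x‖ ^ 2 := by
  obtain ⟨z, p⟩ := q
  simp only at hx ⊢
  have h1 : 0 < 1 - θ := by linarith
  have hxz : x - z = θ • (p - z) := by rw [hx]; module
  have hxp : x - p = (1 - θ) • (z - p) := by rw [hx]; module
  have hnz : ‖x - z‖ = θ * ‖z - p‖ := by
    rw [hxz, norm_smul, Real.norm_of_nonneg hθ0.le, norm_sub_rev]
  have hnp : ‖x - p‖ = (1 - θ) * ‖z - p‖ := by
    rw [hxp, norm_smul, Real.norm_of_nonneg h1.le]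
  have hsum : a / θ / 2 * ‖x - z‖ ^ 2 + a / (1 - θ) / 2 * ‖x - p‖ ^ 2
      = a / 2 * ‖z - p‖ ^ 2 := by
    rw [hnz, hnp]; field_simp; ring
  -- The contact paraboloid with vertex p lies below v. Its inf-convolution with parameter a/θ is a
  -- paraboloid of opening a/(1 - θ) with the same vertex; by `hsum` it meets the upper paraboloid
  -- at x.
  have hlow : ∀ y, v z + a / 2 * ‖z - p‖ ^ 2 - a / (1 - θ) / 2 * ‖y - p‖ ^ 2 ≤ w y := by
    intro y
    obtain ⟨z', hz', hwy⟩ := hw2 y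
    have h2 := hq.2.2 z' hz'
    have h3 := norm_add_sq_le_weighted hθ0 hθ1 (z' - y) (y - p)
    rw [sub_add_sub_cancel, norm_sub_rev z' y] at h3
    have h4 := mul_le_mul_of_nonneg_left h3 (by positivity : 0 ≤ a / 2)
    have h5 : a / 2 * (‖y - z'‖ ^ 2 / θ + ‖y - p‖ ^ 2 / (1 - θ))
        = a / θ / 2 * ‖y - z'‖ ^ 2 + a / (1 - θ) / 2 * ‖y - p‖ ^ 2 := by
      field_simp
    simp only at h2
    linarith
  have hwx : w x = v z + a / θ / 2 * ‖x - z‖ ^ 2 :=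
    le_antisymm (hw1 x z hq.1) (by linarith [hlow x])
  have hin1 : ∀ k, inner ℝ (x - z) k = θ * inner ℝ (p - z) k := by
    intro k; rw [hxz, inner_smul_left]; simp
  have hin2 : ∀ k, inner ℝ (x - p) k = -(1 - θ) * inner ℝ (p - z) k := by
    intro k
    rw [hxp, ← neg_sub p z, inner_smul_left, inner_neg_left]; simp; ring
  refine ⟨hwx, fun y => ⟨?_, ?_⟩⟩
  · have h2 := hlow y
    have e : y - p = (x - p) + (y - x) := by abel
    rw [e, @norm_add_sq ℝ, RCLike.re_to_real, hin2] at h2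
    rw [inner_smul_left, RCLike.conj_to_real]
    have e2 : a / (1 - θ) / 2 * (‖x - p‖ ^ 2 + 2 * (-(1 - θ) * inner ℝ (p - z) (y - x))
        + ‖y - x‖ ^ 2) = a / (1 - θ) / 2 * ‖x - p‖ ^ 2 - a * inner ℝ (p - z) (y - x)
        + a / (1 - θ) / 2 * ‖y - x‖ ^ 2 := by
      field_simp; ring
    linarith
  · have h2 := hw1 y z hq.1
    have e : y - z = (x - z) + (y - x) := by abel
    rw [e, @norm_add_sq ℝ, RCLike.re_to_real, hin1] at h2
    rw [inner_smul_left, RCLike.conj_to_real]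
    have e2 : a / θ / 2 * (‖x - z‖ ^ 2 + 2 * (θ * inner ℝ (p - z) (y - x))
        + ‖y - x‖ ^ 2) = a / θ / 2 * ‖x - z‖ ^ 2 + a * inner ℝ (p - z) (y - x)
        + a / θ / 2 * ‖y - x‖ ^ 2 := by
      field_simp
    linarith

/-- The one-sided quadratic bound of the inf-convolution at a dividing point passes to a subjet of
the function at the contact point. -/
theorem hasSubjet_of_infConvolution (ha : 0 < a)
    {w : EuclideanSpace ℝ (Fin n) → ℝ}
    (hw1 : ∀ x, ∀ z ∈ closedBall (0 : EuclideanSpace ℝ (Fin n)) 1,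
      w x ≤ v z + a / θ / 2 * ‖x - z‖ ^ 2)
    {x z p : EuclideanSpace ℝ (Fin n)} (hz : z ∈ ball (0 : EuclideanSpace ℝ (Fin n)) 1)
    (hwx : w x = v z + a / θ / 2 * ‖x - z‖ ^ 2)
    {H : EuclideanSpace ℝ (Fin n) →L[ℝ] EuclideanSpace ℝ (Fin n)}
    (hexp : ∀ ε > 0, ∀ᶠ y in 𝓝 x,
      |w y - w x - inner ℝ p (y - x) - 1 / 2 * inner ℝ (H (y - x)) (y - x)| ≤ ε * ‖y - x‖ ^ 2) :
    HasSubjet v z p (H - a • ContinuousLinearMap.id ℝ _) := by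
  -- Moving both arguments in parallel keeps the penalty |x - z|² constant, so a lower expansion of
  -- w at x becomes one of v at z. Lowering H by a absorbs the error term.
  have h1 : ∀ᶠ y in 𝓝 z, |w (x + (y - z)) - w x - inner ℝ p (y - z)
      - 1 / 2 * inner ℝ (H (y - z)) (y - z)| ≤ a / 2 * ‖y - z‖ ^ 2 := by
    have ht : Filter.Tendsto (fun y => x + (y - z)) (𝓝 z) (𝓝 x) := by
      have : Continuous fun y => x + (y - z) := by fun_prop
      simpa using this.tendsto z
    simpa using ht.eventually (hexp (a / 2) (by positivity))
  filter_upwards [h1, isOpen_ball.eventually_mem hz] with y hy hyb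
  have h2 := hw1 (x + (y - z)) y (ball_subset_closedBall hyb)
  have e : x + (y - z) - y = x - z := by abel
  rw [e] at h2
  have h3 := (abs_le.1 hy).1
  have e2 : inner ℝ ((H - a • ContinuousLinearMap.id ℝ (EuclideanSpace ℝ (Fin n))) (y - z)) (y - z)
      = inner ℝ (H (y - z)) (y - z) - a * ‖y - z‖ ^ 2 := by
    rw [← real_inner_self_eq_norm_sq, sub_apply, inner_sub_left, smul_apply, inner_smul_left]
    simp
  rw [quadPoly, e2]
  linarith

/-- If the subjets at the contact points are bounded above, then the vertices occupy at most a
multiple of the measure of the contact points. -/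
theorem volume_vertices_le_dividing (hv : Continuous v) (hV : IsCompact V) (ha : 0 < a)
    (hθ0 : 0 < θ) (hθ1 : θ ≤ 1 / 2) {C : ℝ}
    (hint : ∀ q ∈ contactPairs v a V, q.1 ∈ ball (0 : EuclideanSpace ℝ (Fin n)) 1)
    (hjet : ∀ q ∈ contactPairs v a V,
      ∀ X : EuclideanSpace ℝ (Fin n) →L[ℝ] EuclideanSpace ℝ (Fin n),
      (∀ h k, inner ℝ (X h) k = inner ℝ h (X k)) →
      (∀ h, -(3 * a) * ‖h‖ ^ 2 ≤ inner ℝ (X h) h) →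
      HasSubjet v q.1 (a • (q.2 - q.1)) X → formTrace X + 3 * a * n ≤ C * a) :
    volume V ≤ ENNReal.ofReal (C ^ n) *
      volume ((fun q : EuclideanSpace ℝ (Fin n) × EuclideanSpace ℝ (Fin n) =>
        (1 - θ) • q.1 + θ • q.2) '' contactPairs v a V) := by
  classical
  set mix := fun q : EuclideanSpace ℝ (Fin n) × EuclideanSpace ℝ (Fin n) =>
    (1 - θ) • q.1 + θ • q.2 with hmix
  set Γ := contactPairs v a V with hΓ
  set A := mix '' Γ with hA
  have hθ1' : θ < 1 := by linarith
  have h1θ : 0 < 1 - θ := by linarith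
  have hAm : MeasurableSet A :=
    ((isCompact_contactPairs hv hV).image (by fun_prop : Continuous mix)).measurableSet
  have hdist : ∀ q ∈ Γ, ∀ r ∈ Γ, θ * ‖q.2 - r.2‖ ≤ ‖mix q - mix r‖ := fun q hq r hr =>
    contactPairs_dist_le ha hθ1' hq hr
  -- T sends a dividing point to its vertex; `hdist` makes this unambiguous on A.
  obtain ⟨T, hT⟩ : ∃ T : EuclideanSpace ℝ (Fin n) → EuclideanSpace ℝ (Fin n),
      ∀ q ∈ Γ, T (mix q) = q.2 := by
    refine ⟨fun x => if h : ∃ q ∈ Γ, mix q = x then h.choose.2 else 0, fun q hq => ?_⟩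
    have h : ∃ r ∈ Γ, mix r = mix q := ⟨q, hq, rfl⟩
    simp only [dif_pos h]
    have h2 := hdist _ h.choose_spec.1 q hq
    rw [h.choose_spec.2, sub_self, norm_zero] at h2
    have h3 : ‖h.choose.2 - q.2‖ ≤ 0 := by
      by_contra! h4
      nlinarith
    exact sub_eq_zero.1 (norm_le_zero_iff.1 h3)
  have hTL : LipschitzOnWith (Real.toNNReal θ⁻¹) T A := by
    refine LipschitzOnWith.of_dist_le_mul ?_
    rintro _ ⟨q, hq, rfl⟩ _ ⟨r, hr, rfl⟩
    rw [hT q hq, hT r hr, dist_eq_norm, dist_eq_norm, Real.coe_toNNReal _ (by positivity),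
      inv_mul_eq_div, le_div_iff₀ hθ0, mul_comm]
    exact hdist q hq r hr
  have hVT : V ⊆ T '' A := by
    intro y hy
    obtain ⟨z, hz⟩ := exists_contactPair (a := a) hv hy
    exact ⟨mix (z, y), ⟨_, hz, rfl⟩, hT _ hz⟩
  obtain ⟨w, hw1, hw2⟩ := exists_infConvolution hv (a / θ)
  set α := a / (1 - θ) with hα
  have hα0 : 0 < α := by positivity
  have hαa : a ≤ α := by rw [hα, le_div_iff₀ h1θ]; nlinarith
  have hα2 : α ≤ 2 * a := by rw [hα, div_le_iff₀ h1θ]; nlinarith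
  -- This is the slope of the inf-convolution on A, so differentiating T amounts to differentiating
  -- a gradient.
  set P := fun x => α • (T x - x) with hP
  have hPmix : ∀ q ∈ Γ, P (mix q) = a • (q.2 - q.1) := by
    intro q hq
    have : q.2 - mix q = (1 - θ) • (q.2 - q.1) := by rw [hmix]; module
    simp only [hP]
    rw [hT q hq, this, smul_smul, hα, div_mul_cancel₀ _ h1θ.ne']
  have hgood : ∀ᵐ x, x ∈ A → IsThickAt A x ∧ DifferentiableWithinAt ℝ T A x := by
    filter_upwards [hTL.ae_differentiableWithinAt_of_mem (μ := volume),
      (ae_restrict_iff' hAm).1 (ae_isThickAt A)] with x h1 h2 hx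
    exact ⟨h2 hx, h1 hx⟩
  have hdet : ∀ x ∈ A, IsThickAt A x → DifferentiableWithinAt ℝ T A x →
      |(fderivWithin ℝ T A x).det| ≤ C ^ n := by
    intro x hx hthick hdiff
    obtain ⟨q, hq, hqx⟩ := id hx
    set L := fderivWithin ℝ T A x with hL
    set H := α • (L - ContinuousLinearMap.id ℝ (EuclideanSpace ℝ (Fin n))) with hH
    have hPd : HasFDerivWithinAt P H A x :=
      (hdiff.hasFDerivWithinAt.sub (hasFDerivWithinAt_id x A)).const_smul α
    have hM : ∀ b ∈ A, ∀ y ∈ (Set.univ : Set (EuclideanSpace ℝ (Fin n))),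
        |w y - w b - inner ℝ (P b) (y - b)| ≤ (α / 2 + a / θ / 2) * ‖y - b‖ ^ 2 := by
      rintro _ ⟨r, hr, rfl⟩ y -
      obtain ⟨h3, h4⟩ := (infConvolution_touch ha hθ0 hθ1' hw1 hw2 hr rfl).2 y
      rw [hPmix r hr, abs_le]
      have e1 : 0 ≤ α / 2 * ‖y - mix r‖ ^ 2 := by positivity
      have e2 : 0 ≤ a / θ / 2 * ‖y - mix r‖ ^ 2 := by positivity
      simp only [hmix] at *
      constructor <;> linarith
    have hM0 : 0 ≤ α / 2 + a / θ / 2 := by positivity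
    have hHs := symmetric_of_thick hM0 Filter.univ_mem hM hPd hthick
    have hexp := fun (ε : ℝ) (hε : ε > 0) =>
      second_order_of_thick hM0 Filter.univ_mem hM hPd hthick hε
    obtain ⟨hwx, htouch⟩ := infConvolution_touch ha hθ0 hθ1' hw1 hw2 hq hqx.symm
    have hPx : P x = a • (q.2 - q.1) := by rw [← hqx]; exact hPmix q hq
    rw [hPx] at hexp
    -- Touching from below by opening α gives H ≥ -α, that is L ≥ 0, and with α ≤ 2a also H - a ≥
    -- -3a, the range in which `hjet` applies.
    have hHα : ∀ k, -α * ‖k‖ ^ 2 ≤ inner ℝ (H k) k := by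
      intro k
      have := quadratic_ge_of_expansion (c := -(α / 2)) hexp
        (Filter.Eventually.of_forall fun y => (htouch y).1) k
      linarith
    have hHapp : ∀ h k, inner ℝ (H h) k = α * (inner ℝ (L h) k - inner ℝ h k) := by
      intro h k
      simp [hH, inner_smul_left, inner_sub_left]
    have hLs : ∀ h k, inner ℝ (L h) k = inner ℝ h (L k) := by
      intro h k
      have h5 := hHs h k
      rw [real_inner_comm (H k) h, hHapp, hHapp, real_inner_comm h k] at h5
      have h6 := mul_left_cancel₀ hα0.ne' h5
      rw [real_inner_comm (L k) h]
      linarith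
    have hLpos : ∀ h, 0 ≤ inner ℝ (L h) h := by
      intro h
      have h5 := hHα h
      rw [hHapp, real_inner_self_eq_norm_sq] at h5
      by_contra! h6
      nlinarith
    have hj := hjet q hq (H - a • ContinuousLinearMap.id ℝ _) ?_ ?_
      (hasSubjet_of_infConvolution ha hw1 (hint q hq) hwx hexp)
    · have htr : formTrace H = α * (formTrace L - n) := by
        have h7 := formTrace_sub_smul_id L 1
        rw [one_smul, mul_one] at h7
        rw [hH, formTrace_smul, h7]
      rw [formTrace_sub_smul_id, htr] at hj
      have htrL : 0 ≤ formTrace L := Finset.sum_nonneg fun i _ => hLpos _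
      have hn : (0 : ℝ) ≤ n := Nat.cast_nonneg n
      -- The bound reads α tr L + (2a - α)n ≤ Ca, and a ≤ α ≤ 2a.
      have h8 : formTrace L ≤ C := by
        refine le_of_mul_le_mul_right ?_ ha
        nlinarith
      exact (det_le_trace_pow hLs hLpos).trans (pow_le_pow_left₀ htrL h8 n)
    · intro h k
      simp [inner_sub_left, inner_sub_right, inner_smul_left, inner_smul_right, hHs h k]
    · intro h
      have h5 := hHα h
      simp only [sub_apply, smul_apply, ContinuousLinearMap.id_apply, inner_sub_left,
        inner_smul_left, RCLike.conj_to_real, real_inner_self_eq_norm_sq]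
      nlinarith [sq_nonneg ‖h‖]
  -- The bad points are enclosed in a measurable null set. Its part in A has a null image since T is
  -- Lipschitz there.
  set N := toMeasurable volume
    {x | ¬ (x ∈ A → IsThickAt A x ∧ DifferentiableWithinAt ℝ T A x)} with hN
  have hN0 : volume N = 0 := by rw [hN, measure_toMeasurable]; exact hgood
  have hNgood : ∀ x ∈ A \ N, IsThickAt A x ∧ DifferentiableWithinAt ℝ T A x := by
    intro x hx
    by_contra hcon
    exact hx.2 (subset_toMeasurable _ _ (fun h => hcon (h hx.1)))
  have himg : volume (T '' (A \ N)) ≤ ENNReal.ofReal (C ^ n) * volume A := by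
    have h1 := addHaar_image_le_lintegral_abs_det_fderiv (volume : Measure (EuclideanSpace ℝ (Fin n)))
      (s := A \ N) (f := T) (f' := fun x => fderivWithin ℝ T A x)
      (hAm.diff (measurableSet_toMeasurable _ _))
      fun x hx => (hNgood x hx).2.hasFDerivWithinAt.mono Set.sdiff_subset
    refine h1.trans ?_
    calc ∫⁻ x in A \ N, ENNReal.ofReal |(fderivWithin ℝ T A x).det|
        ≤ ∫⁻ _x in A \ N, ENNReal.ofReal (C ^ n) := by
          refine setLIntegral_mono' (hAm.diff (measurableSet_toMeasurable _ _)) fun x hx => ?_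
          exact ENNReal.ofReal_le_ofReal (hdet x hx.1 (hNgood x hx).1 (hNgood x hx).2)
      _ ≤ _ := by
          rw [setLIntegral_const]
          gcongr
          exact Set.sdiff_subset
  have hnull : volume (T '' (A ∩ N)) = 0 :=
    volume_image_eq_zero_of_lipschitzOn (hTL.mono Set.inter_subset_left)
      (measure_mono_null Set.inter_subset_right hN0)
  calc volume V ≤ volume (T '' (A \ N) ∪ T '' (A ∩ N)) := by
        refine measure_mono (hVT.trans ?_)
        rw [← Set.image_union, Set.sdiff_union_inter]
    _ ≤ volume (T '' (A \ N)) + volume (T '' (A ∩ N)) := measure_union_le _ _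
    _ ≤ _ := by rw [hnull, add_zero]; exact himg

/-- The constant for the dividing points does not depend on θ. As θ → 0 they lie in thickenings of
the compact contact set whose measures tend to that of the set. -/
theorem volume_vertices_le (hv : Continuous v) (hV : IsCompact V) (ha : 0 < a) {C : ℝ}
    (hint : ∀ q ∈ contactPairs v a V, q.1 ∈ ball (0 : EuclideanSpace ℝ (Fin n)) 1)
    (hjet : ∀ q ∈ contactPairs v a V,
      ∀ X : EuclideanSpace ℝ (Fin n) →L[ℝ] EuclideanSpace ℝ (Fin n),
      (∀ h k, inner ℝ (X h) k = inner ℝ h (X k)) →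
      (∀ h, -(3 * a) * ‖h‖ ^ 2 ≤ inner ℝ (X h) h) →
      HasSubjet v q.1 (a • (q.2 - q.1)) X → formTrace X + 3 * a * n ≤ C * a) :
    volume V ≤ ENNReal.ofReal (C ^ n) * volume (Prod.fst '' contactPairs v a V) := by
  have hΓ := isCompact_contactPairs (a := a) hv hV
  set S := Prod.fst '' contactPairs v a V with hS
  have hSc : IsCompact S := hΓ.image continuous_fst
  obtain ⟨R, hR⟩ : ∃ R, ∀ q ∈ contactPairs v a V, ‖q.2 - q.1‖ ≤ R :=
    hΓ.exists_bound_of_continuousOn (f := fun q => q.2 - q.1) (by fun_prop)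
  have hR0 : 0 ≤ max R 0 := le_max_right _ _
  have ht : Filter.Tendsto (fun θ : ℝ => θ * max R 0) (𝓝[>] 0) (𝓝 0) := by
    have : Continuous fun θ : ℝ => θ * max R 0 := by fun_prop
    simpa using (this.tendsto 0).mono_left nhdsWithin_le_nhds
  have hlim := ENNReal.Tendsto.const_mul (a := ENNReal.ofReal (C ^ n))
    ((tendsto_measure_cthickening_of_isCompact (μ := volume) hSc).comp ht)
    (Or.inr ENNReal.ofReal_ne_top)
  refine ge_of_tendsto hlim ?_
  have hIoc : Set.Ioc (0 : ℝ) (1 / 2) ∈ 𝓝[>] (0 : ℝ) := Ioc_mem_nhdsGT (by norm_num)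
  filter_upwards [hIoc] with θ hθ
  refine (volume_vertices_le_dividing hv hV ha hθ.1 hθ.2 hint hjet).trans ?_
  simp only [Function.comp_apply]
  gcongr
  rintro _ ⟨q, hq, rfl⟩
  refine mem_cthickening_of_dist_le _ q.1 _ _ ⟨q, hq, rfl⟩ ?_
  have e : (1 - θ) • q.1 + θ • q.2 - q.1 = θ • (q.2 - q.1) := by module
  simp only
  rw [dist_eq_norm, e, norm_smul, Real.norm_of_nonneg hθ.1.le]
  exact mul_le_mul_of_nonneg_left ((hR q hq).trans (le_max_left _ _)) hθ.1.le

end Contact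

/-! ### Touching sets and the Gaussian barrier. -/

/-- The points at which a concave paraboloid of opening `a` touches `u` from below in the closed
unit ball. -/
def touchSet {n : ℕ} (u : EuclideanSpace ℝ (Fin n) → ℝ) (a : ℝ) :
    Set (EuclideanSpace ℝ (Fin n)) :=
  {x | x ∈ closedBall 0 1 ∧ ∃ p : EuclideanSpace ℝ (Fin n),
    ∀ y ∈ closedBall (0 : EuclideanSpace ℝ (Fin n)) 1,
      u x + inner ℝ p (y - x) - a / 2 * ‖y - x‖ ^ 2 ≤ u y}

theorem touchSet_mono {n : ℕ} (u : EuclideanSpace ℝ (Fin n) → ℝ) {a b : ℝ} (hab : a ≤ b) :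
    touchSet u a ⊆ touchSet u b := by
  rintro x ⟨hx, p, hp⟩
  refine ⟨hx, p, fun y hy => le_trans ?_ (hp y hy)⟩
  have : a / 2 * ‖y - x‖ ^ 2 ≤ b / 2 * ‖y - x‖ ^ 2 := by gcongr
  linarith

/-- A touching paraboloid of a bounded function has a bounded slope away from the boundary. -/
theorem norm_slope_le {n : ℕ} {u : EuclideanSpace ℝ (Fin n) → ℝ} {a t : ℝ}
    {x p : EuclideanSpace ℝ (Fin n)}
    (hu : ∀ y ∈ closedBall (0 : EuclideanSpace ℝ (Fin n)) 1, |u y| ≤ 1) (ha : 0 ≤ a) (ht : 0 ≤ t)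
    (hxt : ‖x‖ + t ≤ 1)
    (hp : ∀ y ∈ closedBall (0 : EuclideanSpace ℝ (Fin n)) 1,
      u x + inner ℝ p (y - x) - a / 2 * ‖y - x‖ ^ 2 ≤ u y) :
    ‖p‖ * t ≤ 2 + a / 2 * t ^ 2 := by
  have hx : x ∈ closedBall (0 : EuclideanSpace ℝ (Fin n)) 1 := by simp; linarith
  rcases (norm_nonneg p).eq_or_lt with h0 | h0
  · rw [← h0, zero_mul]; positivity
  · set y := x + (t / ‖p‖) • p with hy
    have hn : ‖y - x‖ = t := by
      rw [hy, add_sub_cancel_left, norm_smul, Real.norm_of_nonneg (by positivity),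
        div_mul_cancel₀ _ h0.ne']
    have hyD : y ∈ closedBall (0 : EuclideanSpace ℝ (Fin n)) 1 := by
      rw [mem_closedBall, dist_zero_right]
      have := norm_add_le x (y - x)
      rw [add_sub_cancel] at this
      linarith
    have h1 := hp y hyD
    have h2 : inner ℝ p (y - x) = ‖p‖ * t := by
      rw [hy, add_sub_cancel_left, inner_smul_right, real_inner_self_eq_norm_sq]
      field_simp
    rw [hn, h2] at h1
    linarith [(abs_le.1 (hu y hyD)).2, (abs_le.1 (hu x hx)).1]

section Rank

/-- The rank one operator `h ↦ ⟪s, h⟫ s`. -/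
noncomputable def rankOneSelf {n : ℕ} (s : EuclideanSpace ℝ (Fin n)) :
    EuclideanSpace ℝ (Fin n) →L[ℝ] EuclideanSpace ℝ (Fin n) :=
  (innerSL ℝ s).smulRight s

theorem inner_rankOneSelf {n : ℕ} (s h k : EuclideanSpace ℝ (Fin n)) :
    inner ℝ (rankOneSelf s h) k = inner ℝ s h * inner ℝ s k := by
  simp [rankOneSelf, inner_smul_left]

theorem formTrace_rankOneSelf {n : ℕ} (s : EuclideanSpace ℝ (Fin n)) :
    formTrace (rankOneSelf s) = ‖s‖ ^ 2 := by
  rw [formTrace, EuclideanSpace.norm_sq_eq]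
  refine Finset.sum_congr rfl fun i _ => ?_
  rw [inner_rankOneSelf, EuclideanSpace.inner_single_right]
  simp [sq]

end Rank

/-- The bound 1 + t/2 ≤ exp (t/2) is squared, which needs 1 + t/2 ≥ 0. The quadratic term gained
here is the radial convexity of the bump. -/
theorem sq_one_add_half_le_exp {t : ℝ} (ht : -2 ≤ t) : 1 + t + t ^ 2 / 4 ≤ Real.exp t := by
  have h1 := Real.add_one_le_exp (t / 2)
  have h2 : Real.exp t = Real.exp (t / 2) ^ 2 := by
    rw [sq, ← Real.exp_add]; congr 1; ring
  rw [h2]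
  nlinarith

section Gaussian

variable {n : ℕ}

theorem gaussian_add (κ : ℝ) (s h : EuclideanSpace ℝ (Fin n)) :
    Real.exp (-κ * ‖s + h‖ ^ 2)
      = Real.exp (-κ * ‖s‖ ^ 2) * Real.exp (-(2 * κ * inner ℝ s h + κ * ‖h‖ ^ 2)) := by
  rw [← Real.exp_add, @norm_add_sq ℝ]
  congr 1
  simp only [RCLike.re_to_real]
  ring

theorem gaussian_ge (κ : ℝ) (s h : EuclideanSpace ℝ (Fin n)) :
    Real.exp (-κ * ‖s‖ ^ 2) * (1 - 2 * κ * inner ℝ s h - κ * ‖h‖ ^ 2)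
      ≤ Real.exp (-κ * ‖s + h‖ ^ 2) := by
  rw [gaussian_add]
  gcongr
  linarith [Real.add_one_le_exp (-(2 * κ * inner ℝ s h + κ * ‖h‖ ^ 2))]

theorem gaussian_ge_local {κ : ℝ} (hκ : 0 < κ) (s : EuclideanSpace ℝ (Fin n)) :
    ∀ᶠ h in 𝓝 (0 : EuclideanSpace ℝ (Fin n)),
      Real.exp (-κ * ‖s‖ ^ 2) * (1 - 2 * κ * inner ℝ s h - 2 * κ * ‖h‖ ^ 2
        + κ ^ 2 * inner ℝ s h ^ 2 / 2) ≤ Real.exp (-κ * ‖s + h‖ ^ 2) := by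
  -- The first condition puts the exponent in the range of `sq_one_add_half_le_exp`. The second
  -- allows j²/4 to be absorbed by j, with j = κ|h|².
  have h1 : ∀ᶠ h in 𝓝 (0 : EuclideanSpace ℝ (Fin n)),
      2 * κ * inner ℝ s h + κ * ‖h‖ ^ 2 < 2 :=
    ContinuousAt.eventually_lt (by fun_prop) (by fun_prop) (by simp)
  have h2 : ∀ᶠ h in 𝓝 (0 : EuclideanSpace ℝ (Fin n)), κ * ‖h‖ ^ 2 < 4 :=
    ContinuousAt.eventually_lt (by fun_prop) (by fun_prop) (by simp)
  filter_upwards [h1, h2] with h h1 h2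
  rw [gaussian_add]
  gcongr
  refine le_trans ?_ (sq_one_add_half_le_exp (by linarith))
  have h3 : 0 ≤ κ * ‖h‖ ^ 2 := by positivity
  set i := κ * inner ℝ s h with hi
  set j := κ * ‖h‖ ^ 2 with hj
  have e1 : 2 * κ * inner ℝ s h = 2 * i := by rw [hi]; ring
  have e2 : κ ^ 2 * inner ℝ s h ^ 2 = i ^ 2 := by rw [hi]; ring
  have e3 : 2 * κ * ‖h‖ ^ 2 = 2 * j := by rw [hj]; ring
  rw [e1, e2, e3]
  nlinarith [sq_nonneg (i + j)]

/-- A concave paraboloid of opening `a` with a Gaussian bump of width `r` around `x₀` on it. -/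
noncomputable def barrier (a A b r c : ℝ) (x₀ x₁ p x : EuclideanSpace ℝ (Fin n)) : ℝ :=
  c + inner ℝ p (x - x₁) - a / 2 * ‖x - x₁‖ ^ 2
    + a * A * r ^ 2 * (Real.exp (-(b / r ^ 2) * ‖x - x₀‖ ^ 2) - Real.exp (-(9 / 4 * b)))

/-- The gradient of the barrier. -/
noncomputable def barrierGrad (a A b r : ℝ) (x₀ x₁ p x : EuclideanSpace ℝ (Fin n)) :
    EuclideanSpace ℝ (Fin n) :=
  p - a • (x - x₁) - (2 * a * A * b * Real.exp (-(b / r ^ 2) * ‖x - x₀‖ ^ 2)) • (x - x₀)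

variable {a A b r c : ℝ} {x₀ x₁ p : EuclideanSpace ℝ (Fin n)}

theorem barrier_continuous : Continuous (barrier a A b r c x₀ x₁ p) := by
  unfold barrier
  fun_prop

theorem barrier_add (z h : EuclideanSpace ℝ (Fin n)) :
    barrier a A b r c x₀ x₁ p (z + h) = barrier a A b r c x₀ x₁ p z
      + inner ℝ (p - a • (z - x₁)) h - a / 2 * ‖h‖ ^ 2
      + a * A * r ^ 2 * (Real.exp (-(b / r ^ 2) * ‖z - x₀ + h‖ ^ 2)
        - Real.exp (-(b / r ^ 2) * ‖z - x₀‖ ^ 2)) := by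
  have e1 : z + h - x₁ = (z - x₁) + h := by abel
  have e2 : z + h - x₀ = z - x₀ + h := by abel
  rw [barrier, barrier, e1, e2, @norm_add_sq ℝ, inner_add_right, inner_sub_left p, inner_smul_left]
  simp only [RCLike.re_to_real, RCLike.conj_to_real]
  ring

/-- The Gaussian factor is at most 1, so the bump adds at most 2aAb to the opening of the
paraboloid. The bound is global, as is needed for touching in the whole ball. -/
theorem barrier_ge (ha : 0 ≤ a) (hA : 0 ≤ A) (hb : 0 ≤ b) (hr : 0 < r)
    (z y : EuclideanSpace ℝ (Fin n)) :
    barrier a A b r c x₀ x₁ p z + inner ℝ (barrierGrad a A b r x₀ x₁ p z) (y - z)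
      - (a + 2 * a * A * b) / 2 * ‖y - z‖ ^ 2 ≤ barrier a A b r c x₀ x₁ p y := by
  obtain ⟨h, rfl⟩ : ∃ h, y = z + h := ⟨y - z, by abel⟩
  rw [add_sub_cancel_left, barrier_add, barrierGrad]
  have h1 := gaussian_ge (b / r ^ 2) (z - x₀) h
  set g := Real.exp (-(b / r ^ 2) * ‖z - x₀‖ ^ 2) with hg
  have hg1 : g ≤ 1 := Real.exp_le_one_iff.2 (by
    have : 0 ≤ b / r ^ 2 * ‖z - x₀‖ ^ 2 := by positivity
    linarith)
  have h2 := mul_le_mul_of_nonneg_left h1 (by positivity : 0 ≤ a * A * r ^ 2)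
  have h3 : a * A * r ^ 2 * (g * (1 - 2 * (b / r ^ 2) * inner ℝ (z - x₀) h - b / r ^ 2 * ‖h‖ ^ 2))
      = a * A * r ^ 2 * g - 2 * a * A * b * g * inner ℝ (z - x₀) h
        - g * (a * A * b * ‖h‖ ^ 2) := by
    field_simp
  have h4 : g * (a * A * b * ‖h‖ ^ 2) ≤ 1 * (a * A * b * ‖h‖ ^ 2) := by gcongr
  rw [inner_sub_left _ ((2 * a * A * b * g) • (z - x₀)), inner_smul_left (z - x₀),
    RCLike.conj_to_real]
  linarith

/-- The local bound retains convexity of size aAbg · b/r² in the radial direction. Relative to the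
concavity 4aAbg this grows with b once |z - x₀| is comparable to r. -/
theorem barrier_ge_local (ha : 0 ≤ a) (hA : 0 ≤ A) (hb : 0 < b) (hr : 0 < r)
    (z : EuclideanSpace ℝ (Fin n)) {g : ℝ}
    (hg : g = Real.exp (-(b / r ^ 2) * ‖z - x₀‖ ^ 2)) :
    ∀ᶠ y in 𝓝 z, barrier a A b r c x₀ x₁ p z + inner ℝ (barrierGrad a A b r x₀ x₁ p z) (y - z)
      - (a + 4 * a * A * b * g) / 2 * ‖y - z‖ ^ 2
      + a * A * b * g * (b / r ^ 2) / 2 * inner ℝ (z - x₀) (y - z) ^ 2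
        ≤ barrier a A b r c x₀ x₁ p y := by
  have ht : Filter.Tendsto (fun y => y - z) (𝓝 z) (𝓝 0) := by
    have : Continuous fun y => y - z := by fun_prop
    simpa using this.tendsto z
  filter_upwards [ht.eventually (gaussian_ge_local (div_pos hb (pow_pos hr 2)) (z - x₀))]
    with y h1
  obtain ⟨h, rfl⟩ : ∃ h, y = z + h := ⟨y - z, by abel⟩
  rw [add_sub_cancel_left] at h1
  rw [add_sub_cancel_left, barrier_add, barrierGrad, ← hg]
  rw [← hg] at h1
  have h2 := mul_le_mul_of_nonneg_left h1 (by positivity : 0 ≤ a * A * r ^ 2)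
  have h3 : a * A * r ^ 2 * (g * (1 - 2 * (b / r ^ 2) * inner ℝ (z - x₀) h
        - 2 * (b / r ^ 2) * ‖h‖ ^ 2 + (b / r ^ 2) ^ 2 * inner ℝ (z - x₀) h ^ 2 / 2))
      = a * A * r ^ 2 * g - 2 * a * A * b * g * inner ℝ (z - x₀) h
        - 2 * a * A * b * g * ‖h‖ ^ 2
        + a * A * b * g * (b / r ^ 2) / 2 * inner ℝ (z - x₀) h ^ 2 := by
    field_simp
  rw [inner_sub_left _ ((2 * a * A * b * g) • (z - x₀)), inner_smul_left (z - x₀),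
    RCLike.conj_to_real]
  linarith

end Gaussian

/-! ### Positive density of touching points. -/

theorem HasSubjet.add_of_ge {n : ℕ} {v Q : EuclideanSpace ℝ (Fin n) → ℝ}
    {z p p' : EuclideanSpace ℝ (Fin n)} {c : ℝ}
    {X : EuclideanSpace ℝ (Fin n) →L[ℝ] EuclideanSpace ℝ (Fin n)} (hv : HasSubjet v z p X)
    (hQ : ∀ᶠ y in 𝓝 z, Q z + inner ℝ p' (y - z) - c / 2 * ‖y - z‖ ^ 2 ≤ Q y) :
    HasSubjet (fun y => v y + Q y) z (p + p') (X - c • ContinuousLinearMap.id ℝ _) := by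
  filter_upwards [hv, hQ] with y h1 h2
  have e2 : inner ℝ ((X - c • ContinuousLinearMap.id ℝ (EuclideanSpace ℝ (Fin n))) (y - z))
      (y - z) = inner ℝ (X (y - z)) (y - z) - c * ‖y - z‖ ^ 2 := by
    rw [← real_inner_self_eq_norm_sq, sub_apply, inner_sub_left, smul_apply, inner_smul_left]
    simp
  rw [quadPoly] at h1 ⊢
  rw [e2, inner_add_left]
  linarith

section Density

variable {n : ℕ} {u : EuclideanSpace ℝ (Fin n) → ℝ} {a A b r S lam Lam : ℝ}
  {x₀ x₁ p : EuclideanSpace ℝ (Fin n)}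

/-- Since a = S² and S r ≤ 2, displacements of order r change slopes by a r ≤ 2S. All gradients are
thus O(S), hence small against a; 11 = 2 + 4 + 5 collects p, the sliding paraboloid and the fixed
one. -/
theorem barrierGrad_bound (haS : a = S ^ 2) (hS : 0 < S) (hA : 0 ≤ A) (hb : 0 ≤ b)
    (hrS : S * r ≤ 2) (hp : ‖p‖ ≤ 2 * S) (hx : ‖x₁ - x₀‖ = r)
    {z y : EuclideanSpace ℝ (Fin n)} (hz : ‖z - x₀‖ ≤ 3 / 2 * r) (hy : ‖y - x₀‖ ≤ r / 2) :
    ‖a • (y - z) + barrierGrad a A b r x₀ x₁ p z‖ ≤ (11 + 6 * A * b) * S := by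
  have ha : 0 ≤ a := by rw [haS]; positivity
  have hr : 0 ≤ r := by rw [← hx]; positivity
  have har : a * r ≤ 2 * S := by rw [haS]; nlinarith
  have h1 : ‖y - z‖ ≤ 2 * r := by
    have := norm_sub_le (y - x₀) (z - x₀)
    rw [sub_sub_sub_cancel_right] at this
    linarith
  have h2 : ‖z - x₁‖ ≤ 5 / 2 * r := by
    have := norm_sub_le (z - x₀) (x₁ - x₀)
    rw [sub_sub_sub_cancel_right] at this
    linarith
  set g := Real.exp (-(b / r ^ 2) * ‖z - x₀‖ ^ 2) with hg
  have hg0 : 0 ≤ g := (Real.exp_pos _).le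
  have hg1 : g ≤ 1 := Real.exp_le_one_iff.2 (by
    have : 0 ≤ b / r ^ 2 * ‖z - x₀‖ ^ 2 := by positivity
    linarith)
  rw [barrierGrad, ← hg]
  have h3 : ‖a • (y - z)‖ ≤ 4 * S := by
    rw [norm_smul, Real.norm_of_nonneg ha]; nlinarith
  have h4 : ‖a • (z - x₁)‖ ≤ 5 * S := by
    rw [norm_smul, Real.norm_of_nonneg ha]; nlinarith
  have h5 : ‖(2 * a * A * b * g) • (z - x₀)‖ ≤ 6 * A * b * S := by
    rw [norm_smul, Real.norm_of_nonneg (by positivity)]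
    calc 2 * a * A * b * g * ‖z - x₀‖ ≤ 2 * a * A * b * 1 * (3 / 2 * r) := by gcongr
      _ = 3 * A * b * (a * r) := by ring
      _ ≤ 3 * A * b * (2 * S) := by gcongr
      _ = _ := by ring
  have h6 := norm_add_le (a • (y - z)) (p - a • (z - x₁) - (2 * a * A * b * g) • (z - x₀))
  have h7 := norm_sub_le (p - a • (z - x₁)) ((2 * a * A * b * g) • (z - x₀))
  have h8 := norm_sub_le p (a • (z - x₁))
  linarith

/-- At x₁ the bump exceeds 9ar²/8, the largest value there of a sliding paraboloid with vertex in
the small ball. So u minus the barrier is negative at the contact point; as u lies above the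
paraboloid, the bump must be positive, and it vanishes at distance 3r/2 from x₀. -/
theorem contact_mem_large_ball (ha : 0 < a) (hA : 0 ≤ A) (hb : 0 < b) (hr : 0 < r)
    (hAb : 9 / 8 < A * (Real.exp (-b) - Real.exp (-(9 / 4 * b))))
    (hp : ∀ y ∈ closedBall (0 : EuclideanSpace ℝ (Fin n)) 1,
      u x₁ + inner ℝ p (y - x₁) - a / 2 * ‖y - x₁‖ ^ 2 ≤ u y)
    (hx₁ : x₁ ∈ closedBall (0 : EuclideanSpace ℝ (Fin n)) 1) (hx : ‖x₁ - x₀‖ = r)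
    {q : EuclideanSpace ℝ (Fin n) × EuclideanSpace ℝ (Fin n)}
    (hq : q ∈ contactPairs (fun y => u y - barrier a A b r (u x₁) x₀ x₁ p y) a
      (closedBall x₀ (r / 2))) : ‖q.1 - x₀‖ < 3 / 2 * r := by
  obtain ⟨z, y⟩ := q
  obtain ⟨hz, hy, hmin⟩ := hq
  simp only at hz hy hmin ⊢
  have h1 := hmin x₁ hx₁
  have hyx : ‖x₁ - y‖ ≤ 3 / 2 * r := by
    rw [mem_closedBall, dist_eq_norm] at hy
    have := norm_sub_le (x₁ - x₀) (y - x₀)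
    rw [sub_sub_sub_cancel_right] at this
    linarith
  have e1 : barrier a A b r (u x₁) x₀ x₁ p x₁
      = u x₁ + a * r ^ 2 * (A * (Real.exp (-b) - Real.exp (-(9 / 4 * b)))) := by
    rw [barrier, hx]
    have : -(b / r ^ 2) * r ^ 2 = -b := by field_simp
    rw [this]; simp; ring
  have h2 : a / 2 * ‖x₁ - y‖ ^ 2 ≤ a / 2 * (3 / 2 * r) ^ 2 := by gcongr
  have har : 0 < a * r ^ 2 := by positivity
  have h3 := mul_lt_mul_of_pos_left hAb har
  have h4 : u z - barrier a A b r (u x₁) x₀ x₁ p z < 0 := by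
    have : 0 ≤ a / 2 * ‖z - y‖ ^ 2 := by positivity
    linarith
  have h5 := hp z hz
  rw [barrier] at h4
  have h6 : 0 < a * A * r ^ 2 * (Real.exp (-(b / r ^ 2) * ‖z - x₀‖ ^ 2)
      - Real.exp (-(9 / 4 * b))) := by linarith
  have h7 := pos_of_mul_pos_right h6 (by positivity)
  have h8 : -(9 / 4 * b) < -(b / r ^ 2) * ‖z - x₀‖ ^ 2 := Real.exp_lt_exp.1 (by linarith)
  by_contra! h9
  have h10 : b / r ^ 2 * (3 / 2 * r) ^ 2 ≤ b / r ^ 2 * ‖z - x₀‖ ^ 2 := by gcongr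
  have h11 : b / r ^ 2 * (3 / 2 * r) ^ 2 = 9 / 4 * b := by field_simp; ring
  linarith

/-- The openings add up: a from the sliding paraboloid and a + 2aAb from the barrier. -/
theorem contact_lower (ha : 0 ≤ a) (hA : 0 ≤ A) (hb : 0 ≤ b) (hr : 0 < r) {c : ℝ}
    {V : Set (EuclideanSpace ℝ (Fin n))}
    {q : EuclideanSpace ℝ (Fin n) × EuclideanSpace ℝ (Fin n)}
    (hq : q ∈ contactPairs (fun y => u y - barrier a A b r c x₀ x₁ p y) a V) :
    q.1 ∈ touchSet u ((2 + 2 * A * b) * a) := by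
  obtain ⟨z, y⟩ := q
  obtain ⟨hz, -, hmin⟩ := hq
  simp only at hz hmin ⊢
  refine ⟨hz, a • (y - z) + barrierGrad a A b r x₀ x₁ p z, fun x hx => ?_⟩
  have h1 := hmin x hx
  have h2 := barrier_ge (c := c) (x₀ := x₀) (x₁ := x₁) (p := p) ha hA hb hr z x
  have e : x - y = (z - y) + (x - z) := by abel
  rw [e, @norm_add_sq ℝ, RCLike.re_to_real] at h1
  have e2 : inner ℝ (a • (y - z)) (x - z) = -(a * inner ℝ (z - y) (x - z)) := by
    rw [inner_smul_left, ← neg_sub z y, inner_neg_left]; simp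
  rw [inner_add_left, e2]
  linarith

/-- At a contact point outside the small ball the barrier would give u a subjet with a large
positive radial eigenvalue. By `hlb` this outweighs the tangential concavity of the bump, by `hAexp`
also that of the paraboloids, with 2a to spare; the lower order terms 1 and 2|p| are each less than
a, contradicting the equation. -/
theorem contact_mem_small_ball (haS : a = S ^ 2) (hlam : 0 < lam)
    (hu : SubjetBound lam Lam 1 u) (hS1 : 1 < S) (hS : 2 * (11 + 6 * A * b) < S)
    (hA : 0 < A) (hb : 0 < b) (hr : 0 < r) (hrS : S * r ≤ 2)
    (hlb : 4 * Lam * n + 1 ≤ lam * b / 4)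
    (hAexp : 2 * Lam * n + 2 ≤ A * b * Real.exp (-(9 / 4 * b)))
    (hAb : 9 / 8 < A * (Real.exp (-b) - Real.exp (-(9 / 4 * b))))
    (hp : ∀ y ∈ closedBall (0 : EuclideanSpace ℝ (Fin n)) 1,
      u x₁ + inner ℝ p (y - x₁) - a / 2 * ‖y - x₁‖ ^ 2 ≤ u y) (hpS : ‖p‖ ≤ 2 * S)
    (hx₁ : x₁ ∈ closedBall (0 : EuclideanSpace ℝ (Fin n)) 1) (hx : ‖x₁ - x₀‖ = r)
    (hball : closedBall x₀ (3 / 2 * r) ⊆ ball 0 1)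
    {q : EuclideanSpace ℝ (Fin n) × EuclideanSpace ℝ (Fin n)}
    (hq : q ∈ contactPairs (fun y => u y - barrier a A b r (u x₁) x₀ x₁ p y) a
      (closedBall x₀ (r / 2))) : q.1 ∈ closedBall x₀ (r / 2) := by
  have ha : 0 < a := by rw [haS]; positivity
  have hlarge := contact_mem_large_ball ha hA.le hb hr hAb hp hx₁ hx hq
  obtain ⟨z, y⟩ := q
  obtain ⟨hz, hy, hmin⟩ := hq
  simp only at hz hy hmin hlarge ⊢
  rw [mem_closedBall, dist_eq_norm] at hy ⊢
  by_contra! hfar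
  have hzb : z ∈ ball (0 : EuclideanSpace ℝ (Fin n)) 1 :=
    hball (by rw [mem_closedBall, dist_eq_norm]; exact hlarge.le)
  obtain ⟨g, hg⟩ : ∃ g, g = Real.exp (-(b / r ^ 2) * ‖z - x₀‖ ^ 2) := ⟨_, rfl⟩
  have hg0 : 0 < g := by rw [hg]; exact Real.exp_pos _
  have hgl : Real.exp (-(9 / 4 * b)) ≤ g := by
    rw [hg]
    gcongr
    have h10 : b / r ^ 2 * ‖z - x₀‖ ^ 2 ≤ b / r ^ 2 * (3 / 2 * r) ^ 2 := by gcongr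
    have h11 : b / r ^ 2 * (3 / 2 * r) ^ 2 = 9 / 4 * b := by field_simp; ring
    linarith
  set m := a * A * b * g * (b / r ^ 2) with hm
  have hm0 : 0 < m := by positivity
  set β := 2 * a + 4 * a * A * b * g with hβ
  have hβ0 : 0 ≤ β := by positivity
  set X := m • rankOneSelf (z - x₀)
    - β • ContinuousLinearMap.id ℝ (EuclideanSpace ℝ (Fin n)) with hX
  have hXapp : ∀ h k, inner ℝ (X h) k
      = m * (inner ℝ (z - x₀) h * inner ℝ (z - x₀) k) - β * inner ℝ h k := by
    intro h k
    rw [hX, sub_apply, inner_sub_left, smul_apply, inner_smul_left, inner_rankOneSelf]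
    simp [inner_smul_left]
  have hj : HasSubjet u z (a • (y - z) + barrierGrad a A b r x₀ x₁ p z) X := by
    filter_upwards [barrier_ge_local (c := u x₁) (x₁ := x₁) (p := p) ha.le hA.le hb hr z hg,
      isOpen_ball.eventually_mem hzb] with x h2 hxb
    have h1 := hmin x (ball_subset_closedBall hxb)
    have e : x - y = (z - y) + (x - z) := by abel
    rw [e, @norm_add_sq ℝ, RCLike.re_to_real] at h1
    have e2 : inner ℝ (a • (y - z)) (x - z) = -(a * inner ℝ (z - y) (x - z)) := by
      rw [inner_smul_left, ← neg_sub z y, inner_neg_left]; simp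
    rw [quadPoly, inner_add_left, e2, hXapp, real_inner_self_eq_norm_sq, hβ]
    linarith
  have hbound := hu z hzb _ X β hβ0
    (fun h k => by rw [← real_inner_comm h, hXapp, hXapp, real_inner_comm h k]; ring)
    (fun h => by
      rw [hXapp, real_inner_self_eq_norm_sq]
      have := mul_nonneg hm0.le (mul_self_nonneg (inner ℝ (z - x₀) h))
      linarith) hj
  have hgrad := barrierGrad_bound (z := z) (y := y) haS (by linarith) hA.le hb.le hrS hpS hx
    hlarge.le hy
  rw [hX, formTrace_sub_smul_id, formTrace_smul, formTrace_rankOneSelf, sub_add_cancel] at hbound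
  have h1 : a * A * b * g * (b / 4) ≤ m * ‖z - x₀‖ ^ 2 := by
    have h2 : b / 4 ≤ b / r ^ 2 * ‖z - x₀‖ ^ 2 := by
      have h3 : b / r ^ 2 * (r / 2) ^ 2 ≤ b / r ^ 2 * ‖z - x₀‖ ^ 2 := by gcongr
      have h4 : b / r ^ 2 * (r / 2) ^ 2 = b / 4 := by field_simp; norm_num
      linarith
    calc a * A * b * g * (b / 4) ≤ a * A * b * g * (b / r ^ 2 * ‖z - x₀‖ ^ 2) := by gcongr
      _ = _ := by rw [hm]; ring
  have h2 := mul_le_mul_of_nonneg_left h1 hlam.le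
  have h3 : a * A * b * g * (4 * Lam * n + 1) ≤ a * A * b * g * (lam * b / 4) := by gcongr
  have h4 : a * (2 * Lam * n + 2) ≤ a * (A * b * g) := by
    gcongr
    exact hAexp.trans (by gcongr)
  have h5 : 2 * (11 + 6 * A * b) * S < a := by
    rw [haS, sq]; gcongr
  have h6 : 1 < a := by rw [haS]; nlinarith
  rw [hβ] at hbound
  linarith

/-- Adding the barrier back turns a subjet X ≥ -3a of the difference into a subjet of u with lower
bound -(4 + 2Ab)a. In the equation 1 and 2|p| are each at most a, which gives the 2 in the constant.
-/
theorem contact_subjet_bound (haS : a = S ^ 2) (hlam : 0 < lam)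
    (hu : SubjetBound lam Lam 1 u) (hS1 : 1 < S) (hS : 2 * (11 + 6 * A * b) < S)
    (hA : 0 < A) (hb : 0 < b) (hr : 0 < r) (hrS : S * r ≤ 2) (hpS : ‖p‖ ≤ 2 * S)
    (hx : ‖x₁ - x₀‖ = r) {c : ℝ}
    {z y : EuclideanSpace ℝ (Fin n)} (hz : z ∈ ball (0 : EuclideanSpace ℝ (Fin n)) 1)
    (hzr : ‖z - x₀‖ ≤ 3 / 2 * r) (hy : ‖y - x₀‖ ≤ r / 2)
    {X : EuclideanSpace ℝ (Fin n) →L[ℝ] EuclideanSpace ℝ (Fin n)}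
    (hX : ∀ h k, inner ℝ (X h) k = inner ℝ h (X k))
    (hXa : ∀ h, -(3 * a) * ‖h‖ ^ 2 ≤ inner ℝ (X h) h)
    (hj : HasSubjet (fun y => u y - barrier a A b r c x₀ x₁ p y) z (a • (y - z)) X) :
    formTrace X + 3 * a * n ≤ (2 + Lam * n * (4 + 2 * A * b)) / lam * a := by
  have ha : 0 < a := by rw [haS]; positivity
  have hj' := hj.add_of_ge (Q := barrier a A b r c x₀ x₁ p)
    (Filter.Eventually.of_forall fun x => barrier_ge (c := c) (x₀ := x₀) (x₁ := x₁) (p := p)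
      ha.le hA.le hb.le hr z x)
  simp only [sub_add_cancel] at hj'
  have hbound := hu z hz _ _ ((4 + 2 * A * b) * a) (by positivity)
    (fun h k => by
      simp [inner_sub_left, inner_sub_right, inner_smul_left, inner_smul_right, hX h k])
    (fun h => by
      simp only [sub_apply, smul_apply, ContinuousLinearMap.id_apply, inner_sub_left,
        inner_smul_left, RCLike.conj_to_real, real_inner_self_eq_norm_sq]
      linarith [hXa h]) hj'
  have hgrad := barrierGrad_bound (z := z) (y := y) haS (by linarith) hA.le hb.le hrS hpS hx
    hzr hy
  rw [formTrace_sub_smul_id] at hbound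
  have h5 : 2 * (11 + 6 * A * b) * S < a := by
    rw [haS, sq]; gcongr
  have h6 : 1 < a := by rw [haS]; nlinarith
  rw [div_mul_eq_mul_div, le_div_iff₀ hlam]
  linarith

/-- Next to a point touched by a paraboloid of opening `a`, a paraboloid whose opening is larger
by a constant factor touches on a set of positive density. -/
theorem density_of_touch (haS : a = S ^ 2) (hlam : 0 < lam)
    (huc : Continuous u) (hu1 : ∀ y ∈ closedBall (0 : EuclideanSpace ℝ (Fin n)) 1, |u y| ≤ 1)
    (hu : SubjetBound lam Lam 1 u) (hS1 : 1 < S) (hS : 2 * (11 + 6 * A * b) < S)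
    (hA : 0 < A) (hb : 0 < b) (hr : 0 < r) (hrS : S * r ≤ 2)
    (hlb : 4 * Lam * n + 1 ≤ lam * b / 4)
    (hAexp : 2 * Lam * n + 2 ≤ A * b * Real.exp (-(9 / 4 * b)))
    (hAb : 9 / 8 < A * (Real.exp (-b) - Real.exp (-(9 / 4 * b))))
    (hx₁ : x₁ ∈ touchSet u a) (hx₁S : ‖x₁‖ + 2 / S ≤ 1) (hx : ‖x₁ - x₀‖ = r)
    (hball : closedBall x₀ (3 / 2 * r) ⊆ ball 0 1) :
    volume (closedBall x₀ (r / 2))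
      ≤ ENNReal.ofReal (((2 + Lam * n * (4 + 2 * A * b)) / lam) ^ n)
        * volume (touchSet u ((2 + 2 * A * b) * a) ∩ closedBall x₀ (r / 2)) := by
  obtain ⟨hx₁D, p, hp⟩ := hx₁
  have hS0 : 0 < S := by linarith
  have ha : 0 < a := by rw [haS]; positivity
  -- The distance 2/S balances the oscillation 2 of u against the quadratic term of opening S².
  have hpS : ‖p‖ ≤ 2 * S := by
    have h := norm_slope_le hu1 ha.le (by positivity) hx₁S hp
    have e : a / 2 * (2 / S) ^ 2 = 2 := by rw [haS]; field_simp
    rw [e, mul_div_assoc', div_le_iff₀ hS0] at h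
    linarith
  have hsmall := fun q hq => contact_mem_small_ball (q := q) haS hlam hu hS1 hS hA hb hr hrS
    hlb hAexp hAb hp hpS hx₁D hx hball hq
  have hint : ∀ q ∈ contactPairs (fun y => u y - barrier a A b r (u x₁) x₀ x₁ p y) a
      (closedBall x₀ (r / 2)), q.1 ∈ ball (0 : EuclideanSpace ℝ (Fin n)) 1 := fun q hq =>
    hball (closedBall_subset_closedBall (by linarith) (hsmall q hq))
  refine (volume_vertices_le (huc.sub barrier_continuous) (isCompact_closedBall _ _) ha hint
    fun q hq X hX hXa hj => contact_subjet_bound haS hlam hu hS1 hS hA hb hr hrS hpS hx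
      (hint q hq) ?_ ?_ hX hXa hj).trans ?_
  · have := hsmall q hq
    rw [mem_closedBall, dist_eq_norm] at this
    linarith
  · have := hq.2.1
    rwa [mem_closedBall, dist_eq_norm] at this
  · gcongr
    rintro _ ⟨q, hq, rfl⟩
    exact ⟨contact_lower ha.le hA.le hb.le hr hq, hsmall q hq⟩

end Density

/-- The constants of the density estimate. -/
theorem exists_density_constants (n : ℕ) {lam Lam : ℝ} (hlam : 0 < lam) (hLam : lam ≤ Lam) :
    ∃ κ S₀ C : ℝ, 4 ≤ κ ∧ 13 ≤ S₀ ∧ 0 ≤ C ∧ ∀ u : EuclideanSpace ℝ (Fin n) → ℝ, Continuous u →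
      (∀ y ∈ closedBall (0 : EuclideanSpace ℝ (Fin n)) 1, |u y| ≤ 1) → SubjetBound lam Lam 1 u →
      ∀ S, S₀ ≤ S → ∀ (r : ℝ) (x₀ x₁ : EuclideanSpace ℝ (Fin n)), 0 < r → S * r ≤ 2 →
        x₁ ∈ touchSet u (S ^ 2) → ‖x₁‖ + 2 / S ≤ 1 → ‖x₁ - x₀‖ = r →
        closedBall x₀ (3 / 2 * r) ⊆ ball 0 1 →
        volume (closedBall x₀ (r / 2)) ≤ ENNReal.ofReal C
          * volume (touchSet u (κ * S ^ 2) ∩ closedBall x₀ (r / 2)) := by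
  have hLam0 : 0 < Lam := hlam.trans_le hLam
  -- The order matters: b depends on the ellipticity and n only, A on b as well, and the threshold
  -- for S on A and b.
  obtain ⟨b, hb, hlb⟩ : ∃ b : ℝ, 0 < b ∧ 4 * Lam * n + 1 ≤ lam * b / 4 := by
    refine ⟨4 * (4 * Lam * n + 1) / lam, by positivity, le_of_eq ?_⟩
    field_simp
  have hd : 0 < Real.exp (-b) - Real.exp (-(9 / 4 * b)) :=
    sub_pos.2 (Real.exp_lt_exp.2 (by linarith))
  have he : 0 < Real.exp (-(9 / 4 * b)) := Real.exp_pos _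
  have he1 : Real.exp (-(9 / 4 * b)) ≤ 1 := Real.exp_le_one_iff.2 (by linarith)
  obtain ⟨A, hA, hA1, hA2⟩ : ∃ A : ℝ, 0 < A ∧
      2 * Lam * n + 2 ≤ A * b * Real.exp (-(9 / 4 * b)) ∧
      9 / 8 < A * (Real.exp (-b) - Real.exp (-(9 / 4 * b))) := by
    refine ⟨(2 * Lam * n + 2) / (b * Real.exp (-(9 / 4 * b)))
      + 2 / (Real.exp (-b) - Real.exp (-(9 / 4 * b))), by positivity, ?_, ?_⟩
    · have h1 : (2 * Lam * n + 2) / (b * Real.exp (-(9 / 4 * b))) * b * Real.exp (-(9 / 4 * b))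
          = 2 * Lam * n + 2 := by field_simp
      have h2 : 0 ≤ 2 / (Real.exp (-b) - Real.exp (-(9 / 4 * b))) * b
        * Real.exp (-(9 / 4 * b)) := by positivity
      linarith
    · have h1 : 2 / (Real.exp (-b) - Real.exp (-(9 / 4 * b)))
          * (Real.exp (-b) - Real.exp (-(9 / 4 * b))) = 2 := div_mul_cancel₀ _ hd.ne'
      have h2 : 0 ≤ (2 * Lam * n + 2) / (b * Real.exp (-(9 / 4 * b)))
          * (Real.exp (-b) - Real.exp (-(9 / 4 * b))) := by positivity
      linarith
  have hAb2 : 2 ≤ A * b := by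
    have h1 : A * b * Real.exp (-(9 / 4 * b)) ≤ A * b * 1 := by gcongr
    have h2 : 0 ≤ 2 * Lam * n := by positivity
    linarith
  refine ⟨2 + 2 * A * b, 2 * (11 + 6 * A * b) + 1, ((2 + Lam * n * (4 + 2 * A * b)) / lam) ^ n,
    by linarith, by linarith, by positivity, ?_⟩
  intro u huc hu1 hu S hS r x₀ x₁ hr hrS hx₁ hx₁S hx hball
  exact density_of_touch rfl hlam huc hu1 hu (by linarith) (by linarith) hA hb hr hrS
    hlb hA1 hA2 hx₁ hx₁S hx hball

/-! ### Covering argument and geometric decay. -/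

section Covering

variable {n : ℕ} {u : EuclideanSpace ℝ (Fin n) → ℝ}

/-- Away from the boundary the slopes are bounded, so the set is the projection of a compact set of
points and slopes. -/
theorem isCompact_touchSet_inter (huc : Continuous u)
    (hu1 : ∀ y ∈ closedBall (0 : EuclideanSpace ℝ (Fin n)) 1, |u y| ≤ 1) {a ρ : ℝ} (ha : 0 ≤ a)
    (hρ : ρ < 1) : IsCompact (touchSet u a ∩ closedBall 0 ρ) := by
  set R := (2 + a / 2 * (1 - ρ) ^ 2) / (1 - ρ) with hR
  have h1 : 0 < 1 - ρ := by linarith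
  have hcl : IsClosed {q : EuclideanSpace ℝ (Fin n) × EuclideanSpace ℝ (Fin n) |
      ∀ y ∈ closedBall (0 : EuclideanSpace ℝ (Fin n)) 1,
        u q.1 + inner ℝ q.2 (y - q.1) - a / 2 * ‖y - q.1‖ ^ 2 ≤ u y} := by
    simp only [Set.ofPred_forall]
    refine isClosed_iInter fun z => isClosed_iInter fun _ => ?_
    exact isClosed_le (by fun_prop) (by fun_prop)
  have hK := (((isCompact_closedBall (0 : EuclideanSpace ℝ (Fin n)) ρ).prod
    (isCompact_closedBall (0 : EuclideanSpace ℝ (Fin n)) R)).inter_right hcl).image continuous_fst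
  have heq : touchSet u a ∩ closedBall 0 ρ = Prod.fst '' ((closedBall 0 ρ ×ˢ closedBall 0 R) ∩
      {q : EuclideanSpace ℝ (Fin n) × EuclideanSpace ℝ (Fin n) |
      ∀ y ∈ closedBall (0 : EuclideanSpace ℝ (Fin n)) 1,
        u q.1 + inner ℝ q.2 (y - q.1) - a / 2 * ‖y - q.1‖ ^ 2 ≤ u y}) := by
    ext x
    constructor
    · rintro ⟨⟨hx, p, hp⟩, hxρ⟩
      refine ⟨(x, p), ⟨⟨hxρ, ?_⟩, hp⟩, rfl⟩
      rw [mem_closedBall, dist_zero_right] at hxρ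
      rw [mem_closedBall, dist_zero_right, hR, le_div_iff₀ h1]
      exact norm_slope_le hu1 ha h1.le (by linarith) hp
    · rintro ⟨⟨x, p⟩, ⟨⟨hx, -⟩, hp⟩, rfl⟩
      exact ⟨⟨closedBall_subset_closedBall hρ.le hx, p, hp⟩, hx⟩
  rw [heq]
  exact hK

/-- Slide the paraboloid with vertex x₀ itself: at the contact point its quadratic term is at most
the oscillation 2 of u. -/
theorem exists_touch_near (huc : Continuous u)
    (hu1 : ∀ y ∈ closedBall (0 : EuclideanSpace ℝ (Fin n)) 1, |u y| ≤ 1) {S : ℝ}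
    {x₀ : EuclideanSpace ℝ (Fin n)} (hx₀ : x₀ ∈ closedBall (0 : EuclideanSpace ℝ (Fin n)) 1) :
    ∃ x₁ ∈ touchSet u (S ^ 2), S * ‖x₁ - x₀‖ ≤ 2 := by
  obtain ⟨z, hz, -, hmin⟩ := exists_contactPair (a := S ^ 2) (V := {x₀}) huc rfl
  simp only at hz hmin
  refine ⟨z, ⟨hz, S ^ 2 • (x₀ - z), fun y hy => ?_⟩, ?_⟩
  · have h1 := hmin y hy
    have e : y - x₀ = (z - x₀) + (y - z) := by abel
    rw [e, @norm_add_sq ℝ, RCLike.re_to_real] at h1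
    rw [inner_smul_left, ← neg_sub z x₀, inner_neg_left, RCLike.conj_to_real]
    linarith
  · have h1 := hmin x₀ hx₀
    rw [sub_self, norm_zero] at h1
    have h2 := (abs_le.1 (hu1 x₀ hx₀)).2
    have h3 := (abs_le.1 (hu1 z hz)).1
    refine le_of_sq_le_sq ?_ (by norm_num)
    nlinarith

/-- For an untouched x let r be the distance to the nearest touching point. The ball of radius r/2
around x is untouched at opening S², but a fixed fraction of it is touched at κS². A Vitali
selection of these balls bounds the set still untouched by D times the newly touched one. -/
theorem volume_step (huc : Continuous u)
    (hu1 : ∀ y ∈ closedBall (0 : EuclideanSpace ℝ (Fin n)) 1, |u y| ≤ 1) {S κ C ρ ρ' : ℝ}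
    (hS : 0 < S) (hκ : 1 ≤ κ) (hC : 0 ≤ C) (hρ' : ρ' < 1) (hρρ' : ρ + 2 / S ≤ ρ')
    (hρS : ρ + 8 / S ≤ 1)
    (hdens : ∀ (r : ℝ) (x₀ x₁ : EuclideanSpace ℝ (Fin n)), 0 < r → S * r ≤ 2 →
        x₁ ∈ touchSet u (S ^ 2) → ‖x₁‖ + 2 / S ≤ 1 → ‖x₁ - x₀‖ = r →
        closedBall x₀ (3 / 2 * r) ⊆ ball 0 1 →
        volume (closedBall x₀ (r / 2)) ≤ ENNReal.ofReal C
          * volume (touchSet u (κ * S ^ 2) ∩ closedBall x₀ (r / 2))) :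
    volume (ball 0 ρ \ touchSet u (κ * S ^ 2)) ≤ ENNReal.ofReal (5 ^ n * C / (1 + 5 ^ n * C))
      * volume (ball 0 ρ' \ touchSet u (S ^ 2)) := by
  set T := touchSet u (κ * S ^ 2) ∩ closedBall 0 ρ' with hT
  have hTm : MeasurableSet T :=
    (isCompact_touchSet_inter huc hu1 (by positivity) hρ').measurableSet
  have hsub : touchSet u (S ^ 2) ⊆ touchSet u (κ * S ^ 2) := touchSet_mono u (by nlinarith)
  set F := ball 0 ρ \ touchSet u (κ * S ^ 2) with hF
  set F' := ball 0 ρ' \ touchSet u (S ^ 2) with hF'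
  set F₀ := ball 0 ρ \ touchSet u (S ^ 2) with hF₀
  have e2 : 2 / S = 2 * (1 / S) := by ring
  have e8 : 8 / S = 8 * (1 / S) := by ring
  have hSi : 0 < 1 / S := by positivity
  rw [e2] at hρρ'
  rw [e8] at hρS
  have hSr : ∀ r, S * r ≤ 2 → r ≤ 2 * (1 / S) := by
    intro r hr
    rw [← e2, le_div_iff₀ hS]; linarith
  have hr : ∀ x : EuclideanSpace ℝ (Fin n), ∃ r : ℝ, x ∈ F₀ → 0 < r ∧ S * r ≤ 2 ∧
      closedBall x (r / 2) ⊆ F' ∧ volume (closedBall x (r / 2)) ≤ ENNReal.ofReal C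
          * volume (touchSet u (κ * S ^ 2) ∩ closedBall x (r / 2)) := by
    intro x
    by_cases hx : x ∈ F₀
    swap
    · exact ⟨0, fun h => absurd h hx⟩
    have hxρ : ‖x‖ < ρ := by simpa using hx.1
    -- A nearest point is sought in a compact piece. Since ρ + 8/S ≤ 1, this piece contains every
    -- touching point within 2/S of x.
    have hK := isCompact_touchSet_inter huc hu1 (sq_nonneg S) (ρ := 1 - 4 * (1 / S))
      (by linarith)
    have hmemK : ∀ y ∈ touchSet u (S ^ 2), ‖y - x‖ ≤ 2 * (1 / S) →
        y ∈ touchSet u (S ^ 2) ∩ closedBall 0 (1 - 4 * (1 / S)) := by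
      intro y hy hyx
      refine ⟨hy, ?_⟩
      rw [mem_closedBall, dist_zero_right]
      have := norm_add_le x (y - x)
      rw [add_sub_cancel] at this
      linarith
    obtain ⟨y, hy, hyx⟩ := exists_touch_near huc hu1 (S := S) (x₀ := x) (by simp; linarith)
    have hyK := hmemK y hy (hSr _ hyx)
    obtain ⟨x₁, hx₁, hmin⟩ := hK.exists_isMinOn ⟨y, hyK⟩ (f := fun z => ‖z - x‖) (by fun_prop)
    have hmin' : ∀ z ∈ touchSet u (S ^ 2) ∩ closedBall 0 (1 - 4 * (1 / S)),
      ‖x₁ - x‖ ≤ ‖z - x‖ := fun z hz => hmin hz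
    have hr0 : 0 < ‖x₁ - x‖ := by
      rw [norm_pos_iff, sub_ne_zero]
      rintro rfl
      exact hx.2 hx₁.1
    have hSr1 : S * ‖x₁ - x‖ ≤ 2 :=
      (mul_le_mul_of_nonneg_left (hmin' y hyK) hS.le).trans hyx
    have hr2 := hSr _ hSr1
    have hx₁n : ‖x₁‖ ≤ 1 - 4 * (1 / S) := by simpa using hx₁.2
    refine ⟨‖x₁ - x‖, fun _ => ⟨hr0, hSr1, fun z hz => ⟨?_, fun hzt => ?_⟩, ?_⟩⟩
    · rw [mem_closedBall, dist_eq_norm] at hz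
      rw [mem_ball, dist_zero_right]
      have := norm_add_le x (z - x)
      rw [add_sub_cancel] at this
      linarith
    · rw [mem_closedBall, dist_eq_norm] at hz
      have := hmin' z (hmemK z hzt (by linarith))
      linarith
    · refine hdens _ x x₁ hr0 hSr1 hx₁.1 (by rw [e2]; linarith) rfl fun z hz => ?_
      rw [mem_closedBall, dist_eq_norm] at hz
      rw [mem_ball, dist_zero_right]
      have := norm_add_le x (z - x)
      rw [add_sub_cancel] at this
      linarith
  choose r hr using hr
  obtain ⟨I, hI, hdisj, hcov⟩ := Vitali.exists_disjoint_subfamily_covering_enlargement_closedBall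
    F₀ (fun x => x) (fun x => r x / 2) (1 / S)
    (fun x hx => by have := hSr _ (hr x hx).2.1; linarith) 5 (by norm_num)
  have hIc : I.Countable := hdisj.countable_of_nonempty_interior fun x hx =>
    ⟨x, ball_subset_interior_closedBall (mem_ball_self (by have := (hr x (hI hx)).1; linarith))⟩
  have h5 : ∀ x ∈ I, volume (closedBall x (5 * (r x / 2)))
      ≤ ENNReal.ofReal (5 ^ n * C) * volume (T ∩ closedBall x (r x / 2)) := by
    intro x hx
    obtain ⟨hr0, -, hrF, hrv⟩ := hr x (hI hx)
    have e1 : volume (closedBall x (5 * (r x / 2)))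
        = ENNReal.ofReal (5 ^ n) * volume (closedBall x (r x / 2)) := by
      rw [Measure.addHaar_closedBall_mul _ _ (by norm_num) (by positivity),
        finrank_euclideanSpace, Fintype.card_fin, Measure.addHaar_closedBall_center volume x]
    have e2 : volume (touchSet u (κ * S ^ 2) ∩ closedBall x (r x / 2))
        ≤ volume (T ∩ closedBall x (r x / 2)) := by
      refine measure_mono ?_
      rintro y ⟨hy1, hy2⟩
      exact ⟨⟨hy1, ball_subset_closedBall (hrF hy2).1⟩, hy2⟩
    rw [e1, ENNReal.ofReal_mul (by positivity), mul_assoc]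
    gcongr
    exact hrv.trans (by gcongr)
  have hFF₀ : F ⊆ F₀ := Set.sdiff_subset_sdiff_right hsub
  have h6 : volume F ≤ ENNReal.ofReal (5 ^ n * C) * volume (F' ∩ T) := by
    calc volume F ≤ volume (⋃ x ∈ I, closedBall x (5 * (r x / 2))) := by
          refine measure_mono fun x hx => ?_
          obtain ⟨y, hy, hxy⟩ := hcov x (hFF₀ hx)
          have := (hr x (hFF₀ hx)).1
          exact Set.mem_biUnion hy (hxy (mem_closedBall_self (by linarith)))
      _ ≤ ∑' x : I, volume (closedBall (x : EuclideanSpace ℝ (Fin n)) (5 * (r x / 2))) :=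
          measure_biUnion_le _ hIc _
      _ ≤ ∑' x : I, ENNReal.ofReal (5 ^ n * C) * volume (T ∩ closedBall x (r x / 2)) :=
          ENNReal.tsum_le_tsum fun x => h5 x x.2
      _ = ENNReal.ofReal (5 ^ n * C) * volume (⋃ x ∈ I, T ∩ closedBall x (r x / 2)) := by
          rw [ENNReal.tsum_mul_left, measure_biUnion hIc
            (hdisj.mono fun x => Set.inter_subset_right)
            fun x _ => hTm.inter measurableSet_closedBall]
      _ ≤ _ := by
          gcongr
          refine Set.iUnion₂_subset fun x hx y hy => ⟨(hr x (hI hx)).2.2.1 hy.2, hy.1⟩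
  have h7 : volume (F' ∩ T) + volume F ≤ volume F' := by
    rw [← measure_inter_add_sdiff F' hTm]
    gcongr
    rintro y ⟨hy1, hy2⟩
    refine ⟨⟨ball_subset_ball (by linarith) hy1, fun h => hy2 (hsub h)⟩, fun h => hy2 h.1⟩
  set D := 5 ^ n * C with hD
  have hD0 : 0 ≤ D := by positivity
  -- The newly touched part and F are disjoint subsets of F', so adding D |F| to both sides of `h6`
  -- leaves at most D |F'| on the right.
  have h8 : ENNReal.ofReal (1 + D) * volume F ≤ ENNReal.ofReal D * volume F' := by
    rw [ENNReal.ofReal_add zero_le_one hD0, ENNReal.ofReal_one, add_mul, one_mul]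
    calc volume F + ENNReal.ofReal D * volume F
        ≤ ENNReal.ofReal D * volume (F' ∩ T) + ENNReal.ofReal D * volume F := by gcongr
      _ ≤ _ := by rw [← mul_add]; gcongr
  rw [div_eq_inv_mul, ENNReal.ofReal_mul (by positivity), ENNReal.ofReal_inv_of_pos (by positivity),
    mul_assoc]
  rw [mul_comm, ← ENNReal.le_div_iff_mul_le (Or.inl (by simp; linarith)) (Or.inl (by simp)),
    ENNReal.div_eq_inv_mul] at h8
  exact h8

theorem volume_ball_sdiff_ball_le {ρ : ℝ} (h0 : 0 < ρ) (h1 : ρ ≤ 1) :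
    volume (ball (0 : EuclideanSpace ℝ (Fin n)) 1 \ ball 0 ρ)
      ≤ ENNReal.ofReal (n * (1 - ρ)) * volume (ball (0 : EuclideanSpace ℝ (Fin n)) 1) := by
  have h2 : 0 ≤ n * (1 - ρ) := mul_nonneg (Nat.cast_nonneg n) (by linarith)
  rw [measure_sdiff (ball_subset_ball h1) measurableSet_ball.nullMeasurableSet
    measure_ball_lt_top.ne, tsub_le_iff_right, Measure.addHaar_ball_of_pos _ _ h0,
    finrank_euclideanSpace, Fintype.card_fin, ← add_mul,
    ← ENNReal.ofReal_add h2 (by positivity)]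
  refine le_mul_of_one_le_left (zero_le) (ENNReal.one_le_ofReal.2 ?_)
  have := one_add_mul_le_pow (a := ρ - 1) (by linarith) n
  rw [add_sub_cancel] at this
  linarith

end Covering

/-- The measure of the set where no paraboloid of opening `T κ^k` touches decays geometrically. -/
theorem exists_volume_decay (n : ℕ) {lam Lam : ℝ} (hlam : 0 < lam) (hLam : lam ≤ Lam) :
    ∃ T κ C q : ℝ, 0 < T ∧ 1 < κ ∧ 0 ≤ C ∧ 0 < q ∧ q < 1 ∧
      ∀ u : EuclideanSpace ℝ (Fin n) → ℝ, Continuous u →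
      (∀ y ∈ closedBall (0 : EuclideanSpace ℝ (Fin n)) 1, |u y| ≤ 1) → SubjetBound lam Lam 1 u →
      ∀ k : ℕ, volume (ball 0 1 \ touchSet u (T * κ ^ k)) ≤ ENNReal.ofReal (C * q ^ k) := by
  obtain ⟨κ, S₀, C, hκ, hS₀, hC, H⟩ := exists_density_constants n hlam hLam
  set q₀ := 5 ^ n * C / (1 + 5 ^ n * C) with hq₀
  have hD : 0 ≤ 5 ^ n * C := by positivity
  have hq₀0 : 0 ≤ q₀ := by positivity
  have hq₀1 : q₀ < 1 := by rw [hq₀, div_lt_one (by positivity)]; linarith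
  set V := volume (ball (0 : EuclideanSpace ℝ (Fin n)) 1) with hV
  have hVt : V ≠ ⊤ := measure_ball_lt_top.ne
  obtain ⟨s, hs, hsκ⟩ : ∃ s : ℝ, 2 ≤ s ∧ κ = s ^ 2 := by
    refine ⟨√κ, ?_, (Real.sq_sqrt (by linarith)).symm⟩
    rw [Real.le_sqrt (by norm_num) (by linarith)]; linarith
  -- The 1/2 accounts for the boundary layer lost in shrinking the ball.
  set q := max q₀ (1 / 2) with hq
  have hq0 : 0 < q := lt_of_lt_of_le (by norm_num) (le_max_right _ _)
  refine ⟨S₀ ^ 2, κ ^ 2, (1 + n * 1) * V.toReal, q, by positivity, by nlinarith, by positivity,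
    hq0, max_lt hq₀1 (by norm_num), ?_⟩
  intro u huc hu1 hu k
  -- For given k the iteration starts at S₀ s^k and takes k steps, ending at the opening S₀² (κ²)^k.
  -- Starting this high makes the total loss of radius, at most 12 / S 0, itself geometrically small
  -- in k.
  set S := fun j : ℕ => S₀ * s ^ (k + j) with hS
  -- Step j loses 2 / (2^j S 0), at least the 2 / S j required, and every ball stays at distance at
  -- least 8 / S 0 from the boundary.
  set ρ := fun j : ℕ => 1 - (12 - 4 / 2 ^ j) / S 0 with hρ
  have hS0 : 0 < S 0 := by positivity
  have hSj : ∀ j, S 0 * 2 ^ j ≤ S j := by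
    intro j
    simp only [hS, add_zero]
    rw [pow_add, ← mul_assoc]
    gcongr
  have hSpos : ∀ j, 0 < S j := fun j => by positivity
  have hS₀S : ∀ j, S₀ ≤ S j := fun j =>
    le_mul_of_one_le_right (by linarith) (one_le_pow₀ (by linarith))
  have hdiv : ∀ j (c : ℝ), 0 ≤ c → c / S j ≤ c / 2 ^ j / S 0 := by
    intro j c hc
    rw [div_div]
    gcongr
    rw [mul_comm]; exact hSj j
  have h2j : ∀ j : ℕ, (0 : ℝ) < 1 / 2 ^ j ∧ 1 / (2 : ℝ) ^ j ≤ 1 := fun j =>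
    ⟨by positivity, by rw [div_le_one (by positivity)]; exact one_le_pow₀ (by norm_num)⟩
  have hρ1 : ∀ j, ρ j < 1 := by
    intro j
    have h := h2j j
    have : 0 < (12 - 4 / 2 ^ j) / S 0 := by
      refine div_pos ?_ hS0
      have : (4 : ℝ) / 2 ^ j = 4 * (1 / 2 ^ j) := by ring
      linarith
    simp only [hρ]; linarith
  have hiter : ∀ j, volume (ball 0 (ρ j) \ touchSet u (S j ^ 2)) ≤ ENNReal.ofReal (q₀ ^ j) * V := by
    intro j
    induction j with
    | zero =>
      simp only [pow_zero, ENNReal.ofReal_one, one_mul]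
      exact measure_mono (Set.sdiff_subset.trans (ball_subset_ball (hρ1 0).le))
    | succ j ih =>
      have e : S (j + 1) ^ 2 = κ * S j ^ 2 := by
        simp only [hS, hsκ]; ring
      have h := h2j j
      have e1 : (4 : ℝ) / 2 ^ (j + 1) = 2 * (1 / 2 ^ j) := by rw [pow_succ]; ring
      have e2 : (4 : ℝ) / 2 ^ j = 4 * (1 / 2 ^ j) := by ring
      have hstep := volume_step huc hu1 (κ := κ) (hSpos j) (by linarith) hC (hρ1 j)
        (ρ := ρ (j + 1)) ?_ ?_ (H u huc hu1 hu (S j) (hS₀S j))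
      · rw [e]
        refine hstep.trans ?_
        rw [pow_succ' q₀, ENNReal.ofReal_mul hq₀0, mul_assoc]
        gcongr
      · have h1 := hdiv j 2 (by norm_num)
        have e3 : 2 / 2 ^ j / S 0 = (12 - 4 / 2 ^ j) / S 0 * (-1) + (12 - 4 / 2 ^ (j + 1)) / S 0 := by
          rw [e1, e2]; ring
        simp only [hρ]
        linarith
      · have h1 := hdiv j 8 (by norm_num)
        have h3 : 8 / 2 ^ j / S 0 ≤ (12 - 4 / 2 ^ (j + 1)) / S 0 := by
          gcongr
          rw [e1]
          have : (8 : ℝ) / 2 ^ j = 8 * (1 / 2 ^ j) := by ring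
          linarith
        simp only [hρ]
        linarith
  have hρk : 1 - ρ k ≤ (1 / 2) ^ k ∧ 0 < ρ k := by
    have h := h2j k
    have h1 : 1 - ρ k ≤ 12 / S 0 := by
      simp only [hρ, sub_sub_cancel]
      gcongr
      have : (4 : ℝ) / 2 ^ k = 4 * (1 / 2 ^ k) := by ring
      linarith
    have h2 : 12 / S 0 ≤ 12 / 13 * (1 / 2) ^ k := by
      rw [div_le_iff₀ hS0]
      have h3 : 13 * 2 ^ k ≤ S 0 := by
        simp only [hS, add_zero]
        gcongr
      have h4 : (1 / 2 : ℝ) ^ k * 2 ^ k = 1 := by rw [← mul_pow]; norm_num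
      have h5 : (0 : ℝ) < (1 / 2) ^ k := by positivity
      nlinarith
    have h3 : (1 / 2 : ℝ) ^ k ≤ 1 := pow_le_one₀ (by norm_num) (by norm_num)
    have h5 : (0 : ℝ) < (1 / 2) ^ k := by positivity
    constructor <;> linarith
  have e : S₀ ^ 2 * (κ ^ 2) ^ k = S k ^ 2 := by
    simp only [hS, hsκ]; ring
  rw [e]
  have hfin : (n : ℝ) * (1 - ρ k) ≤ n * 1 * (1 / 2) ^ k := by
    rw [mul_one]; gcongr; exact hρk.1
  calc volume (ball 0 1 \ touchSet u (S k ^ 2))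
      ≤ volume ((ball 0 (ρ k) \ touchSet u (S k ^ 2))
        ∪ (ball (0 : EuclideanSpace ℝ (Fin n)) 1 \ ball 0 (ρ k))) := by
        refine measure_mono fun x hx => ?_
        by_cases h : x ∈ ball (0 : EuclideanSpace ℝ (Fin n)) (ρ k)
        · exact Or.inl ⟨h, hx.2⟩
        · exact Or.inr ⟨hx.1, h⟩
    _ ≤ ENNReal.ofReal (q₀ ^ k) * V + ENNReal.ofReal (n * 1 * (1 / 2) ^ k) * V := by
        refine (measure_union_le _ _).trans (add_le_add (hiter k) ?_)
        exact (volume_ball_sdiff_ball_le hρk.2 (hρ1 k).le).trans (by gcongr)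
    _ ≤ ENNReal.ofReal (q ^ k) * V + ENNReal.ofReal (n * 1 * q ^ k) * V := by
        gcongr
        · exact le_max_left _ _
        · exact le_max_right _ _
    _ = _ := by
        rw [← add_mul, ← ENNReal.ofReal_add (by positivity) (by positivity),
          ← ENNReal.ofReal_toReal hVt, ← ENNReal.ofReal_mul (by positivity),
          ENNReal.toReal_ofReal ENNReal.toReal_nonneg]
        congr 1
        ring

/-! ### Two-sided touching and its consequences for slopes. -/

/-- At `x` the function `u` is touched from below and from above in the unit ball by paraboloids
of opening `M`. -/
def TwoSidedTouch {n : ℕ} (u : EuclideanSpace ℝ (Fin n) → ℝ) (M : ℝ)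
    (x : EuclideanSpace ℝ (Fin n)) : Prop :=
  (∃ p : EuclideanSpace ℝ (Fin n), ∀ y ∈ ball (0 : EuclideanSpace ℝ (Fin n)) 1,
    u x + inner ℝ p (y - x) - M / 2 * ‖y - x‖ ^ 2 ≤ u y) ∧
  ∃ q : EuclideanSpace ℝ (Fin n), ∀ y ∈ ball (0 : EuclideanSpace ℝ (Fin n)) 1,
    u y ≤ u x + inner ℝ q (y - x) + M / 2 * ‖y - x‖ ^ 2

theorem SubjetBound.congr {n : ℕ} {lam Lam K : ℝ} {u v : EuclideanSpace ℝ (Fin n) → ℝ}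
    (hu : SubjetBound lam Lam K u) (h : ∀ x ∈ ball (0 : EuclideanSpace ℝ (Fin n)) 1, v x = u x) :
    SubjetBound lam Lam K v := by
  intro x hx p X β hβ hX hXβ hj
  refine hu x hx p X β hβ hX hXβ ?_
  filter_upwards [hj, isOpen_ball.eventually_mem hx] with y hy hyb
  rw [← h x hx, ← h y hyb]
  exact hy

/-- A continuous function on the closed unit ball extends to the whole space. -/
theorem exists_continuous_extension {n : ℕ} {u : EuclideanSpace ℝ (Fin n) → ℝ}
    (hu : ContinuousOn u (closedBall 0 1)) :
    ∃ v : EuclideanSpace ℝ (Fin n) → ℝ, Continuous v ∧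
      ∀ x ∈ closedBall (0 : EuclideanSpace ℝ (Fin n)) 1, v x = u x := by
  refine ⟨fun x => u ((max 1 ‖x‖)⁻¹ • x), ?_, fun x hx => ?_⟩
  · refine hu.comp_continuous ?_ fun x => ?_
    · refine Continuous.smul (Continuous.inv₀ (continuous_const.max continuous_norm) fun x => ?_)
        continuous_id
      positivity
    · rw [mem_closedBall, dist_zero_right, norm_smul, norm_inv, Real.norm_of_nonneg (by positivity),
        inv_mul_le_iff₀ (by positivity), mul_one]
      exact le_max_right _ _
  · rw [mem_closedBall, dist_zero_right] at hx
    simp [max_eq_left hx]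

/-- The decay is applied to u/K and -u/K, extended continuously to the whole space. The exceptional
sets are replaced by measurable hulls, to be summed later. -/
theorem exists_twoSidedTouch_decay (n : ℕ) {lam Lam : ℝ} (hlam : 0 < lam) (hLam : lam ≤ Lam) :
    ∃ T κ C q : ℝ, 0 < T ∧ 1 < κ ∧ 0 ≤ C ∧ 0 < q ∧ q < 1 ∧
      ∀ u : EuclideanSpace ℝ (Fin n) → ℝ, ∀ K : ℝ, 0 < K → ContinuousOn u (closedBall 0 1) →
      (∀ y ∈ closedBall (0 : EuclideanSpace ℝ (Fin n)) 1, |u y| ≤ K) →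
      SubjetBound lam Lam K u → (SubjetBound lam Lam K fun y => -u y) →
      ∀ k : ℕ, ∃ E, MeasurableSet E ∧ volume E ≤ ENNReal.ofReal (C * q ^ k) ∧
        ∀ x ∈ ball 0 1, x ∉ E → TwoSidedTouch u (K * (T * κ ^ k)) x := by
  obtain ⟨T, κ, C, q, hT, hκ, hC, hq0, hq1, H⟩ := exists_volume_decay n hlam hLam
  have key : ∀ u : EuclideanSpace ℝ (Fin n) → ℝ, ∀ K : ℝ, 0 < K →
      ContinuousOn u (closedBall 0 1) →
      (∀ y ∈ closedBall (0 : EuclideanSpace ℝ (Fin n)) 1, |u y| ≤ K) →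
      SubjetBound lam Lam K u → ∀ k : ℕ, ∃ E, MeasurableSet E ∧
        volume E ≤ ENNReal.ofReal (C * q ^ k) ∧ ∀ x ∈ ball 0 1, x ∉ E →
        ∃ p : EuclideanSpace ℝ (Fin n), ∀ y ∈ ball (0 : EuclideanSpace ℝ (Fin n)) 1,
          u x + inner ℝ p (y - x) - K * (T * κ ^ k) / 2 * ‖y - x‖ ^ 2 ≤ u y := by
    intro u K hK huc huK hu k
    obtain ⟨v, hvc, hvu⟩ := exists_continuous_extension huc
    have h1 : SubjetBound lam Lam 1 fun y => K⁻¹ * v y := by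
      have := (hu.congr fun x hx => hvu x (ball_subset_closedBall hx)).const_mul (inv_pos.2 hK)
      rwa [inv_mul_cancel₀ hK.ne'] at this
    have h2 := H (fun y => K⁻¹ * v y) (by fun_prop) (fun y hy => by
      rw [hvu y hy, abs_mul, abs_of_pos (inv_pos.2 hK), inv_mul_le_iff₀ hK, mul_one]
      exact huK y hy) h1 k
    refine ⟨toMeasurable volume (ball 0 1 \ touchSet (fun y => K⁻¹ * v y) (T * κ ^ k)),
      measurableSet_toMeasurable _ _, by rwa [measure_toMeasurable], fun x hx hxE => ?_⟩
    have hxt : x ∈ touchSet (fun y => K⁻¹ * v y) (T * κ ^ k) := by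
      by_contra hcon
      exact hxE (subset_toMeasurable _ _ ⟨hx, hcon⟩)
    obtain ⟨-, p, hp⟩ := hxt
    refine ⟨K • p, fun y hy => ?_⟩
    have h3 := mul_le_mul_of_nonneg_left (hp y (ball_subset_closedBall hy)) hK.le
    simp only [hvu x (ball_subset_closedBall hx), hvu y (ball_subset_closedBall hy)] at h3
    rw [mul_inv_cancel_left₀ hK.ne'] at h3
    rw [inner_smul_left, RCLike.conj_to_real]
    refine le_trans (le_of_eq ?_) h3
    field_simp
  refine ⟨T, κ, 2 * C, q, hT, hκ, by positivity, hq0, hq1, ?_⟩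
  intro u K hK huc huK hu hu' k
  obtain ⟨E, hE, hEv, hEt⟩ := key u K hK huc huK hu k
  obtain ⟨E', hE', hEv', hEt'⟩ := key (fun y => -u y) K hK huc.neg
    (fun y hy => by rw [abs_neg]; exact huK y hy) hu' k
  refine ⟨E ∪ E', hE.union hE', ?_, fun x hx hxE => ⟨?_, ?_⟩⟩
  · refine (measure_union_le _ _).trans ((add_le_add hEv hEv').trans (le_of_eq ?_))
    rw [← ENNReal.ofReal_add (by positivity) (by positivity)]
    congr 1
    ring
  · exact hEt x hx fun h => hxE (Or.inl h)
  · obtain ⟨p, hp⟩ := hEt' x hx fun h => hxE (Or.inr h)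
    refine ⟨-p, fun y hy => ?_⟩
    have := hp y hy
    rw [inner_neg_left]
    linarith

section Slope

variable {n : ℕ} {u : EuclideanSpace ℝ (Fin n) → ℝ} {M K : ℝ} {x p q : EuclideanSpace ℝ (Fin n)}

theorem eq_zero_of_inner_le_sq {C : ℝ}
    (h : ∀ᶠ y in 𝓝 x, inner ℝ p (y - x) ≤ C * ‖y - x‖ ^ 2) : p = 0 := by
  by_contra hp
  have hp0 : 0 < ‖p‖ := norm_pos_iff.2 hp
  have h1 : Filter.Tendsto (fun t : ℝ => x + t • p) (𝓝[>] 0) (𝓝 x) := by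
    have : Continuous fun t : ℝ => x + t • p := by fun_prop
    simpa using (this.tendsto 0).mono_left nhdsWithin_le_nhds
  have h2 : ∀ᶠ t : ℝ in 𝓝[>] 0, C * t < 1 :=
    nhdsWithin_le_nhds (ContinuousAt.eventually_lt (by fun_prop) (by fun_prop) (by simp))
  obtain ⟨t, ⟨ht1, ht2⟩, ht0⟩ := (((h1.eventually h).and h2).and self_mem_nhdsWithin).exists
  have ht0 : 0 < t := ht0
  rw [add_sub_cancel_left, inner_smul_right, real_inner_self_eq_norm_sq, norm_smul,
    Real.norm_of_nonneg ht0.le] at ht1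
  have h3 : 0 < t * ‖p‖ ^ 2 := by positivity
  nlinarith

theorem TwoSidedTouch.exists_slope (h : TwoSidedTouch u M x)
    (hx : x ∈ ball (0 : EuclideanSpace ℝ (Fin n)) 1) :
    ∃ p : EuclideanSpace ℝ (Fin n), ∀ y ∈ ball (0 : EuclideanSpace ℝ (Fin n)) 1,
      |u y - u x - inner ℝ p (y - x)| ≤ M / 2 * ‖y - x‖ ^ 2 := by
  obtain ⟨⟨p, hp⟩, q, hq⟩ := h
  have hpq : p - q = 0 := by
    refine eq_zero_of_inner_le_sq (x := x) (C := M) ?_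
    filter_upwards [isOpen_ball.eventually_mem hx] with y hy
    rw [inner_sub_left]
    linarith [hp y hy, hq y hy]
  rw [sub_eq_zero] at hpq
  subst hpq
  refine ⟨p, fun y hy => abs_le.2 ⟨?_, ?_⟩⟩
  · linarith [hp y hy]
  · linarith [hq y hy]

/-- The bound is uniform up to the boundary: the two test points are the ends of a segment of length
one, parallel to p and centred at x/2, which stays in the ball. -/
theorem norm_slope_le_of_twoSided (hM : 0 ≤ M)
    (hu : ∀ y ∈ ball (0 : EuclideanSpace ℝ (Fin n)) 1, |u y| ≤ K)
    (hx : x ∈ ball (0 : EuclideanSpace ℝ (Fin n)) 1)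
    (hp : ∀ y ∈ ball (0 : EuclideanSpace ℝ (Fin n)) 1,
      |u y - u x - inner ℝ p (y - x)| ≤ M / 2 * ‖y - x‖ ^ 2) : ‖p‖ ≤ 4 * (K + M) := by
  have hK : 0 ≤ K := (abs_nonneg _).trans (hu x hx)
  rcases eq_or_ne p 0 with rfl | hp0
  · simp; positivity
  have hpn : 0 < ‖p‖ := norm_pos_iff.2 hp0
  have hx' : ‖x‖ < 1 := by simpa using hx
  have hmain : ∀ s : ℝ, |s| ≤ 1 / 2 →
      |inner ℝ p ((1 / 2 : ℝ) • x + (s / ‖p‖) • p - x)| ≤ 2 * K + 2 * M := by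
    intro s hs
    set y := (1 / 2 : ℝ) • x + (s / ‖p‖) • p with hy
    have hyn : ‖y‖ < 1 := by
      refine (norm_add_le _ _).trans_lt ?_
      rw [norm_smul, norm_smul, norm_div s, norm_norm, div_mul_cancel₀ _ hpn.ne', Real.norm_eq_abs,
        Real.norm_eq_abs, abs_of_pos (by norm_num : (0 : ℝ) < 1 / 2)]
      linarith
    have hyb : y ∈ ball (0 : EuclideanSpace ℝ (Fin n)) 1 := by simpa using hyn
    have h1 := hp y hyb
    have h2 : ‖y - x‖ ≤ 2 := (norm_sub_le _ _).trans (by linarith)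
    have h3 : M / 2 * ‖y - x‖ ^ 2 ≤ M / 2 * 2 ^ 2 := by gcongr
    have h4 := abs_le.1 (hu x hx)
    have h5 := abs_le.1 (hu y hyb)
    have h6 := abs_le.1 (h1.trans h3)
    rw [abs_le]
    constructor <;> linarith
  have h1 := (abs_le.1 (hmain (1 / 2) (by rw [abs_of_pos] <;> norm_num))).2
  have h2 := (abs_le.1 (hmain (-(1 / 2)) (by rw [abs_neg, abs_of_pos] <;> norm_num))).1
  have h3 : inner ℝ p ((1 / 2 : ℝ) • x + (1 / 2 / ‖p‖) • p - x)
      - inner ℝ p ((1 / 2 : ℝ) • x + (-(1 / 2) / ‖p‖) • p - x) = ‖p‖ := by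
    rw [← inner_sub_right, sub_sub_sub_cancel_right, add_sub_add_left_eq_sub, ← sub_smul,
      inner_smul_right, real_inner_self_eq_norm_sq]
    field_simp
    norm_num
  linarith

/-- The slopes at the points of two-sided touching depend in a Lipschitz way on the point. -/
theorem norm_slope_sub_le {z y : EuclideanSpace ℝ (Fin n)} (hM : 0 ≤ M)
    (hyb : ‖y‖ + ‖z - y‖ < 1)
    (hp : ∀ w ∈ ball (0 : EuclideanSpace ℝ (Fin n)) 1,
      |u w - u z - inner ℝ p (w - z)| ≤ M / 2 * ‖w - z‖ ^ 2)
    (hq : ∀ w ∈ ball (0 : EuclideanSpace ℝ (Fin n)) 1,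
      |u w - u y - inner ℝ q (w - y)| ≤ M / 2 * ‖w - y‖ ^ 2) :
    ‖p - q‖ ≤ 3 * M * ‖z - y‖ := by
  rcases eq_or_ne p q with rfl | hpq
  · simp; positivity
  have hn : 0 < ‖p - q‖ := norm_pos_iff.2 (sub_ne_zero.2 hpq)
  set s := ‖z - y‖ with hs
  have hs0 : 0 ≤ s := norm_nonneg _
  -- Both expansions are compared at y + h, with h along p - q and of length |z - y|; the errors sum
  -- to (M/2)(4 + 1 + 1)s².
  set h := (s / ‖p - q‖) • (p - q) with hh
  have hhn : ‖h‖ = s := by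
    rw [hh, norm_smul, Real.norm_of_nonneg (by positivity), div_mul_cancel₀ _ hn.ne']
  have hwb : y + h ∈ ball (0 : EuclideanSpace ℝ (Fin n)) 1 := by
    rw [mem_ball, dist_zero_right]
    exact (norm_add_le _ _).trans_lt (by rw [hhn]; exact hyb)
  have hyb' : y ∈ ball (0 : EuclideanSpace ℝ (Fin n)) 1 := by
    rw [mem_ball, dist_zero_right]; linarith
  have h1 := abs_le.1 (hp _ hwb)
  have h2 := abs_le.1 (hp _ hyb')
  have h3 := abs_le.1 (hq _ hwb)
  have e1 : y + h - y = h := by abel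
  have e2 : y + h - z = (y - z) + h := by abel
  have e3 : ‖y - z‖ = s := by rw [hs, norm_sub_rev]
  have h4 : ‖y - z + h‖ ≤ 2 * s := (norm_add_le _ _).trans (by rw [e3, hhn]; linarith)
  have h5 : M / 2 * ‖y - z + h‖ ^ 2 ≤ M / 2 * (2 * s) ^ 2 := by gcongr
  rw [e1, hhn] at h3
  rw [e2, inner_add_right] at h1
  rw [e3] at h2
  have h6 : inner ℝ p h - inner ℝ q h = ‖p - q‖ * s := by
    rw [← inner_sub_left, hh, inner_smul_right, real_inner_self_eq_norm_sq]
    field_simp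
  have h7 : ‖p - q‖ * s ≤ 3 * M * s * s := by nlinarith [h1.1, h1.2, h2.1, h2.2, h3.1, h3.2]
  rcases hs0.eq_or_lt with h0 | h0
  · have hzy : z = y := by rw [← sub_eq_zero, ← norm_eq_zero, ← hs, ← h0]
    exfalso
    subst hzy
    apply hpq
    rw [← sub_eq_zero]
    refine eq_zero_of_inner_le_sq (x := z) (C := M) ?_
    filter_upwards [isOpen_ball.eventually_mem hyb'] with w hw
    rw [inner_sub_left]
    linarith [(abs_le.1 (hp w hw)).1, (abs_le.1 (hq w hw)).2]
  · exact le_of_mul_le_mul_right h7 h0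

theorem sum_mul_eq_inner (p h : EuclideanSpace ℝ (Fin n)) : ∑ i, p i * h i = inner ℝ p h := by
  rw [EuclideanSpace.inner_eq_star_dotProduct, dotProduct]
  exact Finset.sum_congr rfl fun i _ => by simp [mul_comm]

theorem sum_formMatrix_eq_inner
    (L : EuclideanSpace ℝ (Fin n) →L[ℝ] EuclideanSpace ℝ (Fin n))
    (h : EuclideanSpace ℝ (Fin n)) :
    ∑ i, ∑ j, formMatrix L i j * h i * h j = inner ℝ (L h) h := by
  rw [formMatrix_quadratic, dotProduct]
  refine Finset.sum_congr rfl fun i _ => ?_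
  rw [Matrix.mulVec, dotProduct, Finset.mul_sum]
  exact Finset.sum_congr rfl fun j _ => by ring

/-- The linear map with a given matrix. -/
noncomputable def formMap (A : Matrix (Fin n) (Fin n) ℝ) :
    EuclideanSpace ℝ (Fin n) →L[ℝ] EuclideanSpace ℝ (Fin n) :=
  Matrix.toEuclideanCLM (𝕜 := ℝ) A.transpose

theorem formMatrix_formMap (A : Matrix (Fin n) (Fin n) ℝ) : formMatrix (formMap A) = A := by
  ext i j
  simp [formMatrix, formMap, EuclideanSpace.inner_single_right, Matrix.ofLp_toEuclideanCLM]

theorem hasSecondOrderExpansionAt_iff {A : Matrix (Fin n) (Fin n) ℝ} :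
    HasSecondOrderExpansionAt u x p A ↔ A.IsSymm ∧ ∀ ε > 0, ∀ᶠ y in 𝓝 x,
      |u y - u x - inner ℝ p (y - x) - 1 / 2 * inner ℝ (formMap A (y - x)) (y - x)|
        ≤ ε * ‖y - x‖ ^ 2 := by
  rw [HasSecondOrderExpansionAt, isLittleO_iff]
  refine and_congr_right fun _ => forall₂_congr fun ε hε => ?_
  refine Filter.eventually_congr (Filter.Eventually.of_forall fun y => ?_)
  have h1 : ∑ i, p i * (y i - x i) = inner ℝ p (y - x) := by
    rw [← sum_mul_eq_inner]; rfl
  have h2 : ∑ i, ∑ j, A i j * (y i - x i) * (y j - x j)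
      = inner ℝ (formMap A (y - x)) (y - x) := by
    rw [← sum_formMatrix_eq_inner, formMatrix_formMap]; rfl
  rw [h1, h2, Real.norm_eq_abs, Real.norm_of_nonneg (sq_nonneg _)]

/-- A two-sided touching paraboloid bounds the gradient and the Hessian. -/
theorem expansion_bounds {A : Matrix (Fin n) (Fin n) ℝ}
    (hA : HasSecondOrderExpansionAt u x p A) (hM : 0 ≤ M)
    (hu : ∀ y ∈ ball (0 : EuclideanSpace ℝ (Fin n)) 1, |u y| ≤ K)
    (hx : x ∈ ball (0 : EuclideanSpace ℝ (Fin n)) 1) (ht : TwoSidedTouch u M x) :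
    (∀ i, |p i| ≤ 4 * (K + M)) ∧ ∀ i j, |A i j| ≤ M := by
  obtain ⟨hAs, hexp⟩ := hasSecondOrderExpansionAt_iff.1 hA
  obtain ⟨q, hq⟩ := ht.exists_slope hx
  -- The slope of the touching paraboloids is the gradient of the expansion, as both are first order
  -- expansions of u at x.
  have hpq : p - q = 0 := by
    refine eq_zero_of_inner_le_sq (x := x) (C := 1 / 2 * ‖formMap A‖ + 1 + M / 2) ?_
    filter_upwards [hexp 1 one_pos, isOpen_ball.eventually_mem hx] with y h1 hy
    have h2 := (abs_le.1 (hq y hy)).2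
    have h3 := (abs_le.1 h1).1
    have h4 := real_inner_le_norm (formMap A (y - x)) (y - x)
    have h4' := neg_le_of_abs_le (abs_real_inner_le_norm (formMap A (y - x)) (y - x))
    have h5 := mul_le_mul_of_nonneg_right ((formMap A).le_opNorm (y - x)) (norm_nonneg (y - x))
    rw [inner_sub_left]
    nlinarith
  rw [sub_eq_zero] at hpq
  subst hpq
  refine ⟨fun i => ?_, ?_⟩
  · exact (PiLp.norm_apply_le p i).trans (norm_slope_le_of_twoSided hM hu hx hq)
  have hlow : ∀ k, -M * ‖k‖ ^ 2 ≤ inner ℝ (formMap A k) k := by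
    intro k
    have := quadratic_ge_of_expansion (c := -(M / 2)) hexp (by
      filter_upwards [isOpen_ball.eventually_mem hx] with y hy
      linarith [(abs_le.1 (hq y hy)).1]) k
    linarith
  have hup : ∀ k, inner ℝ (formMap A k) k ≤ M * ‖k‖ ^ 2 := by
    intro k
    have := quadratic_ge_of_expansion (w := fun y => -u y) (p := -p) (L := -formMap A)
      (c := -(M / 2)) (x := x) (fun ε hε => by
        filter_upwards [hexp ε hε] with y hy
        rw [← abs_neg] at hy
        refine le_trans (le_of_eq ?_) hy
        congr 1
        simp only [neg_apply, inner_neg_left]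
        ring) (by
      filter_upwards [isOpen_ball.eventually_mem hx] with y hy
      rw [inner_neg_left]
      linarith [(abs_le.1 (hq y hy)).2]) k
    simp only [neg_apply, inner_neg_left] at this
    linarith
  intro i j
  have hAij : ∀ i j, A i j = inner ℝ (formMap A (EuclideanSpace.single i 1))
      (EuclideanSpace.single j (1 : ℝ)) := by
    intro i j
    conv_lhs => rw [← formMatrix_formMap A]
    rfl
  set e := EuclideanSpace.single i (1 : ℝ) with he
  set e' := EuclideanSpace.single j (1 : ℝ) with he'
  have hsym : inner ℝ (formMap A e') e = inner ℝ (formMap A e) e' := by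
    rw [← hAij, ← hAij]
    exact hAs.apply i j
  -- Off-diagonal entries come from polarization: the forms at e + e' and e - e' are bounded by M
  -- times squared norms whose sum is 4. This gives M itself, without a factor.
  have hpar := parallelogram_law_with_norm ℝ e e'
  have hne : ‖e‖ = 1 := by simp [he]
  have hne' : ‖e'‖ = 1 := by simp [he']
  rw [hne, hne'] at hpar
  have a1 := hlow (e + e')
  have a2 := hup (e + e')
  have a3 := hlow (e - e')
  have a4 := hup (e - e')
  simp only [map_add, map_sub, inner_add_left, inner_add_right, inner_sub_left, inner_sub_right,
    hsym] at a1 a2 a3 a4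
  rw [hAij, abs_le]
  constructor <;> nlinarith

end Slope

/-! ### Second order differentiability almost everywhere. -/

section Differentiability

variable {n : ℕ} {u : EuclideanSpace ℝ (Fin n) → ℝ} {K : ℝ}

/-- The points at distance at least `1 / (k + 1)` from the boundary of the unit ball at which `u`
is touched from both sides by paraboloids of opening `k`. -/
def regularSet (u : EuclideanSpace ℝ (Fin n) → ℝ) (k : ℕ) : Set (EuclideanSpace ℝ (Fin n)) :=
  {x | x ∈ closedBall 0 (1 - 1 / ((k : ℝ) + 1)) ∧ ∃ p : EuclideanSpace ℝ (Fin n),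
    ∀ y ∈ ball (0 : EuclideanSpace ℝ (Fin n)) 1,
      |u y - u x - inner ℝ p (y - x)| ≤ k / 2 * ‖y - x‖ ^ 2}

theorem regularSet_subset_ball (k : ℕ) : regularSet u k ⊆ ball 0 1 := by
  refine fun x hx => closedBall_subset_ball ?_ hx.1
  have : 0 < 1 / ((k : ℝ) + 1) := by positivity
  linarith

theorem isCompact_regularSet (huc : Continuous u)
    (hK : ∀ y ∈ ball (0 : EuclideanSpace ℝ (Fin n)) 1, |u y| ≤ K) (k : ℕ) :
    IsCompact (regularSet u k) := by
  have hcl : IsClosed {q : EuclideanSpace ℝ (Fin n) × EuclideanSpace ℝ (Fin n) |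
      ∀ y ∈ ball (0 : EuclideanSpace ℝ (Fin n)) 1,
        |u y - u q.1 - inner ℝ q.2 (y - q.1)| ≤ k / 2 * ‖y - q.1‖ ^ 2} := by
    simp only [Set.ofPred_forall]
    refine isClosed_iInter fun z => isClosed_iInter fun _ => ?_
    exact isClosed_le (by fun_prop) (by fun_prop)
  have hC := (((isCompact_closedBall (0 : EuclideanSpace ℝ (Fin n)) (1 - 1 / ((k : ℝ) + 1))).prod
    (isCompact_closedBall (0 : EuclideanSpace ℝ (Fin n)) (4 * (K + k)))).inter_right hcl).image
    continuous_fst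
  have heq : regularSet u k = Prod.fst '' ((closedBall 0 (1 - 1 / ((k : ℝ) + 1)) ×ˢ
      closedBall 0 (4 * (K + k))) ∩
      {q : EuclideanSpace ℝ (Fin n) × EuclideanSpace ℝ (Fin n) |
      ∀ y ∈ ball (0 : EuclideanSpace ℝ (Fin n)) 1,
        |u y - u q.1 - inner ℝ q.2 (y - q.1)| ≤ k / 2 * ‖y - q.1‖ ^ 2}) := by
    ext x
    constructor
    · rintro hx
      obtain ⟨hx1, p, hp⟩ := id hx
      refine ⟨(x, p), ⟨⟨hx1, ?_⟩, hp⟩, rfl⟩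
      rw [mem_closedBall, dist_zero_right]
      exact norm_slope_le_of_twoSided (Nat.cast_nonneg k) hK (regularSet_subset_ball k hx) hp
    · rintro ⟨⟨x, p⟩, ⟨⟨hx, -⟩, hp⟩, rfl⟩
      exact ⟨hx, p, hp⟩
  rw [heq]
  exact hC

/-- Points closer than 1/(k + 1) are compared by `norm_slope_sub_le`, which the distance to the
boundary permits. For the others the bound 8(K + k) on the difference of slopes is at most a
multiple of the distance. The extension to the whole space makes Rademacher's theorem available. -/
theorem exists_lipschitz_slope
    (hK : ∀ y ∈ ball (0 : EuclideanSpace ℝ (Fin n)) 1, |u y| ≤ K) (k : ℕ) :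
    ∃ (c : ℝ≥0) (P : EuclideanSpace ℝ (Fin n) → EuclideanSpace ℝ (Fin n)), LipschitzWith c P ∧
      ∀ x ∈ regularSet u k, ∀ y ∈ ball (0 : EuclideanSpace ℝ (Fin n)) 1,
        |u y - u x - inner ℝ (P x) (y - x)| ≤ k / 2 * ‖y - x‖ ^ 2 := by
  have h : ∀ x, ∃ p : EuclideanSpace ℝ (Fin n), x ∈ regularSet u k →
      ∀ y ∈ ball (0 : EuclideanSpace ℝ (Fin n)) 1,
        |u y - u x - inner ℝ p (y - x)| ≤ k / 2 * ‖y - x‖ ^ 2 := by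
    intro x
    by_cases hx : x ∈ regularSet u k
    · obtain ⟨p, hp⟩ := hx.2
      exact ⟨p, fun _ => hp⟩
    · exact ⟨0, fun h => absurd h hx⟩
  choose P hP using h
  have hK0 : 0 ≤ K := (abs_nonneg _).trans (hK 0 (by simp))
  have hk0 : (0 : ℝ) ≤ k := Nat.cast_nonneg k
  have hPn : ∀ x ∈ regularSet u k, ‖P x‖ ≤ 4 * (K + k) := fun x hx =>
    norm_slope_le_of_twoSided hk0 hK (regularSet_subset_ball k hx) (hP x hx)
  set c := 3 * (k : ℝ) + 8 * (K + k) * (k + 1) with hc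
  have hc0 : 0 ≤ c := by positivity
  have hL : LipschitzOnWith (Real.toNNReal c) P (regularSet u k) := by
    refine LipschitzOnWith.of_dist_le_mul fun x hx y hy => ?_
    rw [dist_eq_norm, dist_eq_norm, Real.coe_toNNReal _ hc0]
    rcases lt_or_ge ‖x - y‖ (1 / ((k : ℝ) + 1)) with hlt | hge
    · have hyn : ‖y‖ ≤ 1 - 1 / ((k : ℝ) + 1) := by simpa using hy.1
      refine (norm_slope_sub_le hk0 (by linarith) (hP x hx) (hP y hy)).trans ?_
      rw [hc]
      gcongr
      have : 0 ≤ 8 * (K + k) * (k + 1) := by positivity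
      linarith
    · have h1 : ‖P x - P y‖ ≤ 8 * (K + k) :=
        (norm_sub_le _ _).trans (by linarith [hPn x hx, hPn y hy])
      rw [div_le_iff₀ (by positivity)] at hge
      have h2 : 8 * (K + k) * 1 ≤ 8 * (K + k) * (‖x - y‖ * (k + 1)) := by gcongr
      have h3 : 0 ≤ 3 * (k : ℝ) * ‖x - y‖ := by positivity
      rw [hc]
      linarith
  obtain ⟨g, hg, hgP⟩ := hL.extend_finite_dimension
  refine ⟨_, g, hg, fun x hx => ?_⟩
  rw [← hgP hx]
  exact hP x hx

theorem expansion_of_regularSet {k : ℕ} {x : EuclideanSpace ℝ (Fin n)}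
    {P : EuclideanSpace ℝ (Fin n) → EuclideanSpace ℝ (Fin n)}
    (hP : ∀ x ∈ regularSet u k, ∀ y ∈ ball (0 : EuclideanSpace ℝ (Fin n)) 1,
        |u y - u x - inner ℝ (P x) (y - x)| ≤ k / 2 * ‖y - x‖ ^ 2)
    (hx : x ∈ regularSet u k) (hthick : IsThickAt (regularSet u k) x)
    (hd : DifferentiableAt ℝ P x) :
    HasSecondOrderExpansionAt u x (P x) (formMatrix (fderiv ℝ P x)) := by
  have hk0 : (0 : ℝ) ≤ k / 2 := by positivity
  have hU := isOpen_ball.mem_nhds (regularSet_subset_ball k hx)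
  have hd' : HasFDerivWithinAt P (fderiv ℝ P x) (regularSet u k) x :=
    hd.hasFDerivAt.hasFDerivWithinAt
  rw [hasSecondOrderExpansionAt_iff]
  refine ⟨?_, fun ε hε => ?_⟩
  · have := formMatrix_isHermitian (symmetric_of_thick hk0 hU hP hd' hthick)
    rwa [Matrix.IsHermitian, Matrix.conjTranspose_eq_transpose_of_trivial] at this
  · filter_upwards [second_order_of_thick hk0 hU hP hd' hthick hε] with y hy
    rwa [← sum_formMatrix_eq_inner, formMatrix_formMap, sum_formMatrix_eq_inner]

/-- The least admissible index is used to patch countably many measurable functions into one; points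
in none of the sets get index 0. -/
theorem exists_measurable_index {α : Type*} [MeasurableSpace α] {S : ℕ → Set α}
    (hS : ∀ k, MeasurableSet (S k)) :
    ∃ idx : α → ℕ, Measurable idx ∧ ∀ x k, x ∈ S k → x ∈ S (idx x) := by
  classical
  have hp : ∀ x, ∃ k, x ∈ S k ∨ ∀ j, x ∉ S j := by
    intro x
    by_cases h : ∃ k, x ∈ S k
    · exact h.imp fun _ => Or.inl
    · exact ⟨0, Or.inr (not_exists.1 h)⟩
  refine ⟨fun x => Nat.find (hp x), measurable_find hp fun k => ?_, fun x k hx => ?_⟩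
  · have h : {x | x ∈ S k ∨ ∀ j, x ∉ S j} = S k ∪ ⋂ j, (S j)ᶜ := by ext; simp
    rw [h]
    exact (hS k).union (MeasurableSet.iInter fun j => (hS j).compl)
  · exact (Nat.find_spec (hp x)).resolve_right fun h => h k hx

theorem measurable_apply_index {α β : Type*} [MeasurableSpace α] [MeasurableSpace β] {idx : α → ℕ}
    (hidx : Measurable idx) {F : ℕ → α → β} (hF : ∀ k, Measurable (F k)) :
    Measurable fun x => F (idx x) x :=
  (measurable_from_prod_countable_right (f := fun q : ℕ × α => F q.1 q.2) hF).comp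
    (hidx.prodMk measurable_id)

theorem exists_mem_regularSet {M : ℝ} {x : EuclideanSpace ℝ (Fin n)} (h : TwoSidedTouch u M x)
    (hx : x ∈ ball (0 : EuclideanSpace ℝ (Fin n)) 1) : ∃ k, x ∈ regularSet u k := by
  obtain ⟨p, hp⟩ := h.exists_slope hx
  have hx1 : ‖x‖ < 1 := by simpa using hx
  obtain ⟨k, hk⟩ := exists_nat_ge (max M (1 / (1 - ‖x‖)))
  refine ⟨k, ?_, p, fun y hy => (hp y hy).trans ?_⟩
  · rw [mem_closedBall, dist_zero_right]
    have h1 : 1 / (1 - ‖x‖) ≤ k + 1 := by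
      have := (le_max_right M (1 / (1 - ‖x‖))).trans hk
      linarith
    have h2 : 1 / ((k : ℝ) + 1) ≤ 1 - ‖x‖ := by
      rw [div_le_iff₀ (by linarith)] at h1
      rw [div_le_iff₀ (by positivity)]
      linarith
    linarith
  · gcongr
    exact (le_max_left _ _).trans hk

theorem measurable_formMatrix_fderiv (P : EuclideanSpace ℝ (Fin n) → EuclideanSpace ℝ (Fin n))
    (i j : Fin n) : Measurable fun x => formMatrix (fderiv ℝ P x) i j := by
  have h1 := measurable_fderiv_apply_const ℝ P (EuclideanSpace.single i (1 : ℝ))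
  have h2 : Measurable fun y : EuclideanSpace ℝ (Fin n) =>
      inner ℝ y (EuclideanSpace.single j (1 : ℝ)) := Continuous.measurable (by fun_prop)
  exact h2.comp h1

/-- A function that is touched from both sides by paraboloids almost everywhere has second order
expansions almost everywhere. -/
theorem exists_isGradHess (huc : Continuous u)
    (hK : ∀ y ∈ ball (0 : EuclideanSpace ℝ (Fin n)) 1, |u y| ≤ K)
    (hae : ∀ᵐ x ∂(volume.restrict (ball (0 : EuclideanSpace ℝ (Fin n)) 1)),
      ∃ M : ℝ, TwoSidedTouch u M x) :
    ∃ Du D2u, IsGradHess (ball 0 1) u Du D2u := by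
  have hm : ∀ k, MeasurableSet (regularSet u k) := fun k =>
    (isCompact_regularSet huc hK k).measurableSet
  obtain ⟨idx, hidx, hmem⟩ := exists_measurable_index hm
  choose c P hPL hP using exists_lipschitz_slope hK
  have hgood : ∀ k, ∀ᵐ x : EuclideanSpace ℝ (Fin n), x ∈ regularSet u k →
      HasSecondOrderExpansionAt u x (P k x) (formMatrix (fderiv ℝ (P k) x)) := by
    intro k
    filter_upwards [(hPL k).ae_differentiableAt (μ := volume),
      (ae_restrict_iff' (hm k)).1 (ae_isThickAt (regularSet u k))] with x h1 h2 hx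
    exact expansion_of_regularSet (hP k) hx (h2 hx) h1
  refine ⟨fun x => P (idx x) x, fun x => formMatrix (fderiv ℝ (P (idx x)) x), ?_, ?_, ?_⟩
  · intro i
    have h1 : Measurable fun x => P (idx x) x :=
      measurable_apply_index hidx fun k => (hPL k).continuous.measurable
    have h2 : Measurable fun y : EuclideanSpace ℝ (Fin n) => y i :=
      Continuous.measurable (by fun_prop)
    exact (h2.comp h1).aemeasurable
  · intro i j
    exact (measurable_apply_index (F := fun k x => formMatrix (fderiv ℝ (P k) x) i j) hidx
      fun k => measurable_formMatrix_fderiv (P k) i j).aemeasurable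
  · filter_upwards [hae, ae_restrict_mem measurableSet_ball,
      ae_restrict_of_ae (ae_all_iff.2 hgood)] with x ⟨M, hM⟩ hx hex
    obtain ⟨k, hk⟩ := exists_mem_regularSet hM hx
    exact hex _ (hmem x k hk)

end Differentiability

theorem HasSecondOrderExpansionAt.congr {n : ℕ} {u v : EuclideanSpace ℝ (Fin n) → ℝ}
    {x p : EuclideanSpace ℝ (Fin n)} {A : Matrix (Fin n) (Fin n) ℝ}
    (h : HasSecondOrderExpansionAt u x p A) (huv : u =ᶠ[𝓝 x] v) :
    HasSecondOrderExpansionAt v x p A := by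
  refine ⟨h.1, h.2.congr' ?_ Filter.EventuallyEq.rfl⟩
  filter_upwards [huv] with y hy
  rw [hy, huv.self_of_nhds]

/-! ### Integrability of the opening. -/

section Integrability

variable {n : ℕ} {u : EuclideanSpace ℝ (Fin n) → ℝ} {T κ C q δ K : ℝ}

/-- Geometric decay of the exceptional sets bounds the opening of the touching paraboloids by an
integrable function. -/
theorem exists_opening_majorant (hT : 0 < T) (hκ : 1 < κ) (hC : 0 ≤ C) (hq : 0 < q) (hδ : 0 < δ)
    (hK : 0 < K) (hκq : κ ^ δ * q < 1)
    (H : ∀ k : ℕ, ∃ E, MeasurableSet E ∧ volume E ≤ ENNReal.ofReal (C * q ^ k) ∧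
      ∀ x ∈ ball (0 : EuclideanSpace ℝ (Fin n)) 1, x ∉ E → TwoSidedTouch u (K * (T * κ ^ k)) x) :
    ∃ g : EuclideanSpace ℝ (Fin n) → ℝ≥0∞, Measurable g ∧
      (∫⁻ x in ball 0 1, g x) ≤ ENNReal.ofReal (T ^ δ
          * (volume (ball (0 : EuclideanSpace ℝ (Fin n)) 1)).toReal
        + (T * κ) ^ δ * C / (1 - κ ^ δ * q)) * ENNReal.ofReal (K ^ δ) ∧
      ∀ x ∈ ball (0 : EuclideanSpace ℝ (Fin n)) 1, g x ≠ ⊤ →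
        ∃ M : ℝ, 0 ≤ M ∧ TwoSidedTouch u M x ∧ ENNReal.ofReal (M ^ δ) ≤ g x := by
  choose E hE hEv hEt using H
  set t := κ ^ δ * q with ht
  have hκ0 : 0 < κ := by linarith
  have ht0 : 0 < t := by positivity
  set c := fun k : ℕ => ENNReal.ofReal ((K * (T * κ ^ k)) ^ δ) with hc
  -- If k is the first index with x ∉ E k, the opening K T κ^k has power c k. This is the leading
  -- term for k = 0, and for k > 0 the summand with index k - 1, active because x lies in E (k - 1).
  set g := fun x => c 0 + ∑' k, (E k).indicator (fun _ => c (k + 1)) x with hg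
  have hind : ∀ k, Measurable ((E k).indicator fun _ : EuclideanSpace ℝ (Fin n) => c (k + 1)) :=
    fun k => measurable_const.indicator (hE k)
  refine ⟨g, measurable_const.add (Measurable.tsum hind), ?_, fun x hx hgx => ?_⟩
  · have hpow : ∀ k : ℕ, (K * (T * κ ^ k)) ^ δ = K ^ δ * (T ^ δ * (κ ^ δ) ^ k) := by
      intro k
      rw [Real.mul_rpow hK.le (by positivity), Real.mul_rpow hT.le (by positivity),
        ← Real.rpow_natCast, ← Real.rpow_natCast, ← Real.rpow_mul hκ0.le, ← Real.rpow_mul hκ0.le,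
        mul_comm δ]
    have h1 : ∫⁻ x in ball 0 1, g x ≤ c 0 * volume (ball (0 : EuclideanSpace ℝ (Fin n)) 1)
        + ∑' k, c (k + 1) * volume (E k) := by
      simp only [hg]
      rw [lintegral_add_left measurable_const, setLIntegral_const,
        lintegral_tsum fun k => (hind k).aemeasurable]
      refine add_le_add le_rfl (ENNReal.tsum_le_tsum fun k => ?_)
      rw [lintegral_indicator (hE k), setLIntegral_const]
      gcongr
      exact Measure.restrict_le_self
    have h2 : ∀ k : ℕ, c (k + 1) * volume (E k)
        ≤ ENNReal.ofReal (K ^ δ * ((T * κ) ^ δ * C) * t ^ k) := by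
      intro k
      refine (mul_le_mul_right (hEv k) _).trans (le_of_eq ?_)
      simp only [hc]
      rw [← ENNReal.ofReal_mul (by positivity), hpow, Real.mul_rpow hT.le hκ0.le, ht]
      congr 1
      ring
    have h3 : HasSum (fun k : ℕ => K ^ δ * ((T * κ) ^ δ * C) * t ^ k)
        (K ^ δ * ((T * κ) ^ δ * C) * (1 - t)⁻¹) :=
      (hasSum_geometric_of_lt_one ht0.le hκq).mul_left _
    have h4 : ∑' k, c (k + 1) * volume (E k)
        ≤ ENNReal.ofReal (K ^ δ * ((T * κ) ^ δ * C) * (1 - t)⁻¹) := by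
      rw [← h3.tsum_eq, ENNReal.ofReal_tsum_of_nonneg (fun k => by positivity) h3.summable]
      exact ENNReal.tsum_le_tsum h2
    refine h1.trans ((add_le_add le_rfl h4).trans (le_of_eq ?_))
    have h1t : 0 < 1 - t := by linarith
    have hV : volume (ball (0 : EuclideanSpace ℝ (Fin n)) 1)
        = ENNReal.ofReal (volume (ball (0 : EuclideanSpace ℝ (Fin n)) 1)).toReal :=
      (ENNReal.ofReal_toReal measure_ball_lt_top.ne).symm
    simp only [hc]
    rw [hpow 0]
    conv_lhs => rw [hV]
    rw [← ENNReal.ofReal_mul (by positivity), ← ENNReal.ofReal_add (by positivity) (by positivity),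
      ← ENNReal.ofReal_mul (by positivity)]
    congr 1
    simp only [pow_zero, mul_one]
    field_simp
  -- At a point of every E k all summands are at least c 0 > 0, so g is infinite there.
  · have hex : ∃ k, x ∉ E k := by
      by_contra! hall
      refine hgx (ENNReal.add_eq_top.2 (Or.inr ?_))
      have h1 : ∀ k, c 0 ≤ (E k).indicator (fun _ => c (k + 1)) x := by
        intro k
        rw [Set.indicator_of_mem (hall k)]
        simp only [hc, pow_zero]
        gcongr
        exact one_le_pow₀ hκ.le
      have h2 : c 0 ≠ 0 := by
        simp only [hc, ne_eq, ENNReal.ofReal_eq_zero, not_le]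
        positivity
      exact top_le_iff.1 ((ENNReal.tsum_const_eq_top_of_ne_zero h2).symm.le.trans
        (ENNReal.tsum_le_tsum h1))
    classical
    refine ⟨K * (T * κ ^ Nat.find hex), by positivity, hEt _ x hx (Nat.find_spec hex), ?_⟩
    rcases hfind : Nat.find hex with _ | k
    · exact le_self_add
    · have hk : x ∈ E k := by
        by_contra hcon
        have := Nat.find_min' hex hcon
        omega
      refine le_trans (le_of_eq ?_) (le_add_left (ENNReal.le_tsum k))
      rw [Set.indicator_of_mem hk]

theorem paraboloidOpening_le {M : ℝ} {x : EuclideanSpace ℝ (Fin n)} (hM : 0 ≤ M)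
    (hx : x ∈ ball (0 : EuclideanSpace ℝ (Fin n)) 1) (h : TwoSidedTouch u M x) :
    paraboloidOpening u (ball 0 1) x ≤ ENNReal.ofReal M := by
  obtain ⟨⟨p, hp⟩, q, hq⟩ := h
  refine iInf₂_le (⟨M, hM⟩ : ℝ≥0) ⟨⟨p, hx, by simp, fun y hy => hp y hy⟩, q, hx, by simp,
    fun y hy => hq y hy⟩ |>.trans (le_of_eq ?_)
  rw [ENNReal.ofReal, Real.toNNReal_of_nonneg hM]
  rfl

end Integrability

section Estimate

variable {n : ℕ} {u : EuclideanSpace ℝ (Fin n) → ℝ} {δ K : ℝ}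

/-- A function continuous in the unit ball is bounded there by its essential supremum. -/
theorem abs_le_of_eLpNorm_top_le {g : EuclideanSpace ℝ (Fin n) → ℝ}
    (hg : ContinuousOn g (ball 0 1)) (hK : 0 ≤ K)
    (h : eLpNorm g ∞ (volume.restrict (ball 0 1)) ≤ ENNReal.ofReal K) :
    ∀ x ∈ ball (0 : EuclideanSpace ℝ (Fin n)) 1, |g x| ≤ K := by
  have ho : IsOpen (ball (0 : EuclideanSpace ℝ (Fin n)) 1 ∩ (fun x => |g x|) ⁻¹' Set.Ioi K) :=
    hg.abs.isOpen_inter_preimage isOpen_ball isOpen_Ioi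
  have hae : ∀ᵐ x ∂(volume.restrict (ball (0 : EuclideanSpace ℝ (Fin n)) 1)), |g x| ≤ K := by
    filter_upwards [enorm_ae_le_eLpNormEssSup g
      (volume.restrict (ball (0 : EuclideanSpace ℝ (Fin n)) 1))] with x hx
    rw [← eLpNorm_exponent_top] at hx
    have := hx.trans h
    rwa [Real.enorm_eq_ofReal_abs, ENNReal.ofReal_le_ofReal_iff hK] at this
  have h0 : volume (ball (0 : EuclideanSpace ℝ (Fin n)) 1 ∩ (fun x => |g x|) ⁻¹' Set.Ioi K)
      = 0 := by
    refine measure_mono_null (fun x hx => ?_) (ae_iff.1 ((ae_restrict_iff' measurableSet_ball).1 hae))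
    exact fun hcon => absurd (hcon hx.1) (not_le.2 hx.2)
  intro x hx
  by_contra! hcon
  have hmem : x ∈ ball (0 : EuclideanSpace ℝ (Fin n)) 1 ∩ (fun x => |g x|) ⁻¹' Set.Ioi K :=
    ⟨hx, hcon⟩
  rw [(ho.measure_eq_zero_iff volume).1 h0] at hmem
  exact hmem

theorem abs_le_on_closedBall (hu : ContinuousOn u (closedBall 0 1))
    (h : ∀ x ∈ ball (0 : EuclideanSpace ℝ (Fin n)) 1, |u x| ≤ K) :
    ∀ x ∈ closedBall (0 : EuclideanSpace ℝ (Fin n)) 1, |u x| ≤ K := by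
  intro x hx
  have hcl : closure (ball (0 : EuclideanSpace ℝ (Fin n)) 1) = closedBall 0 1 :=
    closure_ball _ one_ne_zero
  rw [← hcl] at hu hx
  exact le_on_closure h hu.abs continuousOn_const hx

/-- An integrable bound for the opening of two-sided touching paraboloids yields second order
Sobolev regularity. -/
theorem sobolev_of_opening_majorant {g : EuclideanSpace ℝ (Fin n) → ℝ≥0∞} {a c : ℝ≥0∞}
    (huc : ContinuousOn u (closedBall 0 1)) (hK : 0 ≤ K)
    (hu : ∀ y ∈ closedBall (0 : EuclideanSpace ℝ (Fin n)) 1, |u y| ≤ K)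
    (hδ0 : 0 < δ) (hδ1 : δ ≤ 1) (ha : a ≠ ⊤) (hgm : Measurable g)
    (hgi : ∫⁻ x in ball 0 1, g x ≤ a * ENNReal.ofReal K ^ δ)
    (hg : ∀ x ∈ ball (0 : EuclideanSpace ℝ (Fin n)) 1, g x ≠ ⊤ →
        ∃ M : ℝ, 0 ≤ M ∧ TwoSidedTouch u M x ∧ ENNReal.ofReal M ^ δ ≤ g x)
    (hc : c = volume (ball (0 : EuclideanSpace ℝ (Fin n)) 1)
      + n * (4 * (volume (ball (0 : EuclideanSpace ℝ (Fin n)) 1) + a)) + n * (n * a) + a) :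
    MemSobolevTwo δ (ball 0 1) u ∧
      sobolevTwoNorm δ (ball 0 1) u ≤ c ^ (1 / δ) * ENNReal.ofReal K ∧
      (∫⁻ x in ball 0 1, paraboloidOpening u (ball 0 1) x ^ δ) ^ (1 / δ)
        ≤ c ^ (1 / δ) * ENNReal.ofReal K := by
  set V := volume (ball (0 : EuclideanSpace ℝ (Fin n)) 1) with hV
  set k := ENNReal.ofReal K ^ δ with hk
  have hVt : V ≠ ⊤ := measure_ball_lt_top.ne
  have hkt : k ≠ ⊤ := ENNReal.rpow_ne_top_of_nonneg hδ0.le ENNReal.ofReal_ne_top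
  have hub : ∀ y ∈ ball (0 : EuclideanSpace ℝ (Fin n)) 1, |u y| ≤ K := fun y hy =>
    hu y (ball_subset_closedBall hy)
  have hball := ae_restrict_mem (μ := volume)
    (measurableSet_ball (x := (0 : EuclideanSpace ℝ (Fin n))) (ε := 1))
  have hgae : ∀ᵐ x ∂(volume.restrict (ball (0 : EuclideanSpace ℝ (Fin n)) 1)), g x < ⊤ :=
    ae_lt_top hgm (hgi.trans_lt (ENNReal.mul_lt_top ha.lt_top hkt.lt_top)).ne
  have hroot : (c * k) ^ (1 / δ) = c ^ (1 / δ) * ENNReal.ofReal K := by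
    rw [ENNReal.mul_rpow_of_nonneg _ _ (by positivity), hk, ← ENNReal.rpow_mul,
      mul_one_div_cancel hδ0.ne', ENNReal.rpow_one]
  -- Values of u outside the closed ball are arbitrary, while `exists_isGradHess` wants continuity
  -- everywhere.
  obtain ⟨v, hv, hvu⟩ := exists_continuous_extension huc
  have hvu' : ∀ x ∈ ball (0 : EuclideanSpace ℝ (Fin n)) 1, v x = u x := fun x hx =>
    hvu x (ball_subset_closedBall hx)
  obtain ⟨Du, D2u, hm1, hm2, hexp⟩ : ∃ Du D2u, IsGradHess (ball 0 1) u Du D2u := by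
    obtain ⟨Du, D2u, h1, h2, h3⟩ := exists_isGradHess (u := v) (K := K) hv
      (fun y hy => by rw [hvu' y hy]; exact hub y hy) (by
        filter_upwards [hgae, hball] with x hx hxb
        obtain ⟨M, -, ⟨⟨p, hp⟩, r, hr⟩, -⟩ := hg x hxb hx.ne
        refine ⟨M, ⟨p, fun y hy => ?_⟩, r, fun y hy => ?_⟩
        · rw [hvu' y hy, hvu' x hxb]
          exact hp y hy
        · rw [hvu' y hy, hvu' x hxb]
          exact hr y hy)
    refine ⟨Du, D2u, h1, h2, ?_⟩
    filter_upwards [h3, hball] with x hx hxb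
    refine hx.congr ?_
    filter_upwards [isOpen_ball.eventually_mem hxb] with y hy using hvu' y hy
  have hbound : ∀ᵐ x ∂(volume.restrict (ball (0 : EuclideanSpace ℝ (Fin n)) 1)),
      (∀ i, ‖Du x i‖ₑ ^ δ ≤ 4 * (k + g x)) ∧ ∀ i j, ‖D2u x i j‖ₑ ^ δ ≤ g x := by
    filter_upwards [hgae, hball, hexp] with x hx hxb hxe
    obtain ⟨M, hM, hMt, hMg⟩ := hg x hxb hx.ne
    obtain ⟨h1, h2⟩ := expansion_bounds hxe hM hub hxb hMt
    refine ⟨fun i => ?_, fun i j => ?_⟩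
    · have h3 : ‖Du x i‖ₑ ≤ 4 * (ENNReal.ofReal K + ENNReal.ofReal M) := by
        rw [Real.enorm_eq_ofReal_abs, ← ENNReal.ofReal_add hK hM]
        refine (ENNReal.ofReal_le_ofReal (h1 i)).trans (le_of_eq ?_)
        rw [ENNReal.ofReal_mul (by norm_num)]
        norm_num
      -- For δ ≤ 1 the power is subadditive, which separates the bound of u from the opening.
      calc ‖Du x i‖ₑ ^ δ ≤ (4 * (ENNReal.ofReal K + ENNReal.ofReal M)) ^ δ := by gcongr
        _ = 4 ^ δ * (ENNReal.ofReal K + ENNReal.ofReal M) ^ δ :=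
          ENNReal.mul_rpow_of_nonneg _ _ hδ0.le
        _ ≤ 4 ^ (1 : ℝ) * (ENNReal.ofReal K ^ δ + ENNReal.ofReal M ^ δ) := by
          refine mul_le_mul' (ENNReal.rpow_le_rpow_of_exponent_le (by norm_num) hδ1)
            (ENNReal.rpow_add_le_add_rpow _ _ hδ0.le hδ1)
        _ ≤ 4 * (k + g x) := by
          rw [ENNReal.rpow_one]
          gcongr
    · refine le_trans ?_ hMg
      rw [Real.enorm_eq_ofReal_abs]
      gcongr
      exact h2 i j
  have hu1 : ∫⁻ x in ball 0 1, ‖u x‖ₑ ^ δ ≤ V * k := by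
    calc ∫⁻ x in ball 0 1, ‖u x‖ₑ ^ δ ≤ ∫⁻ _ in ball (0 : EuclideanSpace ℝ (Fin n)) 1, k := by
          refine setLIntegral_mono measurable_const fun x hx => ?_
          rw [hk, Real.enorm_eq_ofReal_abs]
          gcongr
          exact hub x hx
      _ = V * k := by rw [setLIntegral_const, mul_comm]
  have hD1 : ∀ i, ∫⁻ x in ball 0 1, ‖Du x i‖ₑ ^ δ ≤ 4 * (V + a) * k := by
    intro i
    calc ∫⁻ x in ball 0 1, ‖Du x i‖ₑ ^ δ
        ≤ ∫⁻ x in ball (0 : EuclideanSpace ℝ (Fin n)) 1, 4 * (k + g x) :=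
          lintegral_mono_ae (hbound.mono fun x hx => hx.1 i)
      _ = 4 * (k * V + ∫⁻ x in ball 0 1, g x) := by
          rw [lintegral_const_mul _ (by fun_prop), lintegral_add_left measurable_const,
            setLIntegral_const]
      _ ≤ 4 * (k * V + a * k) := by gcongr
      _ = 4 * (V + a) * k := by ring
  have hD2 : ∀ i j, ∫⁻ x in ball 0 1, ‖D2u x i j‖ₑ ^ δ ≤ a * k := fun i j =>
    (lintegral_mono_ae (hbound.mono fun x hx => hx.2 i j)).trans hgi
  have hlp : ∀ w : EuclideanSpace ℝ (Fin n) → ℝ,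
      AEStronglyMeasurable w (volume.restrict (ball 0 1)) →
      ∫⁻ x in ball 0 1, ‖w x‖ₑ ^ δ < ⊤ →
        MemLp w (ENNReal.ofReal δ) (volume.restrict (ball 0 1)) := by
    intro w hw hlt
    refine ⟨hw, ?_⟩
    rwa [eLpNorm_lt_top_iff_lintegral_rpow_enorm_lt_top (by simpa using hδ0) ENNReal.ofReal_ne_top,
      ENNReal.toReal_ofReal hδ0.le]
  refine ⟨⟨Du, D2u, ⟨hm1, hm2, hexp⟩, hlp u ?_ ?_, fun i => hlp _ (hm1 i).aestronglyMeasurable ?_,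
    fun i j => hlp _ (hm2 i j).aestronglyMeasurable ?_⟩, ?_, ?_⟩
  · exact (huc.mono ball_subset_closedBall).aestronglyMeasurable measurableSet_ball
  · exact hu1.trans_lt (ENNReal.mul_lt_top hVt.lt_top hkt.lt_top)
  · refine (hD1 i).trans_lt (ENNReal.mul_lt_top (ENNReal.mul_lt_top (by simp) ?_) hkt.lt_top)
    exact ENNReal.add_lt_top.2 ⟨hVt.lt_top, ha.lt_top⟩
  · exact (hD2 i j).trans_lt (ENNReal.mul_lt_top ha.lt_top hkt.lt_top)
  · rw [← hroot]
    rw [sobolevTwoNorm]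
    refine iInf_le_of_le Du (iInf_le_of_le D2u (iInf_le_of_le ⟨hm1, hm2, hexp⟩ ?_))
    gcongr
    calc _ ≤ V * k + ∑ _i : Fin n, 4 * (V + a) * k + ∑ _i : Fin n, ∑ _j : Fin n, a * k := by
          gcongr with i _ i _ j _
          · exact hD1 i
          · exact hD2 i j
      _ = (V + n * (4 * (V + a)) + n * (n * a)) * k := by
          simp only [Finset.sum_const, Finset.card_univ, Fintype.card_fin, nsmul_eq_mul]
          ring
      _ ≤ c * k := mul_le_mul_left (hc ▸ le_self_add) k
  · rw [← hroot]
    gcongr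
    calc _ ≤ ∫⁻ x in ball 0 1, g x := by
          refine setLIntegral_mono hgm fun x hx => ?_
          by_cases hgx : g x = ⊤
          · rw [hgx]
            exact le_top
          obtain ⟨M, hM, hMt, hMg⟩ := hg x hx hgx
          refine le_trans ?_ hMg
          gcongr
          exact paraboloidOpening_le hM hx hMt
      _ ≤ a * k := hgi
      _ ≤ c * k := by
          rw [hc]
          gcongr
          exact le_add_self

end Estimate

/-! ### The exponent and the conclusion. -/

/-- After taking logarithms the condition is δ < -log q / log κ. -/
theorem exists_integrability_exponent {κ q : ℝ} (hκ : 1 < κ) (hq0 : 0 < q) (hq1 : q < 1) :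
    ∃ σ : ℝ, 0 < σ ∧ σ ≤ 1 ∧ ∀ δ < σ, κ ^ δ * q < 1 := by
  have hlk : 0 < Real.log κ := Real.log_pos hκ
  have hlq : Real.log q < 0 := Real.log_neg hq0 hq1
  refine ⟨min 1 (-Real.log q / Real.log κ), lt_min one_pos (div_pos (by linarith) hlk),
    min_le_left _ _, fun δ hδ => ?_⟩
  have h1 : δ < -Real.log q / Real.log κ := hδ.trans_le (min_le_right _ _)
  rw [lt_div_iff₀ hlk] at h1
  have hκ0 : 0 < κ := by linarith
  rw [← Real.log_neg_iff (by positivity), Real.log_mul (by positivity) hq0.ne', Real.log_rpow hκ0]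
  linarith

theorem theorem1p1 (n : ℕ) (hn : 1 ≤ n) (lam Lam : ℝ) (hlam : 0 < lam) (hLam : lam ≤ Lam) :
    ∃ σ : ℝ, 0 < σ ∧ σ ≤ 1 ∧ ∀ δ : ℝ, 0 < δ → δ < σ →
      ∃ C : ℝ, 0 < C ∧ ∀ γ : ℝ, 0 ≤ γ → γ < 1 →
        ∀ u f : EuclideanSpace ℝ (Fin n) → ℝ,
          ContinuousOn u (closedBall 0 1) →
          ContinuousOn f (ball 0 1) →
          MemLp f ∞ (volume.restrict (ball 0 1)) →
          IsViscositySupersol lam Lam γ (ball 0 1) f u →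
          IsViscositySubsol lam Lam γ (ball 0 1) f u →
          MemSobolevTwo δ (ball 0 1) u ∧
          sobolevTwoNorm δ (ball 0 1) u ≤
            ENNReal.ofReal C * (eLpNorm u ∞ (volume.restrict (ball 0 1))
              + eLpNorm f ∞ (volume.restrict (ball 0 1)) ^ (1 / (1 - γ))) ∧
          (∫⁻ x in ball 0 1, paraboloidOpening u (ball 0 1) x ^ δ) ^ (1 / δ) ≤
            ENNReal.ofReal C * (eLpNorm u ∞ (volume.restrict (ball 0 1))
              + eLpNorm f ∞ (volume.restrict (ball 0 1)) ^ (1 / (1 - γ))) := by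
  obtain ⟨T, κ, C₀, q, hT, hκ, hC₀, hq0, hq1, H⟩ := exists_twoSidedTouch_decay n hlam hLam
  obtain ⟨σ, hσ0, hσ1, hσ⟩ := exists_integrability_exponent hκ hq0 hq1
  refine ⟨σ, hσ0, hσ1, fun δ hδ0 hδσ => ?_⟩
  obtain ⟨a, hat, ha⟩ : ∃ a : ℝ≥0∞, a ≠ ⊤ ∧ a = ENNReal.ofReal (T ^ δ
      * (volume (ball (0 : EuclideanSpace ℝ (Fin n)) 1)).toReal
        + (T * κ) ^ δ * C₀ / (1 - κ ^ δ * q)) := ⟨_, ENNReal.ofReal_ne_top, rfl⟩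
  obtain ⟨c, hc⟩ : ∃ c : ℝ≥0∞, c = volume (ball (0 : EuclideanSpace ℝ (Fin n)) 1)
      + n * (4 * (volume (ball (0 : EuclideanSpace ℝ (Fin n)) 1) + a)) + n * (n * a) + a :=
    ⟨_, rfl⟩
  have hV : volume (ball (0 : EuclideanSpace ℝ (Fin n)) 1) ≠ ⊤ := measure_ball_lt_top.ne
  have hct : c ≠ ⊤ := by
    rw [hc]
    finiteness
  have hct' : c ^ (1 / δ) ≠ ⊤ := ENNReal.rpow_ne_top_of_nonneg (by positivity) hct
  -- Adding 1 only serves to make C visibly positive; C is fixed before γ is introduced.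
  refine ⟨(c ^ (1 / δ)).toReal + 1, by positivity, fun γ hγ0 hγ1 u f huc hfc hf hsup hsub => ?_⟩
  have hcC : c ^ (1 / δ) ≤ ENNReal.ofReal ((c ^ (1 / δ)).toReal + 1) := by
    rw [ENNReal.le_ofReal_iff_toReal_le hct' (by positivity)]
    linarith
  set C := (c ^ (1 / δ)).toReal + 1
  have hγ : 0 < 1 - γ := by linarith
  set N := eLpNorm u ∞ (volume.restrict (ball 0 1))
    + eLpNorm f ∞ (volume.restrict (ball 0 1)) ^ (1 / (1 - γ)) with hN
  have hNt : N ≠ ⊤ := by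
    obtain ⟨K, hK⟩ := (isCompact_closedBall (0 : EuclideanSpace ℝ (Fin n)) 1)
      |>.exists_bound_of_continuousOn huc
    refine ENNReal.add_ne_top.2 ⟨?_, ENNReal.rpow_ne_top_of_nonneg (by positivity) hf.2.ne⟩
    rw [eLpNorm_exponent_top]
    refine (eLpNormEssSup_lt_top_of_ae_bound (C := K) ?_).ne
    filter_upwards [ae_restrict_mem measurableSet_ball] with x hx
    exact hK x (ball_subset_closedBall hx)
  -- The strict inequality gives K > 0, needed to divide by K even if u and f vanish. Letting K
  -- decrease to N removes the excess.
  have key : ∀ K : ℝ, N.toReal < K → MemSobolevTwo δ (ball 0 1) u ∧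
      sobolevTwoNorm δ (ball 0 1) u ≤ ENNReal.ofReal C * ENNReal.ofReal K ∧
      (∫⁻ x in ball 0 1, paraboloidOpening u (ball 0 1) x ^ δ) ^ (1 / δ)
        ≤ ENNReal.ofReal C * ENNReal.ofReal K := by
    intro K hK
    have hK0 : 0 < K := ENNReal.toReal_nonneg.trans_lt hK
    have hNK : N ≤ ENNReal.ofReal K := (ENNReal.le_ofReal_iff_toReal_le hNt hK0.le).2 hK.le
    have huK := abs_le_on_closedBall huc (abs_le_of_eLpNorm_top_le
      (huc.mono ball_subset_closedBall) hK0.le (le_self_add.trans hNK))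
    have hfK : ∀ x ∈ ball (0 : EuclideanSpace ℝ (Fin n)) 1, |f x| ≤ K ^ (1 - γ) := by
      refine abs_le_of_eLpNorm_top_le hfc (by positivity) ?_
      rw [← ENNReal.ofReal_rpow_of_pos hK0, ← ENNReal.rpow_inv_le_iff hγ, ← one_div]
      exact le_add_self.trans hNK
    obtain ⟨g, hgm, hgi, hg⟩ := exists_opening_majorant hT hκ hC₀ hq0 hδ0 hK0 (hσ δ hδσ)
      (H u K hK0 huc huK (subjetBound_of_supersol hlam hLam hγ0 hγ1 hK0.le huc hfK hsup)
        (subjetBound_of_subsol hlam hLam hγ0 hγ1 hK0.le huc hfK hsub))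
    rw [← ha, ← ENNReal.ofReal_rpow_of_pos hK0] at hgi
    obtain ⟨h1, h2, h3⟩ := sobolev_of_opening_majorant huc hK0.le huK hδ0 (hδσ.le.trans hσ1) hat
      hgm hgi (fun x hx hgx => by
        obtain ⟨M, hM, hMt, hMg⟩ := hg x hx hgx
        exact ⟨M, hM, hMt, by rwa [ENNReal.ofReal_rpow_of_nonneg hM hδ0.le]⟩) hc
    exact ⟨h1, h2.trans (by gcongr), h3.trans (by gcongr)⟩
  have hlim : Filter.Tendsto (fun K : ℝ => ENNReal.ofReal C * ENNReal.ofReal K)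
      (𝓝[>] N.toReal) (𝓝 (ENNReal.ofReal C * N)) := by
    refine ENNReal.Tendsto.const_mul ?_ (Or.inr ENNReal.ofReal_ne_top)
    have := (ENNReal.continuous_ofReal.tendsto N.toReal).mono_left
      (nhdsWithin_le_nhds (s := Set.Ioi N.toReal))
    rwa [ENNReal.ofReal_toReal hNt] at this
  refine ⟨(key (N.toReal + 1) (by linarith)).1, ge_of_tendsto hlim ?_, ge_of_tendsto hlim ?_⟩
  · filter_upwards [self_mem_nhdsWithin] with K hK using (key K hK).2.1
  · filter_upwards [self_mem_nhdsWithin] with K hK using (key K hK).2.2
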